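/- Let $n\ge 3$, let $P\subset\mathbb{R}^2$ be a set of $n$ distinct points, and let $u:\mathbb{R}^2\setminus P\to\mathbb{R}$ be a $C^2$ function with $u_{xx}u_{yy}-u_{xy}^2=0$ on $\mathbb{R}^2\setminus P$ which cannot be extended as a $C^2$ function to any of the points of $P$. Here "linear" means "of the form $(x,y)\mapsto ax+by+c$". Assume that $u$ is admissible, that is, there is no half-strip (the open region bounded by two parallel half-lines and the segment joining their end points) contained in $\mathbb{R}^2\setminus P$ on which $u$ is linear. Then: 1. The points of $P$ are exactly the vertices of a compact convex polygon $C$ with nonempty interior, and $u$ is linear on $C$: there is a linear function $g$ such that $u=g$ on $C\setminus P$ and $u(z)\to g(p)$ as $z\to p$ for every $p\in P$ (so that $u$, extended continuously to $P$, coincides with $g$ on $C$). 2. The points of $P$ can be numbered $p_1,\dots,p_n$ following one of the two orientations of $\partial C$ (with $p_0:=p_n$, $p_{n+1}:=p_1$) in such a way that, for every $i$, $u$ is a conical function with vertex $p_i$ on the open sector $$S_i=\{\,p_i+s\,(p_{i+1}-p_i)+t\,(p_i-p_{i-1}) : s,t>0\,\},$$ which is bounded by the half-line from $p_i$ through $p_{i+1}$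 and by the half-line that extends the segment $p_{i-1}p_i$ beyond $p_i$. Conical means that $S_i=\{p_i+\rho(\cos\theta,\sin\theta):\rho>0,\ \theta_1<\theta<\theta_2\}$ for some $\theta_1<\theta_2<\theta_1+2\pi$, and that there are a constant $u_0$ and a $C^2$ function $\alpha$ on $(\theta_1,\theta_2)$ with $u(p_i+\rho(\cos\theta,\sin\theta))=u_0+\rho\,\alpha(\theta)$ for all $\rho>0$ and $\theta_1<\theta<\theta_2$. -/

import Mathlib

open Set Filter Topology

/-- The Euclidean plane with coordinates `x = z 0` and `y = z 1`. -/
abbrev Plane : Type := EuclideanSpace ℝ (Fin 2)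

/-- The partial derivative of `f` in the `i`-th coordinate. -/
noncomputable def partialDeriv (i : Fin 2) (f : Plane → ℝ) : Plane → ℝ :=
  fun z => fderiv ℝ f z (EuclideanSpace.single i 1)

/-- The expression `u_xx u_yy - u_xy ^ 2`. -/
noncomputable def mongeAmpere (u : Plane → ℝ) (z : Plane) : ℝ :=
  partialDeriv 0 (partialDeriv 0 u) z * partialDeriv 1 (partialDeriv 1 u) z
    - (partialDeriv 1 (partialDeriv 0 u) z) ^ 2

/-- `u`, regarded as a function on a punctured neighbourhood of `a`, has no `C²` extension
to `a`. The value of the total function `u` at `a` plays no role. -/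
def IsSingularAt (u : Plane → ℝ) (a : Plane) : Prop :=
  ¬ ∃ v : Plane → ℝ, ContDiffAt ℝ 2 v a ∧ v =ᶠ[𝓝[≠] a] u

/-- `u` is a `C²` solution of the degenerate Monge-Ampère equation on the complement of `P`, with a
genuine singularity at every point of `P`. The values of `u` on `P` play no role. -/
structure IsSolutionOff (u : Plane → ℝ) (P : Set Plane) : Prop where
  contDiffOn : ContDiffOn ℝ 2 u Pᶜ
  equation : ∀ z ∈ Pᶜ, mongeAmpere u z = 0
  singular : ∀ a ∈ P, IsSingularAt u a

/-- `u` is linear, in the sense of a polynomial of degree at most one, on `A`. -/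
def IsLinearOn (u : Plane → ℝ) (A : Set Plane) : Prop :=
  ∃ g : Plane →ᵃ[ℝ] ℝ, EqOn u g A

/-- The open half-strip bounded by the segment from `a` to `a + d` and by the two parallel
half-lines with direction `v` issuing from its end points. -/
def halfStrip (a d v : Plane) : Set Plane :=
  {z | ∃ s ∈ Ioo (0 : ℝ) 1, ∃ t : ℝ, 0 < t ∧ z = a + s • d + t • v}

/-- There is no half-strip in the complement of `P` on which `u` is linear. -/
def IsAdmissible (u : Plane → ℝ) (P : Set Plane) : Prop :=
  ∀ a d v : Plane, LinearIndependent ℝ ![d, v] → halfStrip a d v ⊆ Pᶜ →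
    ¬ IsLinearOn u (halfStrip a d v)

/-- A compact convex polygon, possibly degenerate: the convex hull of finitely many points. -/
def IsConvexPolygon (C : Set Plane) : Prop :=
  ∃ F : Finset Plane, C = convexHull ℝ (F : Set Plane)

/-- The unit vector of angle `θ`. -/
noncomputable def unitVec (θ : ℝ) : Plane := !₂[Real.cos θ, Real.sin θ]

/-- The open sector with vertex `a` between the angles `θ₁` and `θ₂`. -/
def openSector (a : Plane) (θ₁ θ₂ : ℝ) : Set Plane :=
  {z | ∃ ρ : ℝ, 0 < ρ ∧ ∃ θ ∈ Ioo θ₁ θ₂, z = a + ρ • unitVec θ}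

/-- `S` is an open sector with vertex `a`, and `u` is conical on it: in polar coordinates centred
at `a` it is a constant plus `ρ` times a `C²` function of the angle. -/
def IsConicalOn (u : Plane → ℝ) (a : Plane) (S : Set Plane) : Prop :=
  ∃ θ₁ θ₂ : ℝ, 0 < θ₂ - θ₁ ∧ θ₂ - θ₁ < 2 * Real.pi ∧ S = openSector a θ₁ θ₂ ∧
    ∃ (u₀ : ℝ) (α : ℝ → ℝ), ContDiffOn ℝ 2 α (Ioo θ₁ θ₂) ∧
      ∀ ρ : ℝ, 0 < ρ → ∀ θ ∈ Ioo θ₁ θ₂, u (a + ρ • unitVec θ) = u₀ + ρ * α θ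

/-- The open convex sector with vertex `a` bounded by the half-lines issuing from `a` in the
directions `v` and `w` (which are linearly independent in the intended use). -/
def sectorBetween (a v w : Plane) : Set Plane :=
  {z | ∃ s : ℝ, 0 < s ∧ ∃ t : ℝ, 0 < t ∧ z = a + s • v + t • w}

/-- Consecutive points of the cyclic list `q` are joined by sides of `C`. When `q` lists every
vertex of a convex polygon `C` with nonempty interior exactly once, this says that `q` runs once
around the boundary of `C` in one of its two orientations. -/
def FollowsBoundary {n : ℕ} [NeZero n] (q : Fin n → Plane) (C : Set Plane) : Prop :=
  ∀ i : Fin n, segment ℝ (q i) (q (i + 1)) ⊆ frontier C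

/-!
A solution `u` of the degenerate equation has a Hessian of rank at most one. Where the Hessian does
not vanish, its kernel is tangent to a foliation by straight *leaves*, and along a leaf the reciprocal
of the trace of the Hessian is an affine function (Hartman-Nirenberg, `exists_affine_lap`). So the
Hessian cannot degenerate along a leaf, and a leaf only ends at a point of the singular set `P`. All
of the geometry below comes from this, together with the fact that leaves do not cross, and from
two principles.

* If the kernels of the Hessian have a limit direction at `q ∈ P`, then `u` has a `C²` extension to
  `q`, which is excluded (`not_kernelTendsTo`). Indeed, the trace of the Hessian at a point close to
  `q` is the harmonic mean of its values at the end points of a leaf segment of fixed length, so that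
  it has a limit, as does the Hessian.
* Admissibility: every half-strip in the domain meets a leaf (`exists_lap_ne_zero_of_halfStrip`).

Consider a line that supports `P`. The leaves that cross it transversally on the free side
have monotone slopes, and admissibility makes them accumulate in every gap. If there were such leaves
on both sides of the contact point `q`, they would have a common limit slope at `q`, and they would
force all kernels near `q` to converge to it. Hence one of the two rays of the supporting line that
issue from `P` consists of null vectors of the Hessian (`tangentRays_union`).

If both rays of a supporting line are null, then there are lines parallel to it consisting of
entire leaves, densely in the strip spanned by `P` (`exists_nullLine`). Such lines isolate and remove
singular points, or are crossed by similar lines in another direction. When `P` is not collinear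
this is contradictory, and by connectedness the null rays have the same orientation on all supporting
lines (`tangentRays_eq_univ`). When `P` is collinear with at least three points, the
same arguments show that the leaves on each side of the line issue from one end point, and a middle
point is removable (`exists_cross_lt`).

So there is a tangent ray in every direction, and these rays sweep the exterior of the convex hull `C`
of `P`. A leaf through an interior point of `C` would have to leave `C` along a supporting line, so
`u` is affine on `C`. By the first principle, all points of `P` are extreme points of `C`
(`HasTangentRays.extremePoints_convexHull`). The directions between two consecutive sides of `C`
have their common end point as the only contact point, so that the rays from this point sweep the
sector bounded by the sides, and `u` is conical there because the Hessian annihilates the radial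
direction (`isConicalOn_sectorBetween`). Finally, `u` has a limit at each point of `P` because its
gradient is bounded nearby: the gradient is constant along leaves, which carry it to a compact set
(`HasTangentRays.exists_bound_fderiv`).
-/

/-! ### The local form of the Hartman-Nirenberg theorem -/

/-- The core of the Hartman-Nirenberg theorem for a function with degenerate Hessian, in coordinates in which the kernel of
the Hessian at the origin is the second axis. Here `F` and `G` play the roles of `u_x` and `u_y`.
In the coordinates `(F, y)` the function `G` depends on `F` only, so that each level curve of `F`
is a straight line, and `1 / F_x = ∂x / ∂F` is affine along it. -/
lemma exists_affine_mul_eq_one_of_degenerate {F G : ℝ × ℝ → ℝ}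
    (hF : ContDiffAt ℝ 1 F 0) (hG : ContDiffAt ℝ 1 G 0)
    (hsym : ∀ᶠ z in 𝓝 (0 : ℝ × ℝ), fderiv ℝ F z (0, 1) = fderiv ℝ G z (1, 0))
    (hdet : ∀ᶠ z in 𝓝 (0 : ℝ × ℝ),
      fderiv ℝ F z (1, 0) * fderiv ℝ G z (0, 1) = fderiv ℝ F z (0, 1) ^ 2)
    (h1 : fderiv ℝ F 0 (1, 0) ≠ 0) (h0 : fderiv ℝ F 0 (0, 1) = 0) :
    ∃ a b : ℝ, ∀ᶠ y in 𝓝 (0 : ℝ),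
      fderiv ℝ F (0, y) (1, 0) * (a + b * y) = 1 ∧ fderiv ℝ F (0, y) (0, 1) = 0 := by
  set α := fderiv ℝ F 0 (1, 0) with hα
  have hF0 : HasFDerivAt F (fderiv ℝ F 0) 0 := (hF.differentiableAt one_ne_zero).hasFDerivAt
  have hFz : ∀ z : ℝ × ℝ, fderiv ℝ F 0 z = α * z.1 := by
    intro z
    have : z = z.1 • ((1 : ℝ), (0 : ℝ)) + z.2 • ((0 : ℝ), (1 : ℝ)) := by ext <;> simp
    conv_lhs => rw [this]
    rw [map_add, map_smul, map_smul, h0, ← hα]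
    simp [mul_comm]
  let e : (ℝ × ℝ) ≃L[ℝ] (ℝ × ℝ) := ContinuousLinearEquiv.equivOfInverse
    ((fderiv ℝ F 0).prod (ContinuousLinearMap.snd ℝ ℝ ℝ))
    ((α⁻¹ • ContinuousLinearMap.fst ℝ ℝ ℝ).prod (ContinuousLinearMap.snd ℝ ℝ ℝ))
    (by intro z; ext <;> simp [hFz, h1]) (by intro z; ext <;> simp [hFz, h1])
  let Φ : ℝ × ℝ → ℝ × ℝ := fun z => (F z, z.2)
  have hΦ : ContDiffAt ℝ 1 Φ 0 := hF.prodMk contDiffAt_snd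
  have hΦ' : HasFDerivAt Φ (e : (ℝ × ℝ) →L[ℝ] (ℝ × ℝ)) 0 := by
    have : HasFDerivAt Φ ((fderiv ℝ F 0).prod (ContinuousLinearMap.snd ℝ ℝ ℝ)) 0 :=
      hF0.prodMk hasFDerivAt_snd
    exact this
  have hs := hΦ.hasStrictFDerivAt' hΦ' one_ne_zero
  set Ψ := hs.localInverse Φ e 0 with hΨ
  have hΨC : ContDiffAt ℝ 1 Ψ (Φ 0) := hΦ.to_localInverse hΦ' one_ne_zero
  have hΨ0 : Ψ (Φ 0) = 0 := hs.localInverse_apply_image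
  have hΨc : Tendsto Ψ (𝓝 (Φ 0)) (𝓝 0) := hs.localInverse_tendsto
  have hFx : ∀ᶠ z in 𝓝 (0 : ℝ × ℝ), fderiv ℝ F z (1, 0) ≠ 0 := by
    have : ContinuousAt (fun z => fderiv ℝ F z (1, 0)) 0 :=
      (hF.continuousAt_fderiv one_ne_zero).clm_apply continuousAt_const
    exact this.eventually_ne h1
  have hFd : ∀ᶠ z in 𝓝 (0 : ℝ × ℝ), DifferentiableAt ℝ F z :=
    (hF.eventually (by simp)).mono fun z hz => hz.differentiableAt one_ne_zero
  have hGd : ∀ᶠ z in 𝓝 (0 : ℝ × ℝ), DifferentiableAt ℝ G z :=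
    (hG.eventually (by simp)).mono fun z hz => hz.differentiableAt one_ne_zero
  have hev : ∀ᶠ w in 𝓝 (Φ 0), ∀ᶠ w' in 𝓝 w, Φ (Ψ w') = w' := (hs.eventually_right_inverse).eventually_nhds
  have hall := hev.and <| ((hΨC.eventually (by simp)).mono
    fun z hz => hz.differentiableAt one_ne_zero).and <|
    hΨc.eventually (hsym.and <| hdet.and <| hFx.and <| hFd.and hGd)
  obtain ⟨ε, hε, hbox⟩ := Metric.eventually_nhds_iff_ball.1 hall
  set p₀ := F 0 with hp₀
  have hΦ0 : Φ 0 = (p₀, 0) := rfl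
  -- the coordinate expressions of the derivatives of `Ψ`
  set X : ℝ × ℝ → ℝ := fun w => (Ψ w).1 with hX
  set Xp : ℝ × ℝ → ℝ := fun w => (fderiv ℝ Ψ w (1, 0)).1 with hXp
  set Xy : ℝ × ℝ → ℝ := fun w => (fderiv ℝ Ψ w (0, 1)).1 with hXy
  set B := Metric.ball (Φ 0) ε with hB
  have hmem : ∀ p y : ℝ, |p - p₀| < ε → |y| < ε → (p, y) ∈ B := by
    intro p y hp hy
    rw [hB, Metric.mem_ball, hΦ0, Prod.dist_eq]
    simpa [Real.dist_eq] using ⟨hp, hy⟩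
  have key : ∀ w ∈ B, F (Ψ w) = w.1 ∧ Ψ w = (X w, w.2) ∧
      fderiv ℝ Ψ w (1, 0) = (Xp w, 0) ∧ fderiv ℝ Ψ w (0, 1) = (Xy w, 1) ∧
      fderiv ℝ F (Ψ w) (1, 0) * Xp w = 1 ∧
      fderiv ℝ F (Ψ w) (1, 0) * Xy w + fderiv ℝ F (Ψ w) (0, 1) = 0 ∧
      fderiv ℝ G (Ψ w) (fderiv ℝ Ψ w (0, 1)) = 0 ∧
      fderiv ℝ G (Ψ w) (fderiv ℝ Ψ w (1, 0)) = - Xy w := by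
    intro w hw
    obtain ⟨hinv, hd, hsy, hde, hx, hfd, hgd⟩ := hbox w hw
    have hiw := hinv.self_of_nhds
    have hdΨ := hd.hasFDerivAt
    have hcompF : HasFDerivAt (fun w' => F (Ψ w')) ((fderiv ℝ F (Ψ w)).comp (fderiv ℝ Ψ w)) w :=
      hfd.hasFDerivAt.comp w hdΨ
    have e1 : (fderiv ℝ F (Ψ w)).comp (fderiv ℝ Ψ w) = ContinuousLinearMap.fst ℝ ℝ ℝ := by
      refine (hcompF.congr_of_eventuallyEq (f₁ := fun w' : ℝ × ℝ => w'.1) ?_).unique hasFDerivAt_fst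
      filter_upwards [hinv] with w' h'
      exact (congrArg Prod.fst h').symm
    have e2 : (ContinuousLinearMap.snd ℝ ℝ ℝ).comp (fderiv ℝ Ψ w) = ContinuousLinearMap.snd ℝ ℝ ℝ := by
      have h2 : HasFDerivAt (fun w' => (Ψ w').2)
          ((ContinuousLinearMap.snd ℝ ℝ ℝ).comp (fderiv ℝ Ψ w)) w := hdΨ.snd
      refine (h2.congr_of_eventuallyEq (f₁ := fun w' : ℝ × ℝ => w'.2) ?_).unique hasFDerivAt_snd
      filter_upwards [hinv] with w' h'
      exact (congrArg Prod.snd h').symm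
    have d1 : fderiv ℝ Ψ w (1, 0) = (Xp w, 0) := by
      have := DFunLike.congr_fun e2 ((1 : ℝ), (0 : ℝ))
      exact Prod.ext rfl (by simpa using this)
    have d2 : fderiv ℝ Ψ w (0, 1) = (Xy w, 1) := by
      have := DFunLike.congr_fun e2 ((0 : ℝ), (1 : ℝ))
      exact Prod.ext rfl (by simpa using this)
    have lin : ∀ (T : ℝ × ℝ →L[ℝ] ℝ) (s t : ℝ), T (s, t) = T (1, 0) * s + T (0, 1) * t := by
      intro T s t
      have : (s, t) = s • ((1 : ℝ), (0 : ℝ)) + t • ((0 : ℝ), (1 : ℝ)) := by ext <;> simp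
      rw [this, map_add, map_smul, map_smul]; simp [mul_comm]
    have f1 := DFunLike.congr_fun e1 ((1 : ℝ), (0 : ℝ))
    have f2 := DFunLike.congr_fun e1 ((0 : ℝ), (1 : ℝ))
    simp only [ContinuousLinearMap.comp_apply, d1, d2, ContinuousLinearMap.coe_fst'] at f1 f2
    rw [lin] at f1 f2
    rw [mul_zero, add_zero] at f1
    rw [mul_one] at f2
    have hsnd : (Φ (Ψ w)).2 = w.2 := by rw [hiw]
    refine ⟨congrArg Prod.fst hiw, Prod.ext rfl hsnd, d1, d2, f1, f2, ?_, ?_⟩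
    · rw [d2, lin, mul_one, ← hsy]
      apply mul_left_cancel₀ hx
      linear_combination hde + fderiv ℝ F (Ψ w) (0, 1) * f2
    · rw [d1, lin, ← hsy, mul_zero, add_zero]
      linear_combination (Xp w) * f2 - Xy w * f1
  have hdX : ∀ w ∈ B, HasFDerivAt Ψ (fderiv ℝ Ψ w) w := fun w hw => (hbox w hw).2.1.hasFDerivAt
  have hlp : ∀ p y : ℝ, HasDerivAt (fun p' : ℝ => (p', y)) ((1 : ℝ), (0 : ℝ)) p := fun p y =>
    (hasDerivAt_id p).prodMk (hasDerivAt_const p y)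
  have hly : ∀ p y : ℝ, HasDerivAt (fun y' : ℝ => (p, y')) ((0 : ℝ), (1 : ℝ)) y := fun p y =>
    (hasDerivAt_const y p).prodMk (hasDerivAt_id y)
  have hXdp : ∀ p y : ℝ, (p, y) ∈ B → HasDerivAt (fun p' => X (p', y)) (Xp (p, y)) p := by
    intro p y h
    exact hasFDerivAt_fst.comp_hasDerivAt p ((hdX _ h).comp_hasDerivAt p (hlp p y))
  have hXdy : ∀ p y : ℝ, (p, y) ∈ B → HasDerivAt (fun y' => X (p, y')) (Xy (p, y)) y := by
    intro p y h
    exact hasFDerivAt_fst.comp_hasDerivAt y ((hdX _ h).comp_hasDerivAt y (hly p y))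
  have hKp : ∀ p y : ℝ, (p, y) ∈ B → HasDerivAt (fun p' => G (Ψ (p', y))) (- Xy (p, y)) p := by
    intro p y h
    have := ((hbox _ h).2.2.2.2.2.2.hasFDerivAt.comp (p, y) (hdX _ h)).comp_hasDerivAt p (hlp p y)
    rw [← (key _ h).2.2.2.2.2.2.2]
    exact this
  have hKy : ∀ p y : ℝ, (p, y) ∈ B → HasDerivAt (fun y' => G (Ψ (p, y'))) 0 y := by
    intro p y h
    have := ((hbox _ h).2.2.2.2.2.2.hasFDerivAt.comp (p, y) (hdX _ h)).comp_hasDerivAt y (hly p y)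
    rw [← (key _ h).2.2.2.2.2.2.1]
    exact this
  have hconst : ∀ {f : ℝ → ℝ}, (∀ y, |y| < ε → HasDerivAt f 0 y) → ∀ y, |y| < ε → f y = f 0 := by
    intro f hf y hy
    have hopen : IsOpen (Metric.ball (0 : ℝ) ε) := Metric.isOpen_ball
    refine hopen.is_const_of_deriv_eq_zero (convex_ball (0 : ℝ) ε).isPreconnected
      (fun z hz => ?_) (fun z hz => ?_) (x := y) (y := 0) (by simpa using hy) (by simpa using hε)
    · exact (hf z (by simpa using hz)).differentiableAt.differentiableWithinAt
    · exact (hf z (by simpa using hz)).deriv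
  -- `G ∘ Ψ` does not depend on `y`, so neither does `X_y = -(G ∘ Ψ)_p`, and `X` is affine in `y`
  have hG0 : ∀ p y : ℝ, |p - p₀| < ε → |y| < ε → G (Ψ (p, y)) = G (Ψ (p, 0)) := by
    intro p y hp hy
    exact hconst (f := fun y' => G (Ψ (p, y'))) (fun y' hy' => hKy p y' (hmem p y' hp hy')) y hy
  have hnear : ∀ p : ℝ, |p - p₀| < ε → ∀ᶠ p' in 𝓝 p, |p' - p₀| < ε := by
    intro p hp
    exact (continuous_abs.comp (continuous_id.sub continuous_const)).continuousAt.eventually_lt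
      continuousAt_const hp
  have hXy0 : ∀ p y : ℝ, |p - p₀| < ε → |y| < ε → Xy (p, y) = Xy (p, 0) := by
    intro p y hp hy
    have a1 := hKp p y (hmem p y hp hy)
    have a2 := hKp p 0 (hmem p 0 hp (by simpa using hε))
    have a3 := a1.congr_of_eventuallyEq (f₁ := fun p' => G (Ψ (p', 0)))
      ((hnear p hp).mono fun p' hp' => (hG0 p' y hp' hy).symm)
    have := a3.unique a2
    linarith
  have hXaff : ∀ p y : ℝ, |p - p₀| < ε → |y| < ε → X (p, y) = X (p, 0) + y * Xy (p, 0) := by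
    intro p y hp hy
    have := hconst (f := fun y' => X (p, y') - y' * Xy (p, 0)) (fun y' hy' => by
      have h1 := (hXdy p y' (hmem p y' hp hy')).sub ((hasDerivAt_id y').mul_const (Xy (p, 0)))
      rw [hXy0 p y' hp hy'] at h1
      exact h1.congr_deriv (by simp)) y hy
    simp only [zero_mul, sub_zero] at this
    linarith
  have h00 : |p₀ - p₀| < ε := by simpa using hε
  have hε0 : |(0 : ℝ)| < ε := by simpa using hε
  have hΨ00 : Ψ (p₀, 0) = 0 := hΨ0
  have hXy00 : Xy (p₀, 0) = 0 := by
    have := (key _ (hmem p₀ 0 h00 hε0)).2.2.2.2.2.1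
    rw [hΨ00, h0, add_zero] at this
    exact (mul_eq_zero.1 this).resolve_left h1
  have hline : ∀ y : ℝ, |y| < ε → Ψ (p₀, y) = (0, y) := by
    intro y hy
    rw [(key _ (hmem p₀ y h00 hy)).2.1, hXaff p₀ y h00 hy, hXy00]
    have : X (p₀, 0) = 0 := by simp [hX, hΨ00]
    simp [this]
  have hy1 : |ε / 2| < ε := by rw [abs_of_pos (half_pos hε)]; exact half_lt_self hε
  refine ⟨Xp (p₀, 0), (Xp (p₀, ε / 2) - Xp (p₀, 0)) / (ε / 2), ?_⟩
  have : ∀ᶠ y in 𝓝 (0 : ℝ), |y| < ε :=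
    continuous_abs.continuousAt.eventually_lt continuousAt_const (by simpa using hε)
  filter_upwards [this] with y hy
  have hk := key _ (hmem p₀ y h00 hy)
  rw [hline y hy] at hk
  constructor
  · -- `X_p = 1 / F_x` is affine in `y`, being the derivative in `p` of a function of this kind
    have b1 := hXdp p₀ y (hmem p₀ y h00 hy)
    have b2 := hXdp p₀ 0 (hmem p₀ 0 h00 hε0)
    have b3 := hXdp p₀ (ε / 2) (hmem p₀ _ h00 hy1)
    have b4 := b2.add ((b3.sub b2).const_mul (y / (ε / 2)))
    have b5 := b4.congr_of_eventuallyEq (f₁ := fun p' => X (p', y)) (by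
      filter_upwards [hnear p₀ h00] with p' hp'
      have c1 := hXaff p' y hp' hy
      have c2 := hXaff p' (ε / 2) hp' hy1
      have hε2 : ε / 2 ≠ 0 := (half_pos hε).ne'
      simp only [Pi.add_apply, Pi.sub_apply]
      rw [c1, c2]
      field_simp
      ring)
    have := b1.unique b5
    have e := hk.2.2.2.2.1
    rw [this] at e
    linear_combination e
  · have := hk.2.2.2.2.2.1
    rw [hXy0 p₀ y h00 hy, hXy00, mul_zero, zero_add] at this
    exact this

/-! ### The Hessian of a solution and its leaves -/

/-- The oriented area `x ∧ y` of two vectors of the plane. -/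
def cross (x y : Plane) : ℝ := x 0 * y 1 - x 1 * y 0

/-- The first standard basis vector. -/
noncomputable abbrev e₀ : Plane := EuclideanSpace.single 0 1

/-- The second standard basis vector. -/
noncomputable abbrev e₁ : Plane := EuclideanSpace.single 1 1

/-- The Hessian of `u` at `z`, as a bilinear form. -/
noncomputable def hess (u : Plane → ℝ) (z : Plane) : Plane →L[ℝ] Plane →L[ℝ] ℝ :=
  fderiv ℝ (fderiv ℝ u) z

/-- The Laplacian, that is, the trace of the Hessian. For a solution of the degenerate equation it
vanishes exactly where the Hessian does. -/
noncomputable def lap (u : Plane → ℝ) (z : Plane) : ℝ := hess u z e₀ e₀ + hess u z e₁ e₁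

lemma plane_eq (z : Plane) : z = z 0 • e₀ + z 1 • e₁ := by
  ext i; fin_cases i <;> simp

lemma plane_ext {x y : Plane} (h0 : x 0 = y 0) (h1 : x 1 = y 1) : x = y := by
  ext i; fin_cases i <;> assumption

lemma cross_self_eq_zero (x : Plane) : cross x x = 0 := by simp [cross, mul_comm]
lemma cross_swap (x y : Plane) : cross y x = - cross x y := by simp only [cross]; ring
lemma cross_add_left (x y z : Plane) : cross (x + y) z = cross x z + cross y z := by
  simp only [cross, PiLp.add_apply]; ring
lemma cross_add_right (x y z : Plane) : cross x (y + z) = cross x y + cross x z := by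
  simp only [cross, PiLp.add_apply]; ring
lemma cross_sub_left (x y z : Plane) : cross (x - y) z = cross x z - cross y z := by
  simp only [cross, PiLp.sub_apply]; ring
lemma cross_sub_right (x y z : Plane) : cross x (y - z) = cross x y - cross x z := by
  simp only [cross, PiLp.sub_apply]; ring
lemma cross_smul_left (t : ℝ) (x y : Plane) : cross (t • x) y = t * cross x y := by
  simp only [cross, PiLp.smul_apply, smul_eq_mul]; ring
lemma cross_smul_right (t : ℝ) (x y : Plane) : cross x (t • y) = t * cross x y := by
  simp only [cross, PiLp.smul_apply, smul_eq_mul]; ring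
lemma cross_neg_left (x y : Plane) : cross (-x) y = - cross x y := by
  simp only [cross, PiLp.neg_apply]; ring
lemma cross_neg_right (x y : Plane) : cross x (-y) = - cross x y := by
  simp only [cross, PiLp.neg_apply]; ring
lemma cross_zero_left (x : Plane) : cross 0 x = 0 := by simp [cross]
lemma cross_zero_right (x : Plane) : cross x 0 = 0 := by simp [cross]

lemma continuous_cross : Continuous fun z : Plane × Plane => cross z.1 z.2 := by
  unfold cross; fun_prop

@[fun_prop]
lemma Continuous.cross {α : Type*} [TopologicalSpace α] {f g : α → Plane} (hf : Continuous f)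
    (hg : Continuous g) : Continuous fun a => cross (f a) (g a) :=
  continuous_cross.comp (hf.prodMk hg)

lemma Filter.Tendsto.cross {α : Type*} {l : Filter α} {f g : α → Plane} {x y : Plane}
    (hf : Tendsto f l (𝓝 x)) (hg : Tendsto g l (𝓝 y)) :
    Tendsto (fun a => cross (f a) (g a)) l (𝓝 (cross x y)) :=
  (continuous_cross.tendsto (x, y)).comp (hf.prodMk_nhds hg)

/-- Cramer's rule in the plane. -/
lemma cross_smul_eq (x y z : Plane) : cross x y • z = cross z y • x + cross x z • y := by
  apply plane_ext <;> simp only [cross, PiLp.add_apply, PiLp.smul_apply, smul_eq_mul] <;> ring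

lemma eq_smul_add_smul {x y : Plane} (h : cross x y ≠ 0) (z : Plane) :
    z = (cross z y / cross x y) • x + (cross x z / cross x y) • y := by
  have := congrArg (fun w => (cross x y)⁻¹ • w) (cross_smul_eq x y z)
  simp only [smul_smul, smul_add, inv_mul_cancel₀ h, one_smul] at this
  simpa only [div_eq_inv_mul] using this

/-- The quarter turn of the plane. -/
noncomputable def rot (x : Plane) : Plane := !₂[-x 1, x 0]

lemma rot_zero' (x : Plane) : rot x 0 = -x 1 := by simp [rot]
lemma rot_one' (x : Plane) : rot x 1 = x 0 := by simp [rot]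

lemma cross_rot_self (x : Plane) : cross x (rot x) = ‖x‖ ^ 2 := by
  rw [EuclideanSpace.norm_sq_eq]
  simp [cross, rot_zero', rot_one', Fin.sum_univ_two]
  ring

lemma cross_rot_self_ne {x : Plane} (hx : x ≠ 0) : cross x (rot x) ≠ 0 := by
  rw [cross_rot_self]; exact pow_ne_zero _ (norm_ne_zero_iff.2 hx)

lemma exists_eq_smul_of_cross_eq_zero {x y : Plane} (hx : x ≠ 0) (h : cross x y = 0) :
    ∃ t : ℝ, y = t • x := by
  have := eq_smul_add_smul (cross_rot_self_ne hx) y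
  rw [h, zero_div, zero_smul, add_zero] at this
  exact ⟨_, this⟩

lemma norm_rot (x : Plane) : ‖rot x‖ = ‖x‖ := by
  rw [EuclideanSpace.norm_eq, EuclideanSpace.norm_eq]
  simp [rot_zero', rot_one', Fin.sum_univ_two, add_comm]

section

variable {u : Plane → ℝ} {P : Set Plane}

lemma contDiffAt_of_notMem (hP : P.Finite) (hu : IsSolutionOff u P) {z : Plane} (hz : z ∉ P) :
    ContDiffAt ℝ 2 u z :=
  hu.contDiffOn.contDiffAt (hP.isClosed.isOpen_compl.mem_nhds hz)

lemma differentiableAt_of_notMem (hP : P.Finite) (hu : IsSolutionOff u P) {z : Plane}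
    (hz : z ∉ P) : DifferentiableAt ℝ u z :=
  (contDiffAt_of_notMem hP hu hz).differentiableAt two_ne_zero

lemma contDiffAt_fderiv (hP : P.Finite) (hu : IsSolutionOff u P) {z : Plane} (hz : z ∉ P) :
    ContDiffAt ℝ 1 (fderiv ℝ u) z :=
  (contDiffAt_of_notMem hP hu hz).fderiv_right (by norm_num)

lemma hasFDerivAt_fderiv (hP : P.Finite) (hu : IsSolutionOff u P) {z : Plane} (hz : z ∉ P) :
    HasFDerivAt (fderiv ℝ u) (hess u z) z :=
  ((contDiffAt_fderiv hP hu hz).differentiableAt one_ne_zero).hasFDerivAt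

lemma continuousAt_hess (hP : P.Finite) (hu : IsSolutionOff u P) {z : Plane} (hz : z ∉ P) :
    ContinuousAt (hess u) z :=
  (contDiffAt_fderiv hP hu hz).continuousAt_fderiv one_ne_zero

lemma continuousAt_lap (hP : P.Finite) (hu : IsSolutionOff u P) {z : Plane} (hz : z ∉ P) :
    ContinuousAt (lap u) z := by
  have := continuousAt_hess hP hu hz
  exact ((this.clm_apply continuousAt_const).clm_apply continuousAt_const).add
    ((this.clm_apply continuousAt_const).clm_apply continuousAt_const)

lemma hess_symm (hP : P.Finite) (hu : IsSolutionOff u P) {z : Plane} (hz : z ∉ P) (x y : Plane) :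
    hess u z x y = hess u z y x :=
  (contDiffAt_of_notMem hP hu hz).isSymmSndFDerivAt (by simp) x y

lemma hess_apply (hP : P.Finite) (hu : IsSolutionOff u P) {z : Plane} (hz : z ∉ P) (x y : Plane) :
    hess u z x y = hess u z e₀ e₀ * (x 0 * y 0) + hess u z e₀ e₁ * (x 0 * y 1 + x 1 * y 0)
      + hess u z e₁ e₁ * (x 1 * y 1) := by
  conv_lhs => rw [plane_eq x, plane_eq y]
  simp only [map_add, map_smul, add_apply, smul_apply,
    smul_eq_mul, hess_symm hP hu hz e₁ e₀]
  ring

lemma partialDeriv_partialDeriv (hP : P.Finite) (hu : IsSolutionOff u P) {z : Plane} (hz : z ∉ P)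
    (i j : Fin 2) : partialDeriv j (partialDeriv i u) z =
      hess u z (EuclideanSpace.single j 1) (EuclideanSpace.single i 1) := by
  have := (hasFDerivAt_fderiv hP hu hz).clm_apply
    (hasFDerivAt_const (EuclideanSpace.single i (1 : ℝ) : Plane) z)
  change fderiv ℝ (fun w => fderiv ℝ u w (EuclideanSpace.single i 1)) z _ = _
  rw [this.fderiv]
  simp

lemma hess_det (hP : P.Finite) (hu : IsSolutionOff u P) {z : Plane} (hz : z ∉ P) :
    hess u z e₀ e₀ * hess u z e₁ e₁ = hess u z e₀ e₁ ^ 2 := by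
  have := hu.equation z hz
  simp only [mongeAmpere, partialDeriv_partialDeriv hP hu hz] at this
  rw [hess_symm hP hu hz e₀ e₁]
  linarith

lemma hess_mul_hess (hP : P.Finite) (hu : IsSolutionOff u P) {z : Plane} (hz : z ∉ P)
    (x y : Plane) : hess u z x x * hess u z y y = hess u z x y ^ 2 := by
  have := hess_det hP hu hz
  rw [hess_apply hP hu hz x x, hess_apply hP hu hz y y, hess_apply hP hu hz x y]
  linear_combination (x 0 * y 1 - x 1 * y 0) ^ 2 * this

lemma hess_eq_zero_of_null {z x y : Plane} (hx : hess u z x = 0) (hy : hess u z y = 0) (hxy : cross x y ≠ 0) :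
    hess u z = 0 := by
  ext1 w
  rw [eq_smul_add_smul hxy w]
  simp [hx, hy]

lemma lap_eq_zero_iff (hP : P.Finite) (hu : IsSolutionOff u P) {z : Plane} (hz : z ∉ P) :
    lap u z = 0 ↔ hess u z = 0 := by
  refine ⟨fun h => ?_, fun h => by simp [lap, h]⟩
  have h1 := hess_det hP hu hz
  have hd : hess u z e₁ e₁ = - hess u z e₀ e₀ := by unfold lap at h; linarith
  have ha : hess u z e₀ e₀ = 0 := by
    have : hess u z e₀ e₀ ^ 2 + hess u z e₀ e₁ ^ 2 = 0 := by rw [← h1, hd]; ring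
    nlinarith [sq_nonneg (hess u z e₀ e₀), sq_nonneg (hess u z e₀ e₁)]
  have hb : hess u z e₀ e₁ = 0 := by
    rw [ha, zero_mul] at h1
    exact pow_eq_zero_iff two_ne_zero |>.1 h1.symm
  ext x y
  rw [hess_apply hP hu hz x y, hd, ha, hb]
  simp

lemma exists_null (hP : P.Finite) (hu : IsSolutionOff u P) {z : Plane} (hz : z ∉ P) :
    ∃ x : Plane, ‖x‖ = 1 ∧ hess u z x = 0 := by
  suffices h : ∃ x : Plane, x ≠ 0 ∧ hess u z x = 0 by
    obtain ⟨x, hx, h⟩ := h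
    refine ⟨‖x‖⁻¹ • x, ?_, by simp [h]⟩
    rw [norm_smul, norm_inv, norm_norm, inv_mul_cancel₀ (norm_ne_zero_iff.2 hx)]
  have h1 := hess_det hP hu hz
  by_cases h0 : hess u z e₁ = 0
  · exact ⟨e₁, by simp, h0⟩
  refine ⟨!₂[hess u z e₁ e₁, - hess u z e₀ e₁], fun h => h0 ?_, ?_⟩
  · have ha := congrArg (fun x : Plane => x 0) h
    have hb := congrArg (fun x : Plane => x 1) h
    simp at ha hb
    ext y
    rw [hess_apply hP hu hz]
    simp [ha, hb]
  · ext y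
    rw [hess_apply hP hu hz]
    simp
    linear_combination (y 0) * h1

/-- The Hessian has rank at most one, with the line spanned by a null vector as its kernel. -/
lemma hess_eq_of_null (hP : P.Finite) (hu : IsSolutionOff u P) {z : Plane} (hz : z ∉ P)
    {x : Plane} (hx : hess u z x = 0) (hn : ‖x‖ = 1) (y w : Plane) :
    hess u z y w = lap u z * (cross x y * cross x w) := by
  have hn2 : x 0 ^ 2 + x 1 ^ 2 = 1 := by
    have := EuclideanSpace.norm_sq_eq x
    rw [hn] at this
    simpa [Fin.sum_univ_two] using this.symm
  have h0 : hess u z x e₀ = 0 := by simp [hx]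
  have h1 : hess u z x e₁ = 0 := by simp [hx]
  rw [hess_apply hP hu hz] at h0 h1
  simp at h0 h1
  have ha : hess u z e₀ e₀ = lap u z * x 1 ^ 2 := by
    unfold lap; linear_combination x 0 * h0 - x 1 * h1 - (hess u z e₀ e₀) * hn2
  have hd : hess u z e₁ e₁ = lap u z * x 0 ^ 2 := by
    unfold lap; linear_combination x 1 * h1 - x 0 * h0 - (hess u z e₁ e₁) * hn2
  have hb : hess u z e₀ e₁ = - (lap u z * (x 0 * x 1)) := by
    unfold lap; linear_combination x 1 * h0 + x 0 * h1 - (hess u z e₀ e₁) * hn2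
  rw [hess_apply hP hu hz, ha, hd, hb]
  unfold cross; ring

/-- Local form of the Hartman-Nirenberg theorem, in the coordinates given by `x` and its quarter turn. -/
lemma eventually_lap_mul_eq_one (hP : P.Finite) (hu : IsSolutionOff u P) {z x : Plane}
    (hz : z ∉ P) (hl : lap u z ≠ 0) (hx : hess u z x = 0) :
    ∃ a b : ℝ, ∀ᶠ t in 𝓝 (0 : ℝ),
      lap u (z + t • x) * (a + b * t) = 1 ∧ hess u (z + t • x) x = 0 := by
  rcases eq_or_ne x 0 with rfl | hx0
  · exact ⟨(lap u z)⁻¹, 0, Eventually.of_forall fun t => by simp [hl]⟩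
  set e := rot x with he
  let A : ℝ × ℝ → Plane := fun w => z + (w.1 • e + w.2 • x)
  let A' : ℝ × ℝ →L[ℝ] Plane := (ContinuousLinearMap.fst ℝ ℝ ℝ).smulRight e +
    (ContinuousLinearMap.snd ℝ ℝ ℝ).smulRight x
  have hA : ∀ w, HasFDerivAt A A' w := fun w => A'.hasFDerivAt.const_add z
  have hAC : ContDiff ℝ 1 A := contDiff_const.add A'.contDiff
  have hA0 : A 0 = z := by simp [A]
  have hAt : Tendsto A (𝓝 0) (𝓝 z) := by
    have := hAC.continuous.tendsto 0
    rwa [hA0] at this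
  have hev : ∀ᶠ w in 𝓝 (0 : ℝ × ℝ), A w ∉ P :=
    hAt.eventually (hP.isClosed.isOpen_compl.mem_nhds hz)
  have hD : ∀ (y : Plane) (w : ℝ × ℝ), A w ∉ P → ∀ s : ℝ × ℝ,
      fderiv ℝ (fun w => fderiv ℝ u (A w) y) w s = hess u (A w) (s.1 • e + s.2 • x) y := by
    intro y w hw s
    have h1 := (hasFDerivAt_fderiv hP hu hw).comp w (hA w)
    have h2 := h1.clm_apply (hasFDerivAt_const y w)
    have h3 : HasFDerivAt (fun w => fderiv ℝ u (A w) y) _ w := h2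
    rw [h3.fderiv]
    simp [A']
  have hC : ∀ y : Plane, ContDiffAt ℝ 1 (fun w => fderiv ℝ u (A w) y) 0 := by
    intro y
    have h1 : ContDiffAt ℝ 1 (fderiv ℝ u) (A 0) := by rw [hA0]; exact contDiffAt_fderiv hP hu hz
    exact (h1.comp (0 : ℝ × ℝ) hAC.contDiffAt).clm_apply contDiffAt_const
  have hn : cross x e = ‖x‖ ^ 2 := cross_rot_self x
  have hlap : ∀ w : Plane, w ∉ P → lap u w * ‖x‖ ^ 2 = hess u w e e + hess u w x x := by
    intro w hw
    rw [hess_apply hP hu hw e e, hess_apply hP hu hw x x, EuclideanSpace.norm_sq_eq]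
    simp [he, rot_zero', rot_one', Fin.sum_univ_two, lap]
    ring
  have hnx : ‖x‖ ^ 2 ≠ 0 := pow_ne_zero _ (norm_ne_zero_iff.2 hx0)
  have h00 : A 0 ∉ P := by rw [hA0]; exact hz
  obtain ⟨a, b, hab⟩ := exists_affine_mul_eq_one_of_degenerate (hC e) (hC x)
    (by
      filter_upwards [hev] with w hw
      rw [hD e w hw, hD x w hw]
      simpa using hess_symm hP hu hw x e)
    (by
      filter_upwards [hev] with w hw
      rw [hD e w hw, hD x w hw, hD e w hw]
      simp only [one_smul, zero_smul, add_zero, zero_add]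
      rw [hess_mul_hess hP hu hw e x, hess_symm hP hu hw e x])
    (by
      rw [hD e 0 h00, hA0]
      simp only [one_smul, zero_smul, add_zero]
      intro h
      have := hlap z hz
      rw [h, hx] at this
      simp at this
      tauto)
    (by
      rw [hD e 0 h00, hA0]
      simp [hx])
  refine ⟨a * ‖x‖ ^ 2, b * ‖x‖ ^ 2, ?_⟩
  have hcur : Tendsto (fun t : ℝ => ((0 : ℝ), t)) (𝓝 0) (𝓝 0) :=
    (Continuous.prodMk_right (0 : ℝ)).tendsto' 0 0 rfl
  filter_upwards [hab, hcur.eventually hev] with t ht htP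
  have hAt' : A (0, t) = z + t • x := by simp [A]
  rw [hD e _ htP, hD e _ htP, hAt'] at ht
  rw [hAt'] at htP
  simp only [one_smul, zero_smul, add_zero, zero_add] at ht
  obtain ⟨h1, h2⟩ := ht
  have h3 := hess_mul_hess hP hu htP x e
  have hee : hess u (z + t • x) e e ≠ 0 := fun h => by rw [h] at h1; simp at h1
  have hxx : hess u (z + t • x) x x = 0 := by
    rw [h2] at h3
    simpa [hee] using h3
  constructor
  · have := hlap _ htP
    rw [hxx, add_zero] at this
    rw [← h1, ← this]; ring
  · ext w
    have hxe : cross x e ≠ 0 := by rw [hn]; exact hnx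
    rw [eq_smul_add_smul hxe w]
    simp [hxx, h2]

/-- **Hartman-Nirenberg theorem.** Along a segment in the domain that starts in the direction of
the kernel of a non-zero Hessian, the Hessian keeps this kernel and the reciprocal of its trace is
affine, so that it does not vanish. -/
theorem exists_affine_lap (hP : P.Finite) (hu : IsSolutionOff u P) {z x : Plane}
    (hl : lap u z ≠ 0) (hx : hess u z x = 0)
    (hseg : ∀ t ∈ Icc (0 : ℝ) 1, z + t • x ∉ P) :
    ∃ a b : ℝ, ∀ t ∈ Icc (0 : ℝ) 1, lap u (z + t • x) * (a + b * t) = 1 ∧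
      hess u (z + t • x) x = 0 := by
  have hz : z ∉ P := by simpa using hseg 0 (by simp)
  obtain ⟨a, b, hab⟩ := eventually_lap_mul_eq_one hP hu hz hl hx
  refine ⟨a, b, ?_⟩
  set Q : ℝ → Prop := fun t => lap u (z + t • x) * (a + b * t) = 1 ∧ hess u (z + t • x) x = 0
    with hQ
  have hcont : Continuous fun t : ℝ => z + t • x := by fun_prop
  have hclos : ∀ t ∈ Icc (0 : ℝ) 1, (∃ᶠ s in 𝓝 t, Q s) → Q t := by
    intro t ht hf
    have h1 : ContinuousAt (fun s : ℝ => lap u (z + s • x) * (a + b * s)) t :=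
      ((continuousAt_lap hP hu (hseg t ht)).comp (f := fun s : ℝ => z + s • x)
        hcont.continuousAt).mul (by fun_prop)
    have h2 : ContinuousAt (fun s : ℝ => hess u (z + s • x) x) t :=
      ((continuousAt_hess hP hu (hseg t ht)).comp (f := fun s : ℝ => z + s • x)
        hcont.continuousAt).clm_apply continuousAt_const
    constructor
    · by_contra h
      exact hf ((h1.eventually_ne h).mono fun s hs hq => hs hq.1)
    · by_contra h
      exact hf ((h2.eventually_ne h).mono fun s hs hq => hs hq.2)
  set S : Set ℝ := {t | ∀ s ∈ Icc (0 : ℝ) 1, s ≤ t → Q s} with hS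
  have hsub : Icc (0 : ℝ) 1 ⊆ S := by
    apply IsClosed.Icc_subset_of_forall_mem_nhdsWithin
    · rw [← isSeqClosed_iff_isClosed]
      intro c t hc hct
      have ht : t ∈ Icc (0 : ℝ) 1 := isClosed_Icc.mem_of_tendsto hct
        (Eventually.of_forall fun k => (hc k).2)
      refine ⟨fun s hs hst => ?_, ht⟩
      rcases hst.lt_or_eq with h | rfl
      · obtain ⟨k, hk⟩ := (hct.eventually (lt_mem_nhds h)).exists
        exact (hc k).1 s hs hk.le
      · apply hclos s hs
        exact hct.frequently (Eventually.of_forall fun k => (hc k).1 (c k) (hc k).2 le_rfl).frequently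
    · intro s hs hs0
      have : s = 0 := le_antisymm hs0 hs.1
      subst this
      exact hab.self_of_nhds
    · rintro t ⟨htS, ht⟩
      have ht' : t ∈ Icc (0 : ℝ) 1 := ⟨ht.1, ht.2.le⟩
      have hQt : Q t := htS t ht' le_rfl
      have hlt : lap u (z + t • x) ≠ 0 := fun h => by
        have := hQt.1
        rw [h, zero_mul] at this
        exact zero_ne_one this
      obtain ⟨a', b', hab'⟩ := eventually_lap_mul_eq_one hP hu (hseg t ht') hlt hQt.2
      have hloc : ∀ᶠ s in 𝓝 t, lap u (z + s • x) * (a' + b' * (s - t)) = 1 ∧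
          hess u (z + s • x) x = 0 := by
        have hs : Tendsto (fun s : ℝ => s - t) (𝓝 t) (𝓝 0) :=
          (continuous_id.sub continuous_const).tendsto' t 0 (by simp)
        filter_upwards [hs.eventually hab'] with s hs
        have e : z + t • x + (s - t) • x = z + s • x := by rw [add_assoc, ← add_smul]; ring_nf
        rwa [e] at hs
      rcases eq_or_lt_of_le ht.1 with h0 | h0
      · subst h0
        obtain ⟨ε, hε, hball⟩ := Metric.eventually_nhds_iff.1 hab
        have : Iio ε ∈ 𝓝[>] (0 : ℝ) := mem_nhdsWithin_of_mem_nhds (Iio_mem_nhds hε)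
        filter_upwards [this] with r hr s hs hsr
        apply hball
        rw [Real.dist_eq, sub_zero, abs_of_nonneg hs.1]
        exact hsr.trans_lt hr
      · obtain ⟨ε, hε, hball⟩ := Metric.eventually_nhds_iff.1 hloc
        -- two points at which both affine functions are the reciprocal of `lap`
        set s₁ := max 0 (t - ε / 2) with hs₁
        have hs₁t : s₁ < t := max_lt h0 (by linarith)
        have hs₁I : s₁ ∈ Icc (0 : ℝ) 1 := ⟨le_max_left _ _, hs₁t.le.trans ht.2.le⟩
        have hs₁d : dist s₁ t < ε := by
          rw [Real.dist_eq, abs_sub_comm, abs_of_pos (sub_pos.2 hs₁t)]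
          have := le_max_right 0 (t - ε / 2)
          rw [← hs₁] at this
          linarith
        have q1 := htS s₁ hs₁I hs₁t.le
        have q2 := (hball hs₁d).1
        have q3 := (hball (y := t) (by simpa using hε)).1
        have hne1 : lap u (z + s₁ • x) ≠ 0 := fun h => by
          rw [h, zero_mul] at q2
          exact zero_ne_one q2
        have r1 : a + b * s₁ = a' + b' * (s₁ - t) := mul_left_cancel₀ hne1 (q1.1.trans q2.symm)
        have r2 : a + b * t = a' + b' * (t - t) := mul_left_cancel₀ hlt (hQt.1.trans q3.symm)
        have hb : b = b' := by
          have : (b - b') * (s₁ - t) = 0 := by linear_combination r1 - r2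
          rcases mul_eq_zero.1 this with h | h
          · linarith
          · linarith
        have ha : a = a' - b' * t := by rw [hb] at r2; linear_combination r2
        have : Iio (t + ε) ∈ 𝓝[>] t := mem_nhdsWithin_of_mem_nhds (Iio_mem_nhds (by linarith))
        filter_upwards [this] with r hr s hs hsr
        rcases le_or_gt s t with hst | hst
        · exact htS s hs hst
        · have hd : dist s t < ε := by
            rw [Real.dist_eq, abs_of_pos (sub_pos.2 hst)]
            have : r < t + ε := hr
            linarith
          have := hball hd
          refine ⟨?_, this.2⟩
          rw [ha, hb, ← this.1]; ring
  exact fun t ht => hsub ht t ht le_rfl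

/-! ### Removable singularities -/

/-- A function on a punctured disc with bounded derivative is Lipschitz there. -/
lemma norm_sub_le_of_punctured {F : Type*} [NormedAddCommGroup F] [NormedSpace ℝ F]
    {f : Plane → F} {f' : Plane → Plane →L[ℝ] F} {q : Plane} {r C : ℝ}
    (hd : ∀ z ∈ Metric.ball q r, z ≠ q → HasFDerivAt f (f' z) z)
    (hb : ∀ z ∈ Metric.ball q r, z ≠ q → ‖f' z‖ ≤ C) {a b : Plane}
    (ha : a ∈ Metric.ball q r) (haq : a ≠ q) (hbm : b ∈ Metric.ball q r) (hbq : b ≠ q) :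
    ‖f b - f a‖ ≤ C * ‖b - a‖ := by
  have h1 : ∀ b ∈ Metric.ball q r, q ∉ segment ℝ a b → ‖f b - f a‖ ≤ C * ‖b - a‖ := by
    intro b hb' hq
    have hsub : segment ℝ a b ⊆ Metric.ball q r := (convex_ball q r).segment_subset ha hb'
    refine (convex_segment a b).norm_image_sub_le_of_norm_hasFDerivWithin_le (f' := f')
      (fun z hz => (hd z (hsub hz) ?_).hasFDerivWithinAt) (fun z hz => hb z (hsub hz) ?_)
      (left_mem_segment ℝ a b) (right_mem_segment ℝ a b)
    · rintro rfl; exact hq hz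
    · rintro rfl; exact hq hz
  by_cases hq : q ∈ segment ℝ a b
  swap
  · exact h1 b hbm hq
  -- rotate the segment slightly about `a`
  obtain ⟨θ, -, hθ⟩ := (segment_eq_image' ℝ a b ▸ hq : q ∈ (fun θ : ℝ => a + θ • (b - a)) '' Icc 0 1)
  change a + θ • (b - a) = q at hθ
  have hab : b - a ≠ 0 := by
    intro h
    rw [h, smul_zero, add_zero] at hθ
    exact haq hθ
  set c : ℝ → Plane := fun t => b + t • rot (b - a) with hc
  have hcc : Continuous c := by fun_prop
  have hc0 : c 0 = b := by simp [hc]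
  have hct : Tendsto c (𝓝[≠] 0) (𝓝 b) := by
    have := hcc.tendsto 0
    rw [hc0] at this
    exact this.mono_left nhdsWithin_le_nhds
  have hfb : ContinuousAt f b := (hd b hbm hbq).continuousAt
  refine le_of_tendsto_of_tendsto (b := 𝓝[≠] (0 : ℝ)) (f := fun t => ‖f (c t) - f a‖)
    (g := fun t => C * ‖c t - a‖) ?_ ?_ ?_
  · exact ((hfb.tendsto.comp hct).sub_const _).norm
  · exact ((hct.sub_const _).norm).const_mul _
  · filter_upwards [hct.eventually (Metric.isOpen_ball.mem_nhds hbm), self_mem_nhdsWithin] with t ht ht0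
    refine h1 _ ht fun hq' => ?_
    obtain ⟨η, -, hη⟩ :=
      (segment_eq_image' ℝ a (c t) ▸ hq' : q ∈ (fun θ : ℝ => a + θ • (c t - a)) '' Icc 0 1)
    have e : θ • (b - a) = η • (c t - a) := add_left_cancel (hθ.trans hη.symm)
    have e2 : c t - a = (b - a) + t • rot (b - a) := by simp only [hc]; abel
    have e3 := congrArg (cross (b - a)) e
    rw [e2, cross_smul_right, cross_smul_right, cross_add_right, cross_smul_right, cross_rot_self,
      cross_self_eq_zero, mul_zero, zero_add] at e3
    have hn : ‖b - a‖ ^ 2 ≠ 0 := pow_ne_zero _ (norm_ne_zero_iff.2 hab)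
    have hη0 : η = 0 := by
      rcases mul_eq_zero.1 e3.symm with h | h
      · exact h
      · rcases mul_eq_zero.1 h with h | h
        · exact absurd h ht0
        · exact absurd h hn
    rw [hη0] at hη
    simp at hη
    exact haq hη

/-- If the derivative has a limit at a puncture, the function extends differentiably. -/
lemma exists_hasFDerivAt_update {F : Type*} [NormedAddCommGroup F] [NormedSpace ℝ F]
    [CompleteSpace F] {f : Plane → F} {f' : Plane → Plane →L[ℝ] F} {q : Plane}
    {l : Plane →L[ℝ] F} (hd : ∀ᶠ z in 𝓝[≠] q, HasFDerivAt f (f' z) z)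
    (hl : Tendsto f' (𝓝[≠] q) (𝓝 l)) :
    ∃ c, Tendsto f (𝓝[≠] q) (𝓝 c) ∧ HasFDerivAt (Function.update f q c) l q := by
  have key : ∀ ε > 0, ∃ δ > 0, ∀ a ∈ Metric.ball q δ, a ≠ q → ∀ b ∈ Metric.ball q δ, b ≠ q →
      ‖(f b - f a) - l (b - a)‖ ≤ ε * ‖b - a‖ := by
    intro ε hε
    have h1 : ∀ᶠ z in 𝓝[≠] q, ‖f' z - l‖ < ε := by
      have := (hl.sub_const l).norm
      rw [sub_self, norm_zero] at this
      exact this.eventually (gt_mem_nhds hε)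
    obtain ⟨δ, hδ, hball⟩ := Metric.mem_nhdsWithin_iff.1 (hd.and h1)
    refine ⟨δ, hδ, fun a ha haq b hb hbq => ?_⟩
    have := norm_sub_le_of_punctured (f := fun z => f z - l z) (f' := fun z => f' z - l)
      (fun z hz hzq => (hball ⟨hz, hzq⟩).1.sub l.hasFDerivAt)
      (fun z hz hzq => (hball ⟨hz, hzq⟩).2.le) ha haq hb hbq
    rw [map_sub]
    convert this using 2
    abel
  have hcau : Cauchy (map f (𝓝[≠] q)) := by
    rw [Metric.cauchy_iff]
    refine ⟨inferInstance, fun ε hε => ?_⟩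
    obtain ⟨δ, hδ, hk⟩ := key 1 one_pos
    set δ' := min δ (ε / (2 * (1 + ‖l‖) + 1)) with hδ'
    have hpos : 0 < 2 * (1 + ‖l‖) + 1 := by positivity
    have hδ'0 : 0 < δ' := lt_min hδ (by positivity)
    refine ⟨f '' (Metric.ball q δ' ∩ {q}ᶜ), image_mem_map
      (Metric.mem_nhdsWithin_iff.2 ⟨δ', hδ'0, Subset.rfl⟩), ?_⟩
    rintro _ ⟨b, ⟨hb, hbq⟩, rfl⟩ _ ⟨a, ⟨ha, haq⟩, rfl⟩
    have hsub := Metric.ball_subset_ball (x := q) (min_le_left δ (ε / (2 * (1 + ‖l‖) + 1)))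
    have h1 := hk a (hsub ha) haq b (hsub hb) hbq
    have h2 : ‖b - a‖ ≤ 2 * δ' := by
      rw [← dist_eq_norm]
      have := dist_triangle_right b a q
      rw [Metric.mem_ball] at ha hb
      linarith
    have h3 : ‖f b - f a‖ ≤ (1 + ‖l‖) * ‖b - a‖ := by
      have := norm_add_le ((f b - f a) - l (b - a)) (l (b - a))
      rw [sub_add_cancel] at this
      have := l.le_opNorm (b - a)
      linarith
    have h4 : δ' * (2 * (1 + ‖l‖) + 1) ≤ ε := by
      rw [← le_div_iff₀ hpos]; exact min_le_right _ _
    rw [dist_eq_norm]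
    have h5 : (1 + ‖l‖) * ‖b - a‖ ≤ (1 + ‖l‖) * (2 * δ') :=
      mul_le_mul_of_nonneg_left h2 (by positivity)
    nlinarith
  obtain ⟨c, hc⟩ := CompleteSpace.complete hcau
  refine ⟨c, hc, ?_⟩
  rw [hasFDerivAt_iff_isLittleO, Asymptotics.isLittleO_iff]
  intro ε hε
  obtain ⟨δ, hδ, hk⟩ := key ε hε
  filter_upwards [Metric.ball_mem_nhds q hδ] with b hb
  rcases eq_or_ne b q with rfl | hbq
  · simp
  rw [Function.update_self, Function.update_of_ne hbq]
  have hid : Tendsto (fun a : Plane => a) (𝓝[≠] q) (𝓝 q) := nhdsWithin_le_nhds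
  have hc' : Tendsto f (𝓝[≠] q) (𝓝 c) := hc
  refine le_of_tendsto_of_tendsto (b := 𝓝[≠] q) (f := fun a => ‖(f b - f a) - l (b - a)‖)
    (g := fun a => ε * ‖b - a‖) ?_ ?_ ?_
  · exact ((tendsto_const_nhds.sub hc').sub
      ((l.continuous.tendsto _).comp (tendsto_const_nhds.sub hid))).norm
  · exact (tendsto_const_nhds.sub hid).norm.const_mul _
  · filter_upwards [nhdsWithin_le_nhds (Metric.ball_mem_nhds q hδ), self_mem_nhdsWithin] with a ha haq
    exact hk a ha haq b hb hbq

lemma eventually_punctured_notMem (hP : P.Finite) (q : Plane) : ∀ᶠ z in 𝓝[≠] q, z ∉ P := by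
  have : (P \ {q})ᶜ ∈ 𝓝 q := (hP.subset sdiff_subset).isClosed.isOpen_compl.mem_nhds (by simp)
  filter_upwards [nhdsWithin_le_nhds this, self_mem_nhdsWithin] with z hz hzq hzP
  exact hz ⟨hzP, hzq⟩

/-- At a genuine singularity the Hessian has no limit. -/
lemma not_tendsto_hess (hP : P.Finite) (hu : IsSolutionOff u P) {q : Plane} (hq : q ∈ P)
    {B : Plane →L[ℝ] Plane →L[ℝ] ℝ} (hB : Tendsto (hess u) (𝓝[≠] q) (𝓝 B)) : False := by
  have hev := eventually_punctured_notMem hP q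
  obtain ⟨l, hl, hl'⟩ := exists_hasFDerivAt_update
    (hev.mono fun z hz => hasFDerivAt_fderiv hP hu hz) hB
  obtain ⟨c, -, hc'⟩ := exists_hasFDerivAt_update
    (hev.mono fun z hz => (differentiableAt_of_notMem hP hu hz).hasFDerivAt) hl
  apply hu.singular q hq
  refine ⟨Function.update u q c, ?_, ?_⟩
  swap
  · filter_upwards [self_mem_nhdsWithin] with z hz
    exact Function.update_of_ne hz _ _
  have hupd : ∀ {F : Type} (g : Plane → F) (d : F) {z : Plane}, z ≠ q →
      Function.update g q d =ᶠ[𝓝 z] g := by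
    intro F g d z hz
    filter_upwards [isOpen_ne.mem_nhds hz] with y hy
    exact Function.update_of_ne hy _ _
  have hev' : ∀ᶠ z in 𝓝 q, z ≠ q → z ∉ P := eventually_nhdsWithin_iff.1 hev
  have h2 : ContDiffAt ℝ ((1 : ℕ) + 1) (Function.update u q c) q := by
    rw [contDiffAt_succ_iff_hasFDerivAt]
    refine ⟨Function.update (fderiv ℝ u) q l, ⟨_, hev', fun z hz => ?_⟩, ?_⟩
    · rcases eq_or_ne z q with rfl | hzq
      · rw [Function.update_self]; exact hc'
      · rw [Function.update_of_ne hzq]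
        exact (differentiableAt_of_notMem hP hu (hz hzq)).hasFDerivAt.congr_of_eventuallyEq
          (hupd _ _ hzq)
    have h1 : ContDiffAt ℝ ((0 : ℕ) + 1) (Function.update (fderiv ℝ u) q l) q := by
      rw [contDiffAt_succ_iff_hasFDerivAt]
      refine ⟨Function.update (hess u) q B, ⟨_, hev', fun z hz => ?_⟩, ?_⟩
      · rcases eq_or_ne z q with rfl | hzq
        · rw [Function.update_self]; exact hl'
        · rw [Function.update_of_ne hzq]
          exact (hasFDerivAt_fderiv hP hu (hz hzq)).congr_of_eventuallyEq (hupd _ _ hzq)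
      · rw [Nat.cast_zero, contDiffAt_zero]
        refine ⟨_, hev', fun z hz => ContinuousAt.continuousWithinAt ?_⟩
        rcases eq_or_ne z q with rfl | hzq
        · exact continuousAt_update_same.2 hB
        · exact (continuousAt_update_of_ne hzq).2 (continuousAt_hess hP hu (hz hzq))
    simpa using h1
  norm_num at h2
  exact h2

lemma tendsto_nhdsWithin_of_seq {X : Type*} [TopologicalSpace X] {A : Set Plane} {f : Plane → X}
    {q : Plane} {M : X} (h : ∀ y : ℕ → Plane, (∀ k, y k ∈ A) → Tendsto y atTop (𝓝 q) →
      ∃ φ : ℕ → ℕ, Tendsto (fun k => f (y (φ k))) atTop (𝓝 M)) : Tendsto f (𝓝[A] q) (𝓝 M) := by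
  apply tendsto_of_subseq_tendsto
  intro y hy
  obtain ⟨h1, h2⟩ := tendsto_nhdsWithin_iff.1 hy
  obtain ⟨N, hN⟩ := eventually_atTop.1 h2
  obtain ⟨φ, hφ⟩ := h (fun k => y (k + N)) (fun k => hN _ (Nat.le_add_left _ _))
    (h1.comp (tendsto_add_atTop_nat N))
  exact ⟨fun k => φ k + N, hφ⟩

/-- Moving along a P-free segment in the kernel direction of a non-zero Hessian. -/
lemma lap_ne_zero_of_segment (hP : P.Finite) (hu : IsSolutionOff u P) {z x : Plane}
    (hl : lap u z ≠ 0) (hx : hess u z x = 0) {t : ℝ} (hseg : ∀ s ∈ Icc (0 : ℝ) 1, z + (s * t) • x ∉ P) :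
    lap u (z + t • x) ≠ 0 ∧ hess u (z + t • x) x = 0 := by
  rcases eq_or_ne t 0 with rfl | ht
  · simpa using ⟨hl, hx⟩
  obtain ⟨a, b, hab⟩ := exists_affine_lap hP hu (x := t • x) hl (by simp [hx])
    (fun s hs => by rw [smul_smul]; exact hseg s hs)
  obtain ⟨h1, h2⟩ := hab 1 (by simp)
  rw [one_smul] at h1 h2
  refine ⟨fun h => by rw [h, zero_mul] at h1; exact zero_ne_one h1, ?_⟩
  rw [map_smul] at h2
  exact (smul_eq_zero.1 h2).resolve_left ht

/-- Along a chord in the kernel direction, the trace of the Hessian at the midpoint is the harmonic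
mean of its values at the end points, which have the same sign. -/
lemma lap_harmonic_mean (hP : P.Finite) (hu : IsSolutionOff u P) {y x : Plane}
    (hl : lap u y ≠ 0) (hx : hess u y x = 0) (hch : ∀ t ∈ Icc (-1 : ℝ) 1, y + t • x ∉ P) :
    0 < lap u (y - x) * lap u (y + x) ∧
      lap u y = 2 * (lap u (y - x) * lap u (y + x)) / (lap u (y - x) + lap u (y + x)) := by
  obtain ⟨h1, h2⟩ := lap_ne_zero_of_segment hP hu hl hx (t := -1)
    (fun s hs => hch _ ⟨by linarith [hs.2], by linarith [hs.1]⟩)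
  have e1 : y + (-1 : ℝ) • x = y - x := by module
  rw [e1] at h1 h2
  obtain ⟨a, b, hab⟩ := exists_affine_lap hP hu (x := (2 : ℝ) • x) h1 (by simp [h2])
    (fun s hs => by
      have : y - x + s • (2 : ℝ) • x = y + (2 * s - 1) • x := by module
      rw [this]
      exact hch _ ⟨by linarith [hs.1], by linarith [hs.2]⟩)
  have q0 := (hab 0 (by simp)).1
  have q1 := (hab (1 / 2) (by norm_num)).1
  have q2 := (hab 1 (by simp)).1
  have e2 : y - x + (0 : ℝ) • (2 : ℝ) • x = y - x := by module
  have e3 : y - x + (1 / 2 : ℝ) • (2 : ℝ) • x = y := by module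
  have e4 : y - x + (1 : ℝ) • (2 : ℝ) • x = y + x := by module
  rw [e2] at q0
  rw [e3] at q1
  rw [e4] at q2
  set s := lap u (y - x)
  set t := lap u (y + x)
  have hs : s ≠ 0 := h1
  have ht : t ≠ 0 := fun h => by rw [h, zero_mul] at q2; exact zero_ne_one q2
  have ha : a = 1 / s := by field_simp; linarith
  have hb : a + b = 1 / t := by field_simp; linarith
  have hst : 0 < s * t := by
    by_contra hneg
    have hneg' : a * (a + b) < 0 := by
      rw [hb, ha, one_div_mul_one_div]
      exact one_div_neg.2 (lt_of_le_of_ne (not_lt.1 hneg) (mul_ne_zero hs ht))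
    have hb0 : b ≠ 0 := by
      rintro rfl
      nlinarith [mul_self_nonneg a]
    have hroot : -a / b ∈ Icc (0 : ℝ) 1 := by
      have hb2 : 0 < b * b := mul_self_pos.2 hb0
      have e5 : -a / b = (-a * b) / (b * b) := by field_simp
      rw [e5]
      constructor
      · exact div_nonneg (by nlinarith [mul_self_nonneg a]) hb2.le
      · rw [div_le_one hb2]; nlinarith [mul_self_nonneg (a + b)]
    have := (hab _ hroot).1
    have e6 : a + b * (-a / b) = 0 := by field_simp; ring
    rw [e6, mul_zero] at this
    exact zero_ne_one this
  refine ⟨hst, ?_⟩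
  have hsum : s + t ≠ 0 := by
    intro h
    have : t = -s := by linarith
    rw [this] at hst
    nlinarith [mul_self_nonneg s]
  have q3 : lap u y * ((1 / s + 1 / t) / 2) = 1 := by
    rw [← hb, ← ha, ← q1]; ring
  field_simp at q3 ⊢
  linarith

lemma tendsto_harmonic_mean {s t : ℕ → ℝ} {a b : ℝ} (hst : ∀ k, 0 < s k * t k)
    (hprod : Tendsto (fun k => s k * t k) atTop (𝓝 (a * b)))
    (hsum : Tendsto (fun k => s k + t k) atTop (𝓝 (a + b))) :
    Tendsto (fun k => 2 * (s k * t k) / (s k + t k)) atTop (𝓝 (2 * (a * b) / (a + b))) := by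
  by_cases h : a + b = 0
  · rw [h, div_zero]
    have h0 : Tendsto (fun k => |s k + t k|) atTop (𝓝 0) := by
      have := hsum.abs
      rwa [h, abs_zero] at this
    refine squeeze_zero_norm (fun k => ?_) h0
    have hk := hst k
    have hne : s k + t k ≠ 0 := by
      intro h'
      have : t k = - s k := by linarith
      rw [this] at hk
      nlinarith [mul_self_nonneg (s k)]
    rw [Real.norm_eq_abs, abs_div, div_le_iff₀ (abs_pos.2 hne), abs_mul_abs_self,
      abs_of_pos (by linarith)]
    nlinarith [mul_self_nonneg (s k), mul_self_nonneg (t k), mul_self_nonneg (s k - t k)]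
  · exact (hprod.const_mul 2).div hsum h

/-! ### Singularities at which the kernels converge are removable -/

/-- Near `q`, the kernels of the non-zero Hessians of `u` tend to the line spanned by `w`. -/
def KernelTendsTo (u : Plane → ℝ) (P : Set Plane) (q w : Plane) : Prop :=
  ∀ (y x : ℕ → Plane) (x₀ : Plane), Tendsto y atTop (𝓝 q) → (∀ k, y k ∉ P) →
    (∀ k, lap u (y k) ≠ 0) → (∀ k, hess u (y k) (x k) = 0) → (∀ k, ‖x k‖ = 1) →
    Tendsto x atTop (𝓝 x₀) → cross w x₀ = 0

lemma exists_ball_inter_subset (hP : P.Finite) (q : Plane) :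
    ∃ r > 0, ∀ z ∈ Metric.ball q r, z ≠ q → z ∉ P := by
  obtain ⟨r, hr, h⟩ := Metric.mem_nhdsWithin_iff.1 (eventually_punctured_notMem hP q)
  exact ⟨r, hr, fun z hz hzq => h ⟨hz, hzq⟩⟩

/-- A closed condition that holds off a line through `q` near `y` holds at `y`. -/
lemma mem_of_eventually_off_line {X : Type*} [TopologicalSpace X] {f : Plane → X} {S : Set X}
    (hS : IsClosed S) {q w y : Plane} (hw : w ≠ 0) (hf : ContinuousAt f y)
    (h : ∀ᶠ z in 𝓝 y, cross w (z - q) ≠ 0 → f z ∈ S) : f y ∈ S := by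
  by_cases hy : cross w (y - q) = 0
  swap
  · exact h.self_of_nhds hy
  have hc : Tendsto (fun t : ℝ => y + t • rot w) (𝓝[≠] 0) (𝓝 y) := by
    have : Tendsto (fun t : ℝ => y + t • rot w) (𝓝 0) (𝓝 y) :=
      Continuous.tendsto' (by fun_prop) _ _ (by simp)
    exact this.mono_left nhdsWithin_le_nhds
  refine hS.mem_of_tendsto (hf.tendsto.comp hc) ?_
  filter_upwards [hc.eventually h, self_mem_nhdsWithin] with t ht ht0
  apply ht
  have : y + t • rot w - q = (y - q) + t • rot w := by abel
  rw [this, cross_add_right, hy, cross_smul_right, zero_add]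
  exact mul_ne_zero ht0 (cross_rot_self_ne hw)

lemma unitVec_zero (θ : ℝ) : unitVec θ 0 = Real.cos θ := by simp [unitVec]

lemma unitVec_one (θ : ℝ) : unitVec θ 1 = Real.sin θ := by simp [unitVec]

lemma isPreconnected_punctured_ball (q : Plane) (δ : ℝ) :
    IsPreconnected (Metric.ball q δ \ {q}) := by
  have h1 : Metric.ball q δ \ {q} =
      (fun a : ℝ × ℝ => q + a.1 • unitVec a.2) '' (Ioo 0 δ ×ˢ univ) := by
    ext z
    constructor
    · rintro ⟨hz, hzq⟩
      have hne : z - q ≠ 0 := sub_ne_zero.2 hzq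
      set c : ℂ := ⟨(z - q) 0, (z - q) 1⟩ with hc
      have hn : ‖c‖ = ‖z - q‖ := by
        rw [EuclideanSpace.norm_eq, Complex.norm_eq_sqrt_sq_add_sq]
        simp [hc, Fin.sum_univ_two]
      refine ⟨(‖z - q‖, Complex.arg c), ⟨⟨norm_pos_iff.2 hne, ?_⟩, mem_univ _⟩, ?_⟩
      · rwa [Metric.mem_ball, dist_eq_norm] at hz
      · have h0 := Complex.norm_mul_cos_arg c
        have h1 := Complex.norm_mul_sin_arg c
        rw [hn] at h0 h1
        apply plane_ext
        · simp only [PiLp.add_apply, PiLp.smul_apply, unitVec_zero, smul_eq_mul, h0]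
          simp [hc]
        · simp only [PiLp.add_apply, PiLp.smul_apply, unitVec_one, smul_eq_mul, h1]
          simp [hc]
    · rintro ⟨⟨ρ, θ⟩, ⟨⟨h0, h1⟩, -⟩, rfl⟩
      have hn : ‖unitVec θ‖ = 1 := by
        rw [EuclideanSpace.norm_eq]; simp [unitVec, Fin.sum_univ_two]
      have hu0 : unitVec θ ≠ 0 := by rw [← norm_ne_zero_iff, hn]; exact one_ne_zero
      refine ⟨?_, ?_⟩
      · simp only [Metric.mem_ball, dist_eq_norm, add_sub_cancel_left, norm_smul, hn, mul_one,
          Real.norm_eq_abs, abs_of_pos h0]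
        exact h1
      · simp [h0.ne', hu0]
  rw [h1]
  apply IsPreconnected.image
  · exact isPreconnected_Ioo.prod isPreconnected_univ
  · apply Continuous.continuousOn
    have : Continuous fun a : ℝ × ℝ => unitVec a.2 := by
      unfold unitVec; fun_prop
    fun_prop

/-- A leaf that runs into `q` lies on the limit line of the kernels. -/
lemma cross_eq_zero_of_leaf_through (hP : P.Finite) (hu : IsSolutionOff u P) {q w : Plane}
    (hk : KernelTendsTo u P q w) {r : ℝ} (hr : ∀ z ∈ Metric.ball q r, z ≠ q → z ∉ P)
    {y x : Plane} (hyr : y ∈ Metric.ball q r) (hyq : y ≠ q) (hl : lap u y ≠ 0)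
    (hx : hess u y x = 0) (hn : ‖x‖ = 1) {t : ℝ} (ht : q = y + t • x) : cross w x = 0 := by
  have ht0 : t ≠ 0 := by rintro rfl; simp at ht; exact hyq ht.symm
  have hx0 : x ≠ 0 := by rw [← norm_ne_zero_iff, hn]; exact one_ne_zero
  have hseg : ∀ s : ℝ, 0 ≤ s → s < 1 → y + (s * t) • x ∉ P := by
    intro s hs0 hs1
    have hd : y + (s * t) • x - q = (1 - s) • (y - q) := by rw [ht]; module
    apply hr
    · rw [Metric.mem_ball, dist_eq_norm, hd, norm_smul, Real.norm_eq_abs,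
        abs_of_pos (by linarith)]
      rw [Metric.mem_ball, dist_eq_norm] at hyr
      nlinarith [norm_nonneg (y - q)]
    · intro h
      rw [h, sub_self] at hd
      rcases smul_eq_zero.1 hd.symm with h | h
      · linarith
      · exact hyq (sub_eq_zero.1 h)
  have hc : ∀ k : ℕ, (0 : ℝ) ≤ 1 - 1 / ((k : ℝ) + 1) ∧ 1 - 1 / ((k : ℝ) + 1) < 1 := by
    intro k
    have h1 : (0 : ℝ) < (k : ℝ) + 1 := by positivity
    have h2 : 1 / ((k : ℝ) + 1) ≤ 1 := by rw [div_le_one h1]; linarith [Nat.cast_nonneg (α := ℝ) k]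
    have h3 : 0 < 1 / ((k : ℝ) + 1) := by positivity
    constructor <;> linarith
  have hW : ∀ k : ℕ, lap u (y + ((1 - 1 / ((k : ℝ) + 1)) * t) • x) ≠ 0 ∧
      hess u (y + ((1 - 1 / ((k : ℝ) + 1)) * t) • x) x = 0 := by
    intro k
    apply lap_ne_zero_of_segment hP hu hl hx
    intro s hs
    rw [← mul_assoc]
    obtain ⟨h1, h2⟩ := hc k
    exact hseg _ (mul_nonneg hs.1 h1) (by nlinarith [hs.1, hs.2])
  refine hk (fun k => y + ((1 - 1 / ((k : ℝ) + 1)) * t) • x) (fun _ => x) x ?_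
    (fun k => hseg _ (hc k).1 (hc k).2) (fun k => (hW k).1) (fun k => (hW k).2) (fun _ => hn)
    tendsto_const_nhds
  have h1 : Tendsto (fun k : ℕ => (1 - 1 / ((k : ℝ) + 1)) * t) atTop (𝓝 ((1 - 0) * t)) :=
    (tendsto_const_nhds.sub tendsto_one_div_add_atTop_nhds_zero_nat).mul_const t
  have := (h1.smul_const x).const_add y
  rw [sub_zero, one_mul, ← ht] at this
  exact this

lemma eq_or_eq_neg_of_cross_eq_zero {w x : Plane} (hw : ‖w‖ = 1) (hx : ‖x‖ = 1)
    (h : cross w x = 0) : x = w ∨ x = -w := by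
  have hw0 : w ≠ 0 := by rw [← norm_ne_zero_iff, hw]; exact one_ne_zero
  obtain ⟨t, rfl⟩ := exists_eq_smul_of_cross_eq_zero hw0 h
  rw [norm_smul, hw, mul_one, Real.norm_eq_abs] at hx
  rcases eq_or_eq_neg_of_abs_eq hx with h | h
  · left; rw [h, one_smul]
  · right; rw [h, neg_one_smul]

lemma exists_subseq_null (hP : P.Finite) (hu : IsSolutionOff u P) {y : ℕ → Plane}
    (hy : ∀ k, y k ∉ P) : ∃ (φ : ℕ → ℕ) (x : ℕ → Plane) (x₀ : Plane), StrictMono φ ∧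
      (∀ k, hess u (y (φ k)) (x k) = 0) ∧ (∀ k, ‖x k‖ = 1) ∧ ‖x₀‖ = 1 ∧
      Tendsto x atTop (𝓝 x₀) := by
  choose x hx using fun k => exists_null hP hu (hy k)
  obtain ⟨x₀, hx₀, φ, hφ, hlim⟩ := (isCompact_sphere (0 : Plane) 1).tendsto_subseq
    (x := x) (fun k => by simpa using (hx k).1)
  exact ⟨φ, x ∘ φ, x₀, hφ, fun k => (hx _).2, fun k => (hx _).1, by simpa using hx₀, hlim⟩

/-- If the kernels have a limit direction at a puncture, the singularity there is removable. -/
theorem not_kernelTendsTo (hP : P.Finite) (hu : IsSolutionOff u P) {q : Plane} (hq : q ∈ P)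
    {w : Plane} (hw0 : w ≠ 0) : ¬ KernelTendsTo u P q w := by
  intro hk
  wlog hw : ‖w‖ = 1 generalizing w
  · refine this (w := ‖w‖⁻¹ • w) (smul_ne_zero (inv_ne_zero (norm_ne_zero_iff.2 hw0)) hw0) ?_
      (by rw [norm_smul, norm_inv, norm_norm, inv_mul_cancel₀ (norm_ne_zero_iff.2 hw0)])
    intro y x x₀ h1 h2 h3 h4 h5 h6
    rw [cross_smul_left, hk y x x₀ h1 h2 h3 h4 h5 h6, mul_zero]
  obtain ⟨R, hR, hRP⟩ := exists_ball_inter_subset hP q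
  set r := R / 4 with hr
  have hr0 : 0 < r := by positivity
  have hside : ∀ s : ℝ, |s| = r → q + s • w ∉ P := by
    intro s hs
    apply hRP
    · rw [Metric.mem_ball, dist_eq_norm, add_sub_cancel_left, norm_smul, hw, Real.norm_eq_abs, hs]
      linarith
    · intro h
      have h2 : s • w = 0 := by simpa using h
      rcases smul_eq_zero.1 h2 with h | h
      · rw [h, abs_zero] at hs; linarith
      · exact hw0 h
  set a := lap u (q - r • w) with ha
  set b := lap u (q + r • w) with hb
  have hqp : q + r • w ∉ P := hside r (abs_of_pos hr0)
  have hqm : q - r • w ∉ P := by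
    have := hside (-r) (by rw [abs_neg, abs_of_pos hr0])
    rwa [neg_smul, ← sub_eq_add_neg] at this
  set M := 2 * (a * b) / (a + b) with hM
  set A : Set Plane := {y | y ∉ P ∧ lap u y ≠ 0 ∧ cross w (y - q) ≠ 0} with hA
  set B : Set Plane := {y | y ∉ P ∧ cross w (y - q) ≠ 0} with hB
  -- the trace converges off the limit line, through points with non-zero Hessian
  have hTA : Tendsto (lap u) (𝓝[A] q) (𝓝 M) := by
    apply tendsto_nhdsWithin_of_seq
    intro y hyA hyq
    obtain ⟨φ, x, x₀, hφ, hx, hxn, hx₀n, hxlim⟩ := exists_subseq_null hP hu (fun k => (hyA k).1)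
    have hyφ : Tendsto (fun k => y (φ k)) atTop (𝓝 q) := hyq.comp hφ.tendsto_atTop
    have hx₀ := hk _ x x₀ hyφ (fun k => (hyA _).1) (fun k => (hyA _).2.1) hx hxn hxlim
    obtain ⟨N, hN⟩ := eventually_atTop.1 (hyφ.eventually (Metric.ball_mem_nhds q hr0))
    refine ⟨fun k => φ (k + N), ?_⟩
    have hchord : ∀ k, ∀ t ∈ Icc (-1 : ℝ) 1, y (φ (k + N)) + t • r • x (k + N) ∉ P := by
      intro k t ht
      have hyk := hN (k + N) (Nat.le_add_left _ _)
      have hA' := hyA (φ (k + N))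
      have hlt : ‖t • r • x (k + N)‖ ≤ r := by
        rw [norm_smul, norm_smul, hxn, mul_one, Real.norm_eq_abs, Real.norm_eq_abs,
          abs_of_pos hr0]
        have : |t| ≤ 1 := abs_le.2 ht
        nlinarith
      apply hRP
      · rw [Metric.mem_ball, dist_eq_norm]
        rw [dist_eq_norm] at hyk
        have : y (φ (k + N)) + t • r • x (k + N) - q
            = (y (φ (k + N)) - q) + t • r • x (k + N) := by abel
        rw [this]
        have := norm_add_le (y (φ (k + N)) - q) (t • r • x (k + N))
        linarith
      · intro h
        have h1 : q = y (φ (k + N)) + (t * r) • x (k + N) := by rw [← smul_smul, h]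
        have hyR : y (φ (k + N)) ∈ Metric.ball q R :=
          Metric.ball_subset_ball (by linarith) hyk
        have hyne : y (φ (k + N)) ≠ q := by
          intro h; apply hA'.2.2; rw [h, sub_self, cross_zero_right]
        have h2 := cross_eq_zero_of_leaf_through hP hu hk hRP hyR hyne hA'.2.1 (hx _) (hxn _) h1
        apply hA'.2.2
        have h3 : y (φ (k + N)) - q = (-(t * r)) • x (k + N) := by
          rw [sub_eq_iff_eq_add, h1]; module
        rw [h3, cross_smul_right, h2, mul_zero]
    have hmean := fun k => lap_harmonic_mean hP hu (x := r • x (k + N)) (hyA (φ (k + N))).2.1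
      (by rw [map_smul, hx, smul_zero]) (hchord k)
    simp_rw [fun k => (hmean k).2]
    have hyN : Tendsto (fun k => y (φ (k + N))) atTop (𝓝 q) :=
      hyφ.comp (tendsto_add_atTop_nat N)
    have hxN : Tendsto (fun k => x (k + N)) atTop (𝓝 x₀) := hxlim.comp (tendsto_add_atTop_nat N)
    have lm := hyN.sub (hxN.const_smul r)
    have lp := hyN.add (hxN.const_smul r)
    rcases eq_or_eq_neg_of_cross_eq_zero hw hx₀n hx₀ with h | h
    · rw [h] at lm lp
      have l1 := (continuousAt_lap hP hu hqm).tendsto.comp lm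
      have l2 := (continuousAt_lap hP hu hqp).tendsto.comp lp
      exact tendsto_harmonic_mean (fun k => (hmean k).1) (l1.mul l2) (l1.add l2)
    · rw [h] at lm lp
      rw [smul_neg, sub_neg_eq_add] at lm
      rw [smul_neg, ← sub_eq_add_neg] at lp
      have l1 := (continuousAt_lap hP hu hqp).tendsto.comp lm
      have l2 := (continuousAt_lap hP hu hqm).tendsto.comp lp
      have := tendsto_harmonic_mean (fun k => (hmean k).1) (l1.mul l2) (l1.add l2)
      rw [hM, mul_comm a b, add_comm a b]
      exact this
  -- by connectedness of the punctured disc it converges off the limit line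
  obtain ⟨M', hTB⟩ : ∃ M', Tendsto (lap u) (𝓝[B] q) (𝓝 M') := by
    have hBA : B = A ∪ (B ∩ {y | lap u y = 0}) := by
      ext y
      simp only [hA, hB, mem_ofPred_eq, mem_union, mem_inter_iff]
      tauto
    have hzero : Tendsto (lap u) (𝓝[B ∩ {y | lap u y = 0}] q) (𝓝 0) := by
      refine tendsto_const_nhds.congr' ?_
      filter_upwards [self_mem_nhdsWithin] with y hy
      exact hy.2.symm
    by_cases hM0 : M = 0
    · refine ⟨0, ?_⟩
      rw [hBA, nhdsWithin_union]
      rw [hM0] at hTA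
      exact hTA.sup hzero
    · have hc : 0 < |M| / 2 := by positivity
      have hgt : ∀ᶠ y in 𝓝[A] q, |M| / 2 < |lap u y| :=
        hTA.abs.eventually (lt_mem_nhds (by linarith [abs_pos.2 hM0]))
      obtain ⟨δ₀, hδ₀, hball⟩ := Metric.mem_nhdsWithin_iff.1 hgt
      set δ := min δ₀ R with hδ
      have hδpos : 0 < δ := lt_min hδ₀ hR
      set D := Metric.ball q δ \ {q} with hD
      have hDP : ∀ y ∈ D, y ∉ P := fun y hy =>
        hRP y (Metric.ball_subset_ball (min_le_right _ _) hy.1) hy.2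
      have hDo : IsOpen D := Metric.isOpen_ball.sdiff isClosed_singleton
      set S : Set ℝ := {v | v = 0 ∨ |M| / 2 ≤ |v|} with hS
      have hSc : IsClosed S :=
        (isClosed_eq continuous_id continuous_const).union
          (isClosed_le continuous_const continuous_abs)
      have hDS : ∀ y ∈ D, lap u y ∈ S := by
        intro y hy
        refine mem_of_eventually_off_line hSc hw0 (q := q) (continuousAt_lap hP hu (hDP y hy)) ?_
        filter_upwards [hDo.mem_nhds hy] with z hz hzw
        by_cases h : lap u z = 0
        · exact Or.inl h
        · exact Or.inr (hball ⟨Metric.ball_subset_ball (min_le_left _ _) hz.1,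
            hDP z hz, h, hzw⟩).le
      have hpre : IsPreconnected (lap u '' D) :=
        (isPreconnected_punctured_ball q δ).image _
          fun y hy => (continuousAt_lap hP hu (hDP y hy)).continuousWithinAt
      have hord := hpre.ordConnected
      by_cases hall : ∀ y ∈ D, lap u y = 0
      · refine ⟨0, tendsto_const_nhds.congr' ?_⟩
        filter_upwards [self_mem_nhdsWithin, nhdsWithin_le_nhds (Metric.ball_mem_nhds q hδpos)]
          with y hy hyδ
        refine (hall y ⟨hyδ, ?_⟩).symm
        rintro rfl
        exact hy.2 (by rw [sub_self, cross_zero_right])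
      · push Not at hall
        obtain ⟨y₁, hy₁, hne⟩ := hall
        have hno : ∀ y ∈ D, lap u y ≠ 0 := by
          intro y hy h0
          have h1 : |M| / 2 ≤ |lap u y₁| := (hDS y₁ hy₁).resolve_left hne
          have hm0 : (0 : ℝ) ∈ lap u '' D := ⟨y, hy, h0⟩
          have hm1 : lap u y₁ ∈ lap u '' D := ⟨y₁, hy₁, rfl⟩
          have hq4 : 0 < |M| / 4 := by linarith
          rcases le_total 0 (lap u y₁) with hs | hs
          · rw [abs_of_nonneg hs] at h1
            obtain ⟨z, hz, hzv⟩ := hord.out hm0 hm1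
              (show |M| / 4 ∈ Icc 0 (lap u y₁) from ⟨by linarith, by linarith⟩)
            rcases hDS z hz with h | h
            · rw [hzv] at h; linarith
            · rw [hzv, abs_of_pos hq4] at h; linarith
          · rw [abs_of_nonpos hs] at h1
            obtain ⟨z, hz, hzv⟩ := hord.out hm1 hm0
              (show -(|M| / 4) ∈ Icc (lap u y₁) 0 from ⟨by linarith, by linarith⟩)
            rcases hDS z hz with h | h
            · rw [hzv] at h; linarith
            · rw [hzv, abs_neg, abs_of_pos hq4] at h; linarith
        refine ⟨M, hTA.mono_left ?_⟩
        have hmem : B ∩ Metric.ball q δ ⊆ A := by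
          rintro y ⟨hy, hyδ⟩
          refine ⟨hy.1, hno y ⟨hyδ, ?_⟩, hy.2⟩
          rintro rfl
          exact hy.2 (by rw [sub_self, cross_zero_right])
        rw [← nhdsWithin_inter_of_mem' (nhdsWithin_le_nhds (Metric.ball_mem_nhds q hδpos))]
        exact nhdsWithin_mono _ hmem
  -- by density of the complement of the line it converges
  have hTP : Tendsto (lap u) (𝓝[Pᶜ] q) (𝓝 M') := by
    rw [Metric.tendsto_nhds]
    intro ε hε
    have h1 := (Metric.tendsto_nhds.1 hTB) (ε / 2) (half_pos hε)
    obtain ⟨δ, hδ, hball⟩ := Metric.mem_nhdsWithin_iff.1 h1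
    filter_upwards [self_mem_nhdsWithin, nhdsWithin_le_nhds (Metric.ball_mem_nhds q hδ)]
      with y hyP hyδ
    have : lap u y ∈ Metric.closedBall M' (ε / 2) := by
      refine mem_of_eventually_off_line Metric.isClosed_closedBall hw0 (q := q)
        (continuousAt_lap hP hu hyP) ?_
      filter_upwards [Metric.isOpen_ball.mem_nhds hyδ, hP.isClosed.isOpen_compl.mem_nhds hyP]
        with z hzδ hzP hzw
      exact Metric.ball_subset_closedBall (hball ⟨hzδ, hzP, hzw⟩)
    rw [Metric.mem_closedBall] at this
    linarith
  -- the Hessian is recovered from its trace and its kernel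
  have hTH : ∀ p p' : Plane, Tendsto (fun y => hess u y p p') (𝓝[Pᶜ] q)
      (𝓝 (M' * (cross w p * cross w p'))) := by
    intro p p'
    have hsplit : Pᶜ = (Pᶜ ∩ {y | lap u y ≠ 0}) ∪ (Pᶜ ∩ {y | lap u y = 0}) := by
      ext y; simp only [mem_union, mem_inter_iff, mem_ofPred_eq]; tauto
    rw [hsplit, nhdsWithin_union]
    refine Tendsto.sup ?_ ?_
    · apply tendsto_nhdsWithin_of_seq
      intro y hyA hyq
      obtain ⟨φ, x, x₀, hφ, hx, hxn, hx₀n, hxlim⟩ := exists_subseq_null hP hu (fun k => (hyA k).1)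
      have hyφ : Tendsto (fun k => y (φ k)) atTop (𝓝 q) := hyq.comp hφ.tendsto_atTop
      have hx₀ := hk _ x x₀ hyφ (fun k => (hyA _).1) (fun k => (hyA _).2) hx hxn hxlim
      refine ⟨φ, ?_⟩
      simp_rw [fun k => hess_eq_of_null hP hu (hyA (φ k)).1 (hx k) (hxn k) p p']
      have hl : Tendsto (fun k => lap u (y (φ k))) atTop (𝓝 M') :=
        hTP.comp (tendsto_nhdsWithin_iff.2 ⟨hyφ, Eventually.of_forall fun k => (hyA _).1⟩)
      have e : cross w p * cross w p' = cross x₀ p * cross x₀ p' := by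
        rcases eq_or_eq_neg_of_cross_eq_zero hw hx₀n hx₀ with h | h
        · rw [h]
        · rw [h, cross_neg_left, cross_neg_left, neg_mul_neg]
      rw [e]
      exact hl.mul ((hxlim.cross tendsto_const_nhds).mul (hxlim.cross tendsto_const_nhds))
    · have h1 : Tendsto (fun y => lap u y * (cross w p * cross w p'))
          (𝓝[Pᶜ ∩ {y | lap u y = 0}] q) (𝓝 (M' * (cross w p * cross w p'))) :=
        (hTP.mono_left (nhdsWithin_mono _ inter_subset_left)).mul_const _
      refine h1.congr' ?_
      filter_upwards [self_mem_nhdsWithin] with y hy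
      have h0 : lap u y = 0 := hy.2
      rw [h0, zero_mul, (lap_eq_zero_iff hP hu hy.1).1 h0]
      simp
  let pr : Fin 2 → Plane →L[ℝ] ℝ := fun i => EuclideanSpace.proj i
  let E : Fin 2 → Fin 2 → Plane →L[ℝ] Plane →L[ℝ] ℝ := fun i j => (pr i).smulRight (pr j)
  have hrep : ∀ y : Plane, hess u y =
      (hess u y e₀ e₀ • E 0 0 + hess u y e₀ e₁ • E 0 1) +
        (hess u y e₁ e₀ • E 1 0 + hess u y e₁ e₁ • E 1 1) := by
    intro y
    ext p p'
    conv_lhs => rw [plane_eq p, plane_eq p']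
    simp [E, pr]
    ring
  have : ContinuousAdd (Plane →L[ℝ] Plane →L[ℝ] ℝ) :=
    (inferInstance : IsTopologicalAddGroup (Plane →L[ℝ] Plane →L[ℝ] ℝ)).toContinuousAdd
  have hlim := (((hTH e₀ e₀).smul_const (E 0 0)).add ((hTH e₀ e₁).smul_const (E 0 1))).add
      (((hTH e₁ e₀).smul_const (E 1 0)).add ((hTH e₁ e₁).smul_const (E 1 1)))
  have hle : 𝓝[≠] q ≤ 𝓝[Pᶜ] q :=
    le_inf nhdsWithin_le_nhds (le_principal_iff.2 (eventually_punctured_notMem hP q))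
  exact not_tendsto_hess hP hu hq ((hlim.congr fun y => (hrep y).symm).mono_left hle)

/-! ### Half-strips, generic points and supporting rays -/

lemma linearIndependent_of_cross_ne_zero {d v : Plane} (h : cross d v ≠ 0) :
    LinearIndependent ℝ ![d, v] := by
  rw [LinearIndependent.pair_iff]
  intro s t hst
  have h1 := congrArg (fun z => cross z v) hst
  have h2 := congrArg (fun z => cross d z) hst
  simp only [cross_add_left, cross_smul_left, cross_self_eq_zero, mul_zero, add_zero,
    cross_zero_left, cross_add_right, cross_smul_right, zero_add, cross_zero_right] at h1 h2
  exact ⟨(mul_eq_zero.1 h1).resolve_right h, (mul_eq_zero.1 h2).resolve_right h⟩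

/-- A solution with vanishing Hessian on a convex open set is affine there. -/
lemma exists_eqOn_affine (hP : P.Finite) (hu : IsSolutionOff u P) {U : Set Plane} (hU : IsOpen U)
    (hUc : Convex ℝ U) (hUP : U ⊆ Pᶜ) (hl : ∀ z ∈ U, lap u z = 0) : IsLinearOn u U := by
  rcases U.eq_empty_or_nonempty with rfl | ⟨c, hc⟩
  · exact ⟨0, fun z hz => hz.elim⟩
  have hconst : ∀ z ∈ U, fderiv ℝ u z = fderiv ℝ u c := fun z hz =>
    hU.is_const_of_fderiv_eq_zero (𝕜 := ℝ) hUc.isPreconnected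
      (fun y hy => (hasFDerivAt_fderiv hP hu (hUP hy)).differentiableAt.differentiableWithinAt)
      (fun y hy => (lap_eq_zero_iff hP hu (hUP hy)).1 (hl y hy)) hz hc
  have hd : ∀ z ∈ U, HasFDerivAt (fun y => u y - fderiv ℝ u c y) (0 : Plane →L[ℝ] ℝ) z := by
    intro z hz
    have h1 := (differentiableAt_of_notMem hP hu (hUP hz)).hasFDerivAt.sub
      (fderiv ℝ u c).hasFDerivAt
    rw [hconst z hz, sub_self] at h1
    exact h1
  have hconst2 : ∀ z ∈ U, u z - fderiv ℝ u c z = u c - fderiv ℝ u c c := fun z hz =>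
    hU.is_const_of_fderiv_eq_zero (𝕜 := ℝ) (f := fun y => u y - fderiv ℝ u c y) hUc.isPreconnected
      (fun y hy => (hd y hy).differentiableAt.differentiableWithinAt)
      (fun y hy => (hd y hy).fderiv) hz hc
  refine ⟨(fderiv ℝ u c : Plane →ₗ[ℝ] ℝ).toAffineMap +
    AffineMap.const ℝ Plane (u c - fderiv ℝ u c c), fun z hz => ?_⟩
  have := hconst2 z hz
  simp only [AffineMap.coe_add, Pi.add_apply, LinearMap.coe_toAffineMap, AffineMap.const_apply,
    ContinuousLinearMap.coe_coe]
  linarith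

lemma mem_halfStrip_iff {a d v z : Plane} (h : cross d v ≠ 0) :
    z ∈ halfStrip a d v ↔ cross (z - a) v / cross d v ∈ Ioo (0 : ℝ) 1 ∧
      0 < cross d (z - a) / cross d v := by
  constructor
  · rintro ⟨s, hs, t, ht, rfl⟩
    have e : a + s • d + t • v - a = s • d + t • v := by abel
    rw [e, cross_add_left, cross_add_right]
    simp only [cross_smul_left, cross_smul_right, cross_self_eq_zero, mul_zero, add_zero, zero_add,
      mul_div_cancel_right₀ _ h]
    exact ⟨hs, ht⟩
  · rintro ⟨hs, ht⟩
    refine ⟨_, hs, _, ht, ?_⟩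
    have := eq_smul_add_smul h (z - a)
    rw [add_assoc, ← this]
    abel

/-- Admissibility in the form in which it is used: every half-strip in the domain contains a point
with non-zero Hessian. -/
lemma exists_lap_ne_zero_of_halfStrip (hP : P.Finite) (hu : IsSolutionOff u P)
    (hadm : IsAdmissible u P) {a d v : Plane} (h : cross d v ≠ 0) (hsub : halfStrip a d v ⊆ Pᶜ) :
    ∃ y ∈ halfStrip a d v, lap u y ≠ 0 := by
  by_contra hno
  push Not at hno
  refine hadm a d v (linearIndependent_of_cross_ne_zero h) hsub ?_
  have hset : halfStrip a d v = {z | cross (z - a) v / cross d v ∈ Ioo (0 : ℝ) 1 ∧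
      0 < cross d (z - a) / cross d v} := ext fun z => mem_halfStrip_iff h
  have c1 : Continuous fun z : Plane => cross (z - a) v / cross d v := by
    unfold cross; fun_prop
  have c2 : Continuous fun z : Plane => cross d (z - a) / cross d v := by
    unfold cross; fun_prop
  refine exists_eqOn_affine hP hu ?_ ?_ hsub hno
  · rw [hset]
    exact (isOpen_Ioo.preimage c1).inter (isOpen_lt continuous_const c2)
  · rintro _ ⟨s, hs, t, ht, rfl⟩ _ ⟨s', hs', t', ht', rfl⟩ α β hα hβ hαβ
    refine ⟨α * s + β * s', (convex_Ioo (0 : ℝ) 1) hs hs' hα hβ hαβ, α * t + β * t', ?_, ?_⟩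
    · have := (convex_Ioi (0 : ℝ)) (show t ∈ Ioi 0 from ht) (show t' ∈ Ioi 0 from ht') hα hβ hαβ
      exact this
    · have : a = α • a + β • a := by rw [← add_smul, hαβ, one_smul]
      nth_rewrite 3 [this]
      module

/-- Points off finitely many lines are dense. -/
lemma dense_forall_cross_ne_zero {S : Set (Plane × Plane)} (hS : S.Finite)
    (h0 : ∀ s ∈ S, s.1 ≠ 0) : Dense {y : Plane | ∀ s ∈ S, cross s.1 (y - s.2) ≠ 0} := by
  have e : {y : Plane | ∀ s ∈ S, cross s.1 (y - s.2) ≠ 0} =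
      ⋂ s ∈ S, {y : Plane | cross s.1 (y - s.2) ≠ 0} := by ext y; simp
  rw [e]
  refine dense_biInter_of_isOpen (fun s _ => ?_) hS.countable (fun s hs => ?_)
  · have : Continuous fun y : Plane => cross s.1 (y - s.2) := by unfold cross; fun_prop
    exact isOpen_ne_fun this continuous_const
  · intro y
    rw [mem_closure_iff_frequently]
    intro hno
    exact mem_of_eventually_off_line (f := fun z : Plane => z) (S := ∅) isClosed_empty (h0 s hs)
      continuousAt_id (hno.mono fun z hz hz' => hz hz')

lemma exists_forall_cross_secant_ne_zero (hP : P.Finite) {O : Set Plane} (hO : IsOpen O)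
    (hne : O.Nonempty) :
    ∃ y ∈ O, ∀ p ∈ P, ∀ p' ∈ P, p ≠ p' → cross (p' - p) (y - p) ≠ 0 := by
  have hfin : ((fun a : Plane × Plane => (a.2 - a.1, a.1)) ''
      {a | a ∈ P ×ˢ P ∧ a.1 ≠ a.2}).Finite :=
    ((hP.prod hP).subset fun a ha => ha.1).image _
  have hd := dense_forall_cross_ne_zero hfin (by
    rintro _ ⟨a, ha, rfl⟩
    exact sub_ne_zero.2 ha.2.symm)
  obtain ⟨y, hyO, hy⟩ := hd.inter_open_nonempty O hO hne
  exact ⟨y, hyO, fun p hp p' hp' hpp => hy (p' - p, p) ⟨(p, p'), ⟨⟨hp, hp'⟩, hpp⟩, rfl⟩⟩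

lemma dense_generic_direction (hP : P.Finite) :
    Dense {v : Plane | ∀ p ∈ P, ∀ p' ∈ P, p ≠ p' → cross v (p' - p) ≠ 0} := by
  have hfin : ((fun a : Plane × Plane => (a.2 - a.1, (0 : Plane))) ''
      {a | a ∈ P ×ˢ P ∧ a.1 ≠ a.2}).Finite :=
    ((hP.prod hP).subset fun a ha => ha.1).image _
  refine (dense_forall_cross_ne_zero hfin ?_).mono ?_
  · rintro _ ⟨a, ha, rfl⟩
    exact sub_ne_zero.2 ha.2.symm
  · intro v hv p hp p' hp' hpp h
    refine hv (p' - p, 0) ⟨(p, p'), ⟨⟨hp, hp'⟩, hpp⟩, rfl⟩ ?_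
    rw [sub_zero, cross_swap, h, neg_zero]

/-- Two transversal null vectors are impossible at a point with non-zero Hessian. -/
lemma false_of_two_null {z x y : Plane} (hl : lap u z ≠ 0) (hx : hess u z x = 0)
    (hy : hess u z y = 0) (hxy : cross x y ≠ 0) : False :=
  hl (by simp [lap, hess_eq_zero_of_null hx hy hxy])

lemma hess_eq_zero_of_cross_eq_zero {z x y : Plane} (hx : hess u z x = 0) (hx0 : x ≠ 0)
    (h : cross x y = 0) : hess u z y = 0 := by
  obtain ⟨t, rfl⟩ := exists_eq_smul_of_cross_eq_zero hx0 h
  simp [hx]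

/-- The Hessian annihilates the direction `v` along the ray issuing from `q` in this direction. -/
def RayNull (u : Plane → ℝ) (P : Set Plane) (q v : Plane) : Prop :=
  ∀ t : ℝ, 0 < t → q + t • v ∉ P → hess u (q + t • v) v = 0

lemma isClosed_rayNull (hP : P.Finite) (hu : IsSolutionOff u P) (q : Plane) (σ : ℝ) :
    IsClosed {v | RayNull u P q (σ • v)} := by
  have e : {v | RayNull u P q (σ • v)} = ⋂ (t : ℝ) (_ : 0 < t),
      {v | q + t • σ • v ∉ P → hess u (q + t • σ • v) (σ • v) = 0} := by
    ext v; simp [RayNull]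
  rw [e]
  refine isClosed_biInter fun t _ => ?_
  rw [← isOpen_compl_iff, isOpen_iff_mem_nhds]
  intro v hv
  have hv' : q + t • σ • v ∉ P ∧ hess u (q + t • σ • v) (σ • v) ≠ 0 := by
    simpa using hv
  have hc : Continuous fun v : Plane => q + t • σ • v := by fun_prop
  have h1 : ∀ᶠ w in 𝓝 v, q + t • σ • w ∉ P :=
    hc.continuousAt.eventually (hP.isClosed.isOpen_compl.mem_nhds hv'.1)
  have h2 : ContinuousAt (fun w : Plane => hess u (q + t • σ • w) (σ • w)) v :=
    ((continuousAt_hess hP hu hv'.1).comp (f := fun w : Plane => q + t • σ • w)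
      hc.continuousAt).clm_apply (by fun_prop)
  filter_upwards [h1, h2.eventually_ne hv'.2] with w hw1 hw2
  exact fun h => hw2 (h hw1)

/-- The directions `v` of those oriented lines that support `P`, with `P` to the left, and contain
from some point of `P` on a ray in the direction `σ v` of null vectors. -/
def tangentRays (u : Plane → ℝ) (P : Set Plane) (σ : ℝ) : Set Plane :=
  {v | ∃ q ∈ P, (∀ p ∈ P, 0 ≤ cross v (p - q)) ∧ RayNull u P q (σ • v)}

lemma isClosed_tangentRays (hP : P.Finite) (hu : IsSolutionOff u P) (σ : ℝ) :
    IsClosed (tangentRays u P σ) := by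
  have e : tangentRays u P σ = ⋃ q ∈ P, ((⋂ p ∈ P, {v : Plane | 0 ≤ cross v (p - q)}) ∩
      {v | RayNull u P q (σ • v)}) := by
    ext v; simp [tangentRays, and_left_comm]
  rw [e]
  refine hP.isClosed_biUnion fun q _ => ?_
  refine (isClosed_biInter fun p _ => ?_).inter (isClosed_rayNull hP hu q σ)
  exact isClosed_le continuous_const (by unfold cross; fun_prop)

/-! ### Leaves crossing a supporting line -/

/-- The vector with slope `m` pointing to the right of `v`. -/
noncomputable def slant (v : Plane) (m : ℝ) : Plane := -rot v - m • v

lemma cross_slant_left (v : Plane) (m : ℝ) : cross (slant v m) v = ‖v‖ ^ 2 := by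
  rw [slant, cross_sub_left, cross_neg_left, cross_smul_left, cross_self_eq_zero, cross_swap v,
    cross_rot_self]
  ring

lemma cross_slant_right (v : Plane) (m : ℝ) : cross v (slant v m) = -‖v‖ ^ 2 := by
  rw [cross_swap, cross_slant_left]

lemma cross_slant_slant (v : Plane) (m m' : ℝ) :
    cross (slant v m) (slant v m') = (m - m') * ‖v‖ ^ 2 := by
  nth_rewrite 2 [slant]
  rw [slant]
  simp only [cross_sub_left, cross_sub_right, cross_neg_left, cross_neg_right, cross_smul_left,
    cross_smul_right, cross_self_eq_zero, cross_rot_self, cross_swap v (rot v)]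
  ring

lemma slant_ne_zero {v : Plane} (hv : v ≠ 0) (m : ℝ) : slant v m ≠ 0 := by
  intro h
  have := cross_slant_left v m
  rw [h, cross_zero_left] at this
  exact pow_ne_zero 2 (norm_ne_zero_iff.2 hv) this.symm

/-- The half-lines to the right of the line `q + ℝ v` along which the Hessian is non-zero with the
direction of the half-line as its kernel. Such a half-line is recorded by the parameter of the point
where it meets the line and by its slope. -/
def leafSet (u : Plane → ℝ) (q v : Plane) : Set (ℝ × ℝ) :=
  {a | ∀ r : ℝ, 0 < r → lap u (q + a.1 • v + r • slant v a.2) ≠ 0 ∧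
    hess u (q + a.1 • v + r • slant v a.2) (slant v a.2) = 0}

lemma notMem_of_right {q v : Plane} (hsupp : ∀ p ∈ P, p ≠ q → 0 < cross v (p - q)) {s m r : ℝ}
    (hv : v ≠ 0) (h : 0 < r ∨ r = 0 ∧ s ≠ 0) : q + s • v + r • slant v m ∉ P := by
  intro hp
  have hn : 0 < ‖v‖ ^ 2 := pow_pos (norm_pos_iff.2 hv) 2
  have e : q + s • v + r • slant v m - q = s • v + r • slant v m := by abel
  have hc : cross v (q + s • v + r • slant v m - q) = -(r * ‖v‖ ^ 2) := by
    rw [e, cross_add_right, cross_smul_right, cross_smul_right, cross_self_eq_zero,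
      cross_slant_right]
    ring
  have h0 : 0 ≤ r := by rcases h with h | h <;> linarith [h]
  by_cases hq : q + s • v + r • slant v m = q
  · rw [hq, sub_self, cross_zero_right] at hc
    rcases h with h | ⟨rfl, hs⟩
    · nlinarith
    · rw [zero_smul, add_zero, add_eq_left, smul_eq_zero] at hq
      tauto
  · have := hsupp _ hp hq
    nlinarith

lemma mem_leafSet_of_null (hP : P.Finite) (hu : IsSolutionOff u P) {q v : Plane} (hv : v ≠ 0)
    (hsupp : ∀ p ∈ P, p ≠ q → 0 < cross v (p - q)) {s m r₀ : ℝ} (h0 : 0 < r₀ ∨ r₀ = 0 ∧ s ≠ 0)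
    (hl : lap u (q + s • v + r₀ • slant v m) ≠ 0)
    (hx : hess u (q + s • v + r₀ • slant v m) (slant v m) = 0) : (s, m) ∈ leafSet u q v := by
  intro r hr
  have h := lap_ne_zero_of_segment hP hu hl hx (t := r - r₀) (fun θ hθ => by
    have e : q + s • v + r₀ • slant v m + (θ * (r - r₀)) • slant v m
        = q + s • v + (r₀ + θ * (r - r₀)) • slant v m := by module
    rw [e]
    refine notMem_of_right hsupp hv ?_
    have h0' : 0 ≤ r₀ := by rcases h0 with h | h <;> linarith [h]
    rcases h0 with h0 | ⟨h0, hs⟩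
    · left
      rcases le_total r₀ r with h | h
      · nlinarith [hθ.1, hθ.2]
      · nlinarith [hθ.1, hθ.2]
    · rcases eq_or_lt_of_le hθ.1 with h | h
      · right; rw [← h, h0]; simp [hs]
      · left; rw [h0]; nlinarith)
  have e : q + s • v + r₀ • slant v m + (r - r₀) • slant v m
      = q + s • v + r • slant v m := by module
  rw [e] at h
  exact h

/-- Leaves do not cross to the right of a supporting line, so their slopes are antitone. -/
lemma slope_antitone {q v : Plane} (hv : v ≠ 0) {s₁ m₁ s₂ m₂ : ℝ}
    (h1 : (s₁, m₁) ∈ leafSet u q v) (h2 : (s₂, m₂) ∈ leafSet u q v) (hs : s₁ < s₂) : m₂ ≤ m₁ := by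
  by_contra! hm
  have hn : ‖v‖ ^ 2 ≠ 0 := pow_ne_zero 2 (norm_ne_zero_iff.2 hv)
  set r := (s₂ - s₁) / (m₂ - m₁) with hr
  have hr0 : 0 < r := div_pos (by linarith) (by linarith)
  obtain ⟨a1, a2⟩ := h1 r hr0
  obtain ⟨-, b2⟩ := h2 r hr0
  have hrm : r * (m₂ - m₁) = s₂ - s₁ := div_mul_cancel₀ _ (by linarith)
  have e : q + s₂ • v + r • slant v m₂ = q + s₁ • v + r • slant v m₁ := by
    have : s₂ = s₁ + r * (m₂ - m₁) := by linarith
    rw [this, slant, slant]; module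
  simp only at a1 a2 b2
  rw [e] at b2
  refine false_of_two_null a1 a2 b2 ?_
  rw [cross_slant_slant]
  exact mul_ne_zero (by linarith) hn

/-- A vector not parallel to `v` is proportional to a slanted vector. -/
lemma exists_slant_null {z x v : Plane} (hx : hess u z x = 0) (hvx : cross v x ≠ 0) :
    ∃ m, hess u z (slant v m) = 0 ∧ cross (slant v m) x = 0 := by
  have hx0 : x ≠ 0 := by rintro rfl; exact hvx (cross_zero_right v)
  have h : cross x (slant v (cross x (-rot v) / cross x v)) = 0 := by
    rw [slant, cross_sub_right, cross_smul_right, div_mul_cancel₀ _ (by rw [cross_swap]; simpa), sub_self]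
  refine ⟨_, hess_eq_zero_of_cross_eq_zero hx hx0 h, ?_⟩
  rw [cross_swap, h, neg_zero]

/-- By admissibility, leaves meet every interval of the supporting line between two leaves: the
half-strip based on a gap would contain no leaf. -/
lemma exists_leaf_between (hP : P.Finite) (hu : IsSolutionOff u P) (hadm : IsAdmissible u P)
    {q v : Plane} (hv : v ≠ 0) (hsupp : ∀ p ∈ P, p ≠ q → 0 < cross v (p - q))
    {s₁ m₁ s₂ m₂ a b : ℝ} (h1 : (s₁, m₁) ∈ leafSet u q v) (h2 : (s₂, m₂) ∈ leafSet u q v)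
    (ha : s₁ ≤ a) (hab : a < b) (hb : b ≤ s₂) :
    ∃ s m, (s, m) ∈ leafSet u q v ∧ a < s ∧ s < b := by
  by_contra! hno
  have hn : 0 < ‖v‖ ^ 2 := pow_pos (norm_pos_iff.2 hv) 2
  set S : Set ℝ := {m | ∃ s, b ≤ s ∧ (s, m) ∈ leafSet u q v} with hS
  have hSne : S.Nonempty := ⟨m₂, s₂, hb, h2⟩
  have hSb : BddAbove S := ⟨m₁, fun m ⟨s, hs, hm⟩ => slope_antitone hv h1 hm (by linarith)⟩
  set m₀ := sSup S with hm₀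
  have hd : cross ((b - a) • v) (slant v m₀) ≠ 0 := by
    rw [cross_smul_left, cross_slant_right]
    exact mul_ne_zero (by linarith) (by linarith)
  have hform : ∀ z ∈ halfStrip (q + a • v) ((b - a) • v) (slant v m₀), ∃ s t : ℝ,
      a < s ∧ s < b ∧ 0 < t ∧ z = q + s • v + t • slant v m₀ := by
    rintro z ⟨s, hs, t, ht, rfl⟩
    refine ⟨a + s * (b - a), t, by nlinarith [hs.1], by nlinarith [hs.2], ht, by module⟩
  obtain ⟨y, hy, hl⟩ := exists_lap_ne_zero_of_halfStrip hP hu hadm hd (by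
    intro z hz
    obtain ⟨s, t, -, -, ht, rfl⟩ := hform z hz
    exact notMem_of_right hsupp hv (Or.inl ht))
  obtain ⟨s₀, t, has, hsb, ht, rfl⟩ := hform y hy
  have hyP := notMem_of_right hsupp hv (s := s₀) (m := m₀) (Or.inl ht)
  obtain ⟨x, hxn, hx⟩ := exists_null hP hu hyP
  have hx0 : x ≠ 0 := by rw [← norm_ne_zero_iff, hxn]; exact one_ne_zero
  by_cases hvx : cross v x = 0
  · -- a leaf parallel to the supporting line would cross a given leaf
    have hxv : hess u (q + s₀ • v + t • slant v m₀) v = 0 :=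
      hess_eq_zero_of_cross_eq_zero hx hx0 (by rw [cross_swap, hvx, neg_zero])
    have key := lap_ne_zero_of_segment hP hu hl hxv (t := s₁ - t * m₁ - s₀ + t * m₀)
      (fun θ _ => by
        have : q + s₀ • v + t • slant v m₀ + (θ * (s₁ - t * m₁ - s₀ + t * m₀)) • v =
          q + (s₀ + θ * (s₁ - t * m₁ - s₀ + t * m₀)) • v + t • slant v m₀ := by module
        rw [this]
        exact notMem_of_right hsupp hv (Or.inl ht))
    have e : q + s₀ • v + t • slant v m₀ + (s₁ - t * m₁ - s₀ + t * m₀) • v =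
        q + s₁ • v + t • slant v m₁ := by rw [slant, slant]; module
    rw [e] at key
    obtain ⟨k1, k2⟩ := h1 t ht
    refine false_of_two_null k1 k2 key.2 ?_
    simp only [cross_slant_left]
    exact hn.ne'
  · obtain ⟨m', hm', -⟩ := exists_slant_null hx hvx
    have e : q + s₀ • v + t • slant v m₀ = q + (s₀ - t * m₀ + t * m') • v + t • slant v m' := by
      rw [slant, slant]; module
    rw [e] at hl hm'
    have hmem := mem_leafSet_of_null hP hu hv hsupp (Or.inl ht) hl hm'
    have hsb' : s₀ - t * m₀ + t * m' < b := by
      by_contra! hge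
      have : m' ≤ m₀ := le_csSup hSb ⟨_, hge, hmem⟩
      nlinarith
    have hsa : s₀ - t * m₀ + t * m' ≤ a := by
      by_contra! hgt
      exact absurd hsb' (not_lt.2 (hno _ _ hmem hgt))
    have hlt : m' < m₀ := by
      by_contra! hge
      nlinarith
    obtain ⟨m, ⟨s, hs, hm⟩, hmm⟩ := exists_lt_of_lt_csSup hSne hlt
    have := slope_antitone hv hmem hm (by linarith)
    linarith

/-- Inside a disc around `q` free of other points of `P`, a leaf that misses `q` extends across the
supporting line. -/
lemma leaf_extend (hP : P.Finite) (hu : IsSolutionOff u P) {q v : Plane} (hv : v ≠ 0)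
    (hsupp : ∀ p ∈ P, p ≠ q → 0 < cross v (p - q)) {R : ℝ}
    (hR : ∀ z ∈ Metric.ball q R, z ≠ q → z ∉ P) {s m r : ℝ} (h : (s, m) ∈ leafSet u q v)
    (hs : s ≠ 0) (hsR : ‖s • v‖ < R) (hrR : ‖s • v + r • slant v m‖ < R) :
    lap u (q + s • v + r • slant v m) ≠ 0 ∧
      hess u (q + s • v + r • slant v m) (slant v m) = 0 := by
  rcases lt_or_ge 0 r with hr | hr
  · exact h r hr
  obtain ⟨h1, h2⟩ := h 1 one_pos
  have key := lap_ne_zero_of_segment hP hu h1 h2 (t := r - 1) (fun θ hθ => by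
    simp only
    have e : q + s • v + (1 : ℝ) • slant v m + (θ * (r - 1)) • slant v m =
        q + s • v + (1 + θ * (r - 1)) • slant v m := by module
    rw [e]
    rcases lt_trichotomy 0 (1 + θ * (r - 1)) with h0 | h0 | h0
    · exact notMem_of_right hsupp hv (Or.inl h0)
    · exact notMem_of_right hsupp hv (Or.inr ⟨h0.symm, hs⟩)
    · have hr0 : r < 0 := by
        by_contra! hr'
        have : r = 0 := le_antisymm hr hr'
        rw [this] at h0
        linarith [hθ.2]
      set r' := 1 + θ * (r - 1) with hr'
      have hrr : r ≤ r' := by nlinarith [hθ.2]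
      apply hR
      · -- convexity of the disc
        have hconv := (convex_ball (0 : Plane) R)
          (show s • v ∈ Metric.ball (0 : Plane) R by simpa using hsR)
          (show s • v + r • slant v m ∈ Metric.ball (0 : Plane) R by simpa using hrR)
          (show 0 ≤ 1 - r' / r from sub_nonneg.2 ((div_le_one_of_neg hr0).2 hrr))
          (show 0 ≤ r' / r from div_nonneg_of_nonpos h0.le hr0.le) (by ring)
        have e2 : (1 - r' / r) • (s • v) + (r' / r) • (s • v + r • slant v m) =
            s • v + r' • slant v m := by
          have : r' = r' / r * r := (div_mul_cancel₀ _ hr0.ne).symm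
          nth_rewrite 3 [this]
          module
        rw [e2] at hconv
        rw [Metric.mem_ball, dist_eq_norm]
        rw [Metric.mem_ball, dist_zero_right] at hconv
        have e3 : q + s • v + r' • slant v m - q = s • v + r' • slant v m := by abel
        rwa [e3]
      · intro hq
        have e3 : s • v + r' • slant v m = 0 := by
          have := sub_eq_zero.2 hq
          rw [← this]; abel
        have e4 := congrArg (cross v) e3
        rw [cross_add_right, cross_smul_right, cross_smul_right, cross_self_eq_zero,
          cross_slant_right, cross_zero_right] at e4
        have hn : 0 < ‖v‖ ^ 2 := pow_pos (norm_pos_iff.2 hv) 2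
        nlinarith)
  simp only at key
  have e : q + s • v + (1 : ℝ) • slant v m + (r - 1) • slant v m =
      q + s • v + r • slant v m := by module
  rw [e] at key
  exact key

/-- A null direction that leads to a transversal crossing with a leaf within the disc is
impossible. -/
lemma false_of_crossing (hP : P.Finite) (hu : IsSolutionOff u P) {q v : Plane} (hv : v ≠ 0)
    (hsupp : ∀ p ∈ P, p ≠ q → 0 < cross v (p - q)) {R : ℝ}
    (hR : ∀ z ∈ Metric.ball q R, z ≠ q → z ∉ P) {s m r τ : ℝ} (h : (s, m) ∈ leafSet u q v)
    (hs : s ≠ 0) (hsR : ‖s • v‖ < R) (hrR : ‖s • v + r • slant v m‖ < R) {y x : Plane}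
    (hyR : ‖y - q‖ < R) (hl : lap u y ≠ 0) (hx : hess u y x = 0)
    (hcross : y + τ • x = q + s • v + r • slant v m) (hne : cross (slant v m) x ≠ 0)
    (hq : ∀ θ ∈ Icc (0 : ℝ) 1, y + (θ * τ) • x ≠ q) : False := by
  obtain ⟨a1, a2⟩ := leaf_extend hP hu hv hsupp hR h hs hsR hrR
  have key := lap_ne_zero_of_segment hP hu hl hx (t := τ) (fun θ hθ => by
    apply hR _ ?_ (hq θ hθ)
    have hconv := (convex_ball (0 : Plane) R)
      (show y - q ∈ Metric.ball (0 : Plane) R by simpa using hyR)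
      (show s • v + r • slant v m ∈ Metric.ball (0 : Plane) R by simpa using hrR)
      (show 0 ≤ 1 - θ by linarith [hθ.2]) hθ.1 (by ring)
    have e1 : s • v + r • slant v m = y + τ • x - q := by rw [hcross]; abel
    rw [e1, Metric.mem_ball, dist_zero_right] at hconv
    rw [Metric.mem_ball, dist_eq_norm]
    have e2 : y + (θ * τ) • x - q = (1 - θ) • (y - q) + θ • (y + τ • x - q) := by module
    rwa [e2])
  rw [hcross] at key
  exact false_of_two_null a1 a2 key.2 hne

/-! ### One ray of each supporting line is null -/

/-- A point of a supporting line at which the Hessian does not annihilate the direction of the line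
lies on a leaf transversal to the line. -/
lemma exists_mem_leafSet (hP : P.Finite) (hu : IsSolutionOff u P) {q v : Plane} (hv : v ≠ 0)
    (hsupp : ∀ p ∈ P, p ≠ q → 0 < cross v (p - q)) {s : ℝ} (hs : s ≠ 0)
    (hne : hess u (q + s • v) v ≠ 0) : ∃ m, (s, m) ∈ leafSet u q v := by
  have hnot : q + s • v ∉ P := by
    have := notMem_of_right hsupp hv (s := s) (m := 0) (r := 0) (Or.inr ⟨rfl, hs⟩)
    simpa using this
  have hl : lap u (q + s • v) ≠ 0 := by
    intro h
    rw [(lap_eq_zero_iff hP hu hnot).1 h] at hne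
    exact hne rfl
  obtain ⟨x, hxn, hx⟩ := exists_null hP hu hnot
  have hx0 : x ≠ 0 := by rw [← norm_ne_zero_iff, hxn]; exact one_ne_zero
  have hvx : cross v x ≠ 0 := fun h =>
    hne (hess_eq_zero_of_cross_eq_zero hx hx0 (by rw [cross_swap, h, neg_zero]))
  obtain ⟨m, hm, -⟩ := exists_slant_null hx hvx
  refine ⟨m, mem_leafSet_of_null hP hu hv hsupp (r₀ := 0) (Or.inr ⟨rfl, hs⟩) ?_ ?_⟩
  · simpa using hl
  · simpa using hm

lemma norm_slant_le (v : Plane) (m : ℝ) : ‖slant v m‖ ≤ (1 + |m|) * ‖v‖ := by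
  have := norm_sub_le (-rot v) (m • v)
  rw [norm_neg, norm_rot, norm_smul, Real.norm_eq_abs] at this
  rw [slant]; linarith

lemma continuous_slant (v : Plane) : Continuous (slant v) := by unfold slant; fun_prop

/-- Leaves close to `q` on both sides have the same limit slope, because otherwise they would cross
near `q`. -/
lemma exists_common_slope (hP : P.Finite) (hu : IsSolutionOff u P) (hadm : IsAdmissible u P)
    {q v : Plane} (hv : v ≠ 0) (hsupp : ∀ p ∈ P, p ≠ q → 0 < cross v (p - q)) {t₁ m₁ t₂ m₂ : ℝ}
    (h1 : (t₁, m₁) ∈ leafSet u q v) (ht₁ : 0 < t₁) (h2 : (t₂, m₂) ∈ leafSet u q v)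
    (ht₂ : t₂ < 0) :
    ∃ m₀ : ℝ, ∀ ε > 0, (∃ t m, (t, m) ∈ leafSet u q v ∧ 0 < t ∧ t < ε ∧ |m - m₀| < ε) ∧
      ∃ t m, (t, m) ∈ leafSet u q v ∧ t < 0 ∧ -ε < t ∧ |m - m₀| < ε := by
  -- the slopes of the leaves on either side of `q`
  set A : Set ℝ := {m | ∃ t, 0 < t ∧ (t, m) ∈ leafSet u q v} with hA
  set B : Set ℝ := {m | ∃ t, t < 0 ∧ (t, m) ∈ leafSet u q v} with hB
  have hAne : A.Nonempty := ⟨m₁, t₁, ht₁, h1⟩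
  have hBne : B.Nonempty := ⟨m₂, t₂, ht₂, h2⟩
  have hAB : ∀ a ∈ A, ∀ b ∈ B, a ≤ b := fun a ⟨t, ht, ha⟩ b ⟨s, hs, hb⟩ =>
    slope_antitone hv hb ha (by linarith)
  have hAb : BddAbove A := ⟨m₂, fun a ha => hAB a ha m₂ ⟨t₂, ht₂, h2⟩⟩
  have hBb : BddBelow B := ⟨m₁, fun b hb => hAB m₁ ⟨t₁, ht₁, h1⟩ b hb⟩
  have hle : sSup A ≤ sInf B := csSup_le hAne fun a ha => le_csInf hBne fun b hb => hAB a ha b hb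
  have hpos : ∀ ε > 0, ∃ t m, (t, m) ∈ leafSet u q v ∧ 0 < t ∧ t < ε := fun ε hε => by
    obtain ⟨s, m, hm, h3, h4⟩ := exists_leaf_between hP hu hadm hv hsupp h2 h1 ht₂.le
      (lt_min hε ht₁) (min_le_right _ _)
    exact ⟨s, m, hm, h3, h4.trans_le (min_le_left _ _)⟩
  have hneg : ∀ ε > 0, ∃ t m, (t, m) ∈ leafSet u q v ∧ t < 0 ∧ -ε < t := fun ε hε => by
    obtain ⟨s, m, hm, h3, h4⟩ := exists_leaf_between hP hu hadm hv hsupp h2 h1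
      (a := max (-ε) t₂) (b := 0) (le_max_right _ _) (max_lt (by linarith) ht₂) ht₁.le
    exact ⟨s, m, hm, h4, (le_max_left _ _).trans_lt h3⟩
  have heq : sSup A = sInf B := by
    by_contra hne
    have hlt : 0 < sInf B - sSup A := sub_pos.2 (lt_of_le_of_ne hle hne)
    set d := sInf B - sSup A with hd
    obtain ⟨R, hR, hRP⟩ := exists_ball_inter_subset hP q
    set K := 1 + |m₁| + |m₂| with hK
    have hKpos : 0 < K := by positivity
    set C := (2 / d * K + 1) * ‖v‖ + 1 with hC
    have hCpos : 0 < C := by positivity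
    obtain ⟨t, m, hm, ht0, ht⟩ := hpos (min (R / C) t₁) (lt_min (by positivity) ht₁)
    obtain ⟨s, m', hm', hs0, hs⟩ := hneg (R / C) (by positivity)
    have hmA : m ≤ sSup A := le_csSup hAb ⟨t, ht0, hm⟩
    have hmB : sInf B ≤ m' := csInf_le hBb ⟨s, hs0, hm'⟩
    have hmd : d ≤ m' - m := by linarith
    have htR : t < R / C := ht.trans_le (min_le_left _ _)
    have htt : t < t₁ := ht.trans_le (min_le_right _ _)
    have hmm1 : m₁ ≤ m := slope_antitone hv hm h1 htt
    have hmm2 : m ≤ m₂ := hAB m ⟨t, ht0, hm⟩ m₂ ⟨t₂, ht₂, h2⟩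
    have hmK : 1 + |m| ≤ K := by
      have : |m| ≤ |m₁| + |m₂| := by
        rw [abs_le]
        constructor
        · linarith [neg_abs_le m₁, abs_nonneg m₂]
        · linarith [le_abs_self m₂, abs_nonneg m₁]
      linarith
    -- the parameter at which the two extended leaves meet
    set r := -(t - s) / (m' - m) with hr
    have hrm : r * (m' - m) = -(t - s) := div_mul_cancel₀ _ (by linarith)
    have hcross : q + t • v + r • slant v m = q + s • v + r • slant v m' := by
      have : s = t + r * (m' - m) := by linarith
      rw [this, slant, slant]; module
    have hrabs : |r| ≤ 2 * (R / C) / d := by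
      rw [hr, abs_div, abs_neg, abs_of_pos (show 0 < t - s by linarith),
        abs_of_pos (show 0 < m' - m by linarith)]
      exact div_le_div₀ (by positivity) (by linarith) hlt hmd
    have hv0 : 0 ≤ ‖v‖ := norm_nonneg v
    have htv : ‖t • v‖ ≤ R / C * ‖v‖ := by
      rw [norm_smul, Real.norm_eq_abs, abs_of_pos ht0]
      exact mul_le_mul_of_nonneg_right htR.le hv0
    have hsv : ‖s • v‖ ≤ R / C * ‖v‖ := by
      rw [norm_smul, Real.norm_eq_abs, abs_of_neg hs0]
      exact mul_le_mul_of_nonneg_right (by linarith) hv0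
    have hrs : ‖r • slant v m‖ ≤ 2 * (R / C) / d * (K * ‖v‖) := by
      rw [norm_smul, Real.norm_eq_abs]
      refine mul_le_mul hrabs ((norm_slant_le v m).trans ?_) (norm_nonneg _) (by positivity)
      exact mul_le_mul_of_nonneg_right hmK hv0
    have htot : R / C * ‖v‖ + 2 * (R / C) / d * (K * ‖v‖) < R := by
      have e : R / C * ‖v‖ + 2 * (R / C) / d * (K * ‖v‖) = R / C * (C - 1) := by rw [hC]; ring
      rw [e, mul_sub, div_mul_cancel₀ _ hCpos.ne']
      have : 0 < R / C := by positivity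
      linarith
    have hrs0 : 0 ≤ 2 * (R / C) / d * (K * ‖v‖) := by positivity
    have hnorm : ‖t • v + r • slant v m‖ < R := (norm_add_le _ _).trans_lt (by linarith)
    obtain ⟨a1, a2⟩ := leaf_extend hP hu hv hsupp hRP hm ht0.ne' (by linarith) hnorm
    have e : s • v + r • slant v m' = t • v + r • slant v m := by
      rw [add_assoc, add_assoc] at hcross
      exact (add_left_cancel hcross).symm
    obtain ⟨b1, b2⟩ := leaf_extend hP hu hv hsupp hRP hm' hs0.ne (by linarith) (by rwa [e])
    rw [← hcross] at b2
    refine false_of_two_null a1 a2 b2 ?_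
    rw [cross_slant_slant]
    exact mul_ne_zero (by linarith) (pow_ne_zero 2 (norm_ne_zero_iff.2 hv))
  refine ⟨sSup A, fun ε hε => ⟨?_, ?_⟩⟩
  · obtain ⟨a, ⟨t', ht', ha⟩, haε⟩ := exists_lt_of_lt_csSup hAne (show sSup A - ε < sSup A by linarith)
    obtain ⟨t, m, hm, ht0, ht⟩ := hpos (min ε t') (lt_min hε ht')
    refine ⟨t, m, hm, ht0, ht.trans_le (min_le_left _ _), ?_⟩
    have q1 : m ≤ sSup A := le_csSup hAb ⟨t, ht0, hm⟩
    have q2 := slope_antitone hv hm ha (ht.trans_le (min_le_right _ _))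
    rw [abs_lt]; constructor <;> linarith
  · obtain ⟨b, ⟨t', ht', hb⟩, hbε⟩ := exists_lt_of_csInf_lt hBne (show sInf B < sInf B + ε by linarith)
    obtain ⟨t, m, hm, ht0, ht⟩ := hneg (min ε (-t')) (lt_min hε (by linarith))
    have : min ε (-t') ≤ -t' := min_le_right _ _
    have q1 : sInf B ≤ m := csInf_le hBb ⟨t, ht0, hm⟩
    have q2 := slope_antitone hv hb hm (by linarith)
    refine ⟨t, m, hm, ht0, by linarith [min_le_left ε (-t')], ?_⟩
    rw [heq, abs_lt]; constructor <;> linarith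

/-- If leaves accumulate at `q` from both sides with a common limit slope, they block all kernel
directions near `q` other than the limit one. -/
lemma kernelTendsTo_of_common_slope (hP : P.Finite) (hu : IsSolutionOff u P) {q v : Plane}
    (hqP : q ∈ P) (hv : v ≠ 0) (hsupp : ∀ p ∈ P, p ≠ q → 0 < cross v (p - q)) {m₀ : ℝ}
    (h : ∀ ε > 0, (∃ t m, (t, m) ∈ leafSet u q v ∧ 0 < t ∧ t < ε ∧ |m - m₀| < ε) ∧
      ∃ t m, (t, m) ∈ leafSet u q v ∧ t < 0 ∧ -ε < t ∧ |m - m₀| < ε) :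
    KernelTendsTo u P q (slant v m₀) := by
  intro y x x₀ hy hyP hl hx hxn hxlim
  by_contra hκ
  obtain ⟨R, hR, hRP⟩ := exists_ball_inter_subset hP q
  have hx₀ : ‖x₀‖ = 1 := by
    have := hxlim.norm
    simp_rw [hxn] at this
    exact tendsto_nhds_unique this tendsto_const_nhds
  set N := ‖v‖ ^ 2 with hN
  have hNpos : 0 < N := pow_pos (norm_pos_iff.2 hv) 2
  -- `κ m` does not vanish when the limit direction `x₀` is transversal to the slope `m`
  set κ : ℝ → ℝ := fun m => cross (slant v m) x₀ with hκdef
  have hκc : Continuous κ := (continuous_slant v).cross continuous_const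
  have hev : ∀ᶠ a : ℝ × ℝ in 𝓝 (0, m₀), ‖a.1 • v‖ < R ∧ 0 < κ a.2 * κ m₀ ∧
      |a.1 * N / κ a.2| < R := by
    have c1 : ContinuousAt (fun a : ℝ × ℝ => ‖a.1 • v‖) (0, m₀) := by fun_prop
    have c2 : ContinuousAt (fun a : ℝ × ℝ => κ a.2 * κ m₀) (0, m₀) := by fun_prop
    have c3 : ContinuousAt (fun a : ℝ × ℝ => |a.1 * N / κ a.2|) (0, m₀) := by
      refine ContinuousAt.abs (ContinuousAt.div (by fun_prop) ?_ hκ)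
      exact (hκc.comp continuous_snd).continuousAt
    refine (c1.eventually (gt_mem_nhds (by simpa using hR))).and
      ((c2.eventually (lt_mem_nhds (by simpa using mul_self_pos.2 hκ))).and
        (c3.eventually (gt_mem_nhds (by simpa using hR))))
  obtain ⟨ε, hε, hball⟩ := Metric.eventually_nhds_iff_ball.1 hev
  obtain ⟨⟨t, m, hm, ht0, htε, hmε⟩, ⟨t', m', hm', ht'0, ht'ε, hm'ε⟩⟩ := h ε hε
  -- the crossing of the line through `y k` with a given leaf
  have crossing : ∀ s n : ℝ, (s, n) ∈ leafSet u q v → s ≠ 0 → |s| < ε → |n - m₀| < ε →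
      0 < κ n * κ m₀ ∧ ∃ τ : ℕ → ℝ, Tendsto τ atTop (𝓝 (s * N / κ n)) ∧
        ∀ᶠ k in atTop, (∀ θ ∈ Icc (0 : ℝ) 1, y k + (θ * τ k) • x k ≠ q) → False := by
    intro s n hsn hs0 hsε hnε
    obtain ⟨b1, b2, b3⟩ := hball (s, n) (by
      rw [Metric.mem_ball, Prod.dist_eq, Real.dist_eq, Real.dist_eq, sub_zero]
      exact max_lt hsε hnε)
    simp only at b1 b2 b3
    have hκn : κ n ≠ 0 := fun h0 => by rw [h0, zero_mul] at b2; exact lt_irrefl 0 b2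
    have hyq : Tendsto (fun k => y k - q) atTop (𝓝 0) := by
      have := hy.sub_const q; rwa [sub_self] at this
    set κk : ℕ → ℝ := fun k => cross (slant v n) (x k) with hκk
    have hκlim : Tendsto κk atTop (𝓝 (κ n)) := tendsto_const_nhds.cross hxlim
    set τ : ℕ → ℝ := fun k => (s * N - cross (slant v n) (y k - q)) / κk k with hτ
    set ρ : ℕ → ℝ := fun k => (cross (y k - q) (x k) - s * cross v (x k)) / κk k with hρ
    have hτlim : Tendsto τ atTop (𝓝 (s * N / κ n)) := by
      have := ((tendsto_const_nhds (x := s * N)).sub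
        ((tendsto_const_nhds (x := slant v n)).cross hyq)).div hκlim hκn
      rwa [cross_zero_right, sub_zero] at this
    refine ⟨b2, τ, hτlim, ?_⟩
    have hyx : Tendsto (fun k => y k - q + τ k • x k) atTop (𝓝 ((s * N / κ n) • x₀)) := by
      have := hyq.add (hτlim.smul hxlim); rwa [zero_add] at this
    have e1 : ∀ᶠ k in atTop, ‖y k - q + τ k • x k‖ < R := by
      apply hyx.norm.eventually (gt_mem_nhds _)
      rwa [norm_smul, hx₀, mul_one, Real.norm_eq_abs]
    have e2 : ∀ᶠ k in atTop, ‖y k - q‖ < R := by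
      apply hyq.norm.eventually (gt_mem_nhds _)
      simpa using hR
    filter_upwards [e1, e2, hκlim.eventually_ne hκn] with k k1 k2 k3 hq
    have hc : y k - q + τ k • x k = s • v + ρ k • slant v n := by
      -- both sides have the same area with `slant v n` and with `x k`
      have hz := eq_smul_add_smul k3 (y k - q + τ k • x k - (s • v + ρ k • slant v n))
      have z1 : cross (slant v n) (y k - q + τ k • x k - (s • v + ρ k • slant v n)) = 0 := by
        simp only [cross_sub_right (slant v n) (y k - q + τ k • x k), cross_add_right,
          cross_smul_right, cross_self_eq_zero, cross_slant_left]
        have : τ k * cross (slant v n) (x k) = s * N - cross (slant v n) (y k - q) :=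
          div_mul_cancel₀ _ k3
        rw [this]; ring
      have z2 : cross (y k - q + τ k • x k - (s • v + ρ k • slant v n)) (x k) = 0 := by
        simp only [cross_sub_left (y k - q + τ k • x k), cross_add_left, cross_smul_left,
          cross_self_eq_zero]
        have : ρ k * cross (slant v n) (x k) = cross (y k - q) (x k) - s * cross v (x k) :=
          div_mul_cancel₀ _ k3
        rw [this]; ring
      rw [z1, z2, zero_div, zero_smul, zero_smul, add_zero] at hz
      exact sub_eq_zero.1 hz
    refine false_of_crossing hP hu hv hsupp hRP hsn hs0 b1 (r := ρ k) (τ := τ k) (y := y k)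
      (x := x k) (by rwa [← hc]) k2 (hl k) (hx k) ?_ k3 hq
    rw [add_assoc, ← hc]; abel
  obtain ⟨p1, τ, hτ, c1⟩ := crossing t m hm ht0.ne' (by rwa [abs_of_pos ht0]) hmε
  obtain ⟨p2, τ', hτ', c2⟩ := crossing t' m' hm' ht'0.ne
    (by rw [abs_of_neg ht'0]; linarith) hm'ε
  -- the crossings with leaves on different sides of `q` lie in opposite directions from `y k`
  have hsign : t * N / κ m * (t' * N / κ m') < 0 := by
    have hmm : 0 < κ m * κ m' := by
      have h1 : 0 < (κ m * κ m₀) * (κ m' * κ m₀) := mul_pos p1 p2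
      have h2 : 0 < κ m₀ * κ m₀ := mul_self_pos.2 hκ
      have h3 : 0 < (κ m * κ m') * (κ m₀ * κ m₀) := by
        have : (κ m * κ m') * (κ m₀ * κ m₀) = (κ m * κ m₀) * (κ m' * κ m₀) := by ring
        rwa [this]
      exact (pos_iff_pos_of_mul_pos h3).2 h2
    rw [div_mul_div_comm]
    apply div_neg_of_neg_of_pos _ hmm
    have : t * N * (t' * N) = (t * t') * (N * N) := by ring
    rw [this]
    exact mul_neg_of_neg_of_pos (mul_neg_of_pos_of_neg ht0 ht'0) (mul_pos hNpos hNpos)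
  obtain ⟨k, k1, k2, k3⟩ := (c1.and (c2.and ((hτ.mul hτ').eventually (gt_mem_nhds hsign)))).exists
  -- `q` lies on at most one of the two paths
  have hq1 : ∃ θ ∈ Icc (0 : ℝ) 1, y k + (θ * τ k) • x k = q := by
    by_contra! hcon; exact k1 hcon
  have hq2 : ∃ θ ∈ Icc (0 : ℝ) 1, y k + (θ * τ' k) • x k = q := by
    by_contra! hcon; exact k2 hcon
  obtain ⟨θ, hθ, e1⟩ := hq1
  obtain ⟨θ', hθ', e2⟩ := hq2
  have hxk : x k ≠ 0 := by rw [← norm_ne_zero_iff, hxn]; exact one_ne_zero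
  have e3 : θ * τ k = θ' * τ' k := by
    have := add_left_cancel (e1.trans e2.symm)
    exact smul_left_injective ℝ hxk this
  have hz : θ * τ k = 0 := by
    by_contra hne
    have hsq : 0 < (θ * τ k) * (θ' * τ' k) := by rw [← e3]; exact mul_self_pos.2 hne
    have : (θ * τ k) * (θ' * τ' k) = (θ * θ') * (τ k * τ' k) := by ring
    rw [this] at hsq
    have : (θ * θ') * (τ k * τ' k) ≤ 0 :=
      mul_nonpos_of_nonneg_of_nonpos (mul_nonneg hθ.1 hθ'.1) k3.le
    linarith
  rw [hz, zero_smul, add_zero] at e1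
  exact hyP k (e1 ▸ hqP)

/-- On every supporting line of `P` one of the two rays issuing from `P` consists of null vectors:
otherwise leaves would accumulate transversally on both sides of the contact point, which would
make the singularity there removable. -/
theorem tangentRays_union (hP : P.Finite) (hne : P.Nonempty) (hu : IsSolutionOff u P)
    (hadm : IsAdmissible u P) : tangentRays u P 1 ∪ tangentRays u P (-1) = univ := by
  have hcl : IsClosed (tangentRays u P 1 ∪ tangentRays u P (-1)) :=
    (isClosed_tangentRays hP hu 1).union (isClosed_tangentRays hP hu (-1))
  rw [← hcl.closure_eq]
  refine ((dense_generic_direction hP).mono ?_).closure_eq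
  intro v hgen
  obtain ⟨q, hq, hmin⟩ := hP.exists_minimalFor (cross v) P hne
  have hmin' : ∀ p ∈ P, cross v q ≤ cross v p := fun p hp => by
    by_contra! h
    exact absurd (hmin hp h.le) (not_le.2 h)
  rcases eq_or_ne v 0 with rfl | hv
  · exact Or.inl ⟨q, hq, fun p _ => by rw [cross_zero_left], fun t _ _ => by simp⟩
  have hsupp : ∀ p ∈ P, p ≠ q → 0 < cross v (p - q) := fun p hp hpq => by
    have h1 := hgen q hq p hp hpq.symm
    have h2 := hmin' p hp
    rw [cross_sub_right] at h1 ⊢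
    exact lt_of_le_of_ne (by linarith) (Ne.symm h1)
  have hle : ∀ p ∈ P, 0 ≤ cross v (p - q) := fun p hp => by
    rw [cross_sub_right]; linarith [hmin' p hp]
  by_contra hno
  rw [mem_union, not_or] at hno
  have n1 : ¬ RayNull u P q v := fun h => hno.1 ⟨q, hq, hle, by rwa [one_smul]⟩
  have n2 : ¬ RayNull u P q (-v) := fun h => hno.2 ⟨q, hq, hle, by rwa [neg_one_smul]⟩
  simp only [RayNull, not_forall] at n1 n2
  obtain ⟨t₁, ht₁, -, h1⟩ := n1
  obtain ⟨t₂, ht₂, -, h2⟩ := n2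
  rw [smul_neg, ← neg_smul, map_neg, neg_eq_zero] at h2
  obtain ⟨m₁, hm₁⟩ := exists_mem_leafSet hP hu hv hsupp ht₁.ne' h1
  obtain ⟨m₂, hm₂⟩ := exists_mem_leafSet hP hu hv hsupp (neg_ne_zero.2 ht₂.ne') h2
  obtain ⟨m₀, hm₀⟩ := exists_common_slope hP hu hadm hv hsupp hm₁ ht₁ hm₂ (neg_lt_zero.2 ht₂)
  exact not_kernelTendsTo hP hu hq (slant_ne_zero hv m₀)
    (kernelTendsTo_of_common_slope hP hu hq hv hsupp hm₀)

/-! ### Supporting lines with two null rays -/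

/-- The line `{z | v ∧ z = l}`, parallel to `v`, lies in the domain, and the Hessian is non-zero
along it with kernel spanned by `v`. -/
def NullLine (u : Plane → ℝ) (P : Set Plane) (v : Plane) (l : ℝ) : Prop :=
  ∀ z, cross v z = l → z ∉ P ∧ lap u z ≠ 0 ∧ hess u z v = 0

lemma NullLine.neg {v : Plane} {l : ℝ} (h : NullLine u P (-v) l) : NullLine u P v (-l) := by
  intro z hz
  obtain ⟨h1, h2, h3⟩ := h z (by rw [cross_neg_left, hz, neg_neg])
  exact ⟨h1, h2, by simpa using h3⟩

lemma NullLine.false_of_cross_ne_zero {v v' : Plane} {l l' : ℝ} (h : NullLine u P v l)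
    (h' : NullLine u P v' l') (hv : cross v v' ≠ 0) : False := by
  set z : Plane := (-l' / cross v v') • v + (l / cross v v') • v' with hz
  obtain ⟨-, h1, h2⟩ := h z (by
    rw [hz, cross_add_right, cross_smul_right, cross_smul_right, cross_self_eq_zero,
      div_mul_cancel₀ _ hv]
    ring)
  obtain ⟨-, -, h3⟩ := h' z (by
    rw [hz, cross_add_right, cross_smul_right, cross_smul_right, cross_self_eq_zero,
      cross_swap v v', mul_neg, div_mul_cancel₀ _ hv]
    ring)
  exact false_of_two_null h1 h2 h3 hv

/-- A ray of null vectors cannot run into a null line. -/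
lemma NullLine.false_of_rayNull {v q x : Plane} {l : ℝ} (h : NullLine u P v l)
    (hr : RayNull u P q x) (hx : cross v x ≠ 0) (hpos : 0 < (l - cross v q) / cross v x) :
    False := by
  obtain ⟨h1, h2, h3⟩ := h (q + ((l - cross v q) / cross v x) • x) (by
    rw [cross_add_right, cross_smul_right, div_mul_cancel₀ _ hx]; ring)
  exact false_of_two_null h2 h3 (hr _ hpos h1) hx

/-- Leaves that go far out in the direction `v` without being parallel to `v` would meet one of the
bounding rays. -/
lemma false_of_hits_ray (hP : P.Finite) (hu : IsSolutionOff u P) {v c y x : Plane} (hv : v ≠ 0)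
    (hc : RayNull u P c v) {G τ : ℝ} (hG : ∀ p ∈ P, cross p (rot v) < G)
    (hcG : cross c (rot v) < G) (hy : G ≤ cross y (rot v)) (hl : lap u y ≠ 0)
    (hx : hess u y x = 0) (hτ : 0 ≤ τ * cross x (rot v))
    (hlev : cross v (y + τ • x) = cross v c) (hvx : cross v x ≠ 0) : False := by
  have hfar : ∀ s ∈ Icc (0 : ℝ) 1, G ≤ cross (y + (s * τ) • x) (rot v) := by
    intro s hs
    rw [cross_add_left, cross_smul_left, mul_assoc]
    have := mul_nonneg hs.1 hτ
    linarith
  have hseg : ∀ s ∈ Icc (0 : ℝ) 1, y + (s * τ) • x ∉ P := fun s hs h =>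
    absurd (hG _ h) (not_lt.2 (hfar s hs))
  obtain ⟨h1, h2⟩ := lap_ne_zero_of_segment hP hu hl hx hseg
  have hzP := hseg 1 (by simp)
  have hzG := hfar 1 (by simp)
  rw [one_mul] at hzP hzG
  obtain ⟨t, ht⟩ := exists_eq_smul_of_cross_eq_zero (y := y + τ • x - c) hv
    (by rw [cross_sub_right, hlev, sub_self])
  have hz : y + τ • x = c + t • v := by rw [← ht]; abel
  have ht0 : 0 < t := by
    rw [hz, cross_add_left, cross_smul_left, cross_rot_self] at hzG
    have hn : 0 < ‖v‖ ^ 2 := pow_pos (norm_pos_iff.2 hv) 2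
    by_contra! h
    nlinarith
  rw [hz] at h1 h2 hzP
  exact false_of_two_null h1 (hc t ht0 hzP) h2 hvx

/-- Between two parallel rays of null vectors, every band contains a null line: far out, the leaves
in a half-strip of the band have to be parallel to the rays. -/
theorem exists_nullLine (hP : P.Finite) (hu : IsSolutionOff u P) (hadm : IsAdmissible u P)
    {a b v : Plane} (hv : v ≠ 0) (ha : RayNull u P a v) (hb : RayNull u P b v) {l₁ l₂ : ℝ}
    (h1 : cross v a ≤ l₁) (h12 : l₁ < l₂) (h2 : l₂ ≤ cross v b) :
    ∃ l, l₁ < l ∧ l < l₂ ∧ NullLine u P v l := by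
  have hn : 0 < ‖v‖ ^ 2 := pow_pos (norm_pos_iff.2 hv) 2
  set N := ‖v‖ ^ 2 with hN
  -- a band free of points of `P`
  have hfin : (cross v '' P).Finite := hP.image _
  obtain ⟨c, hc, hcP⟩ := ((Ioo_infinite h12).sdiff hfin).nonempty
  have hopen : IsOpen (Ioo l₁ l₂ \ cross v '' P) := isOpen_Ioo.sdiff hfin.isClosed
  obtain ⟨ε, hε, hball⟩ := Metric.isOpen_iff.1 hopen c ⟨hc, hcP⟩
  obtain ⟨G, hG⟩ := ((((hP.insert a).insert b).image fun p => cross p (rot v))).bddAbove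
  have hG' : ∀ p ∈ insert b (insert a P), cross p (rot v) < G + 1 := fun p hp =>
    (hG (mem_image_of_mem _ hp)).trans_lt (lt_add_one G)
  set base : Plane := ((G + 1) / N) • v + ((c - ε / 2) / N) • rot v with hbase
  have hd : cross ((ε / N) • rot v) v ≠ 0 := by
    rw [cross_smul_left, cross_swap v, cross_rot_self]
    exact mul_ne_zero (div_pos hε hn).ne' (neg_ne_zero.2 hn.ne')
  have hform : ∀ z ∈ halfStrip base ((ε / N) • rot v) v,
      cross v z ∈ Metric.ball c ε ∧ G + 1 ≤ cross z (rot v) := by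
    rintro z ⟨s, hs, t, ht, rfl⟩
    have e1 : cross v (base + s • (ε / N) • rot v + t • v) = c - ε / 2 + s * ε := by
      simp only [hbase, cross_add_right, cross_smul_right, cross_self_eq_zero, cross_rot_self]
      field_simp
      ring
    have e2 : cross (base + s • (ε / N) • rot v + t • v) (rot v) = G + 1 + t * N := by
      simp only [hbase, cross_add_left, cross_smul_left, cross_self_eq_zero, cross_rot_self]
      field_simp
      ring
    rw [e1, e2, Metric.mem_ball, Real.dist_eq, abs_lt]
    refine ⟨⟨?_, ?_⟩, ?_⟩ <;> nlinarith [hs.1, hs.2]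
  obtain ⟨y, hy, hl⟩ := exists_lap_ne_zero_of_halfStrip hP hu hadm hd (fun z hz hzP =>
    (hball (hform z hz).1).2 (mem_image_of_mem _ hzP))
  obtain ⟨hyl, hyG⟩ := hform y hy
  obtain ⟨hyI, hyF⟩ := hball hyl
  have hlevP : ∀ z, cross v z = cross v y → z ∉ P := fun z hz hzP => hyF ⟨z, hzP, hz⟩
  suffices hyv : hess u y v = 0 by
    refine ⟨cross v y, hyI.1, hyI.2, fun z hz => ?_⟩
    obtain ⟨t, ht⟩ := exists_eq_smul_of_cross_eq_zero (y := z - y) hv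
      (by rw [cross_sub_right, hz, sub_self])
    have hz' : z = y + t • v := by rw [← ht]; abel
    have := lap_ne_zero_of_segment hP hu hl hyv (t := t) (fun s _ => hlevP _ (by
      rw [cross_add_right, cross_smul_right, cross_self_eq_zero, mul_zero, add_zero]))
    rw [← hz'] at this
    exact ⟨hlevP z hz, this⟩
  obtain ⟨x, hxn, hx⟩ := exists_null hP hu (hlevP y rfl)
  have hx0 : x ≠ 0 := by rw [← norm_ne_zero_iff, hxn]; exact one_ne_zero
  by_contra hyv
  have hvx : cross v x ≠ 0 := fun h =>
    hyv (hess_eq_zero_of_cross_eq_zero hx hx0 (by rw [cross_swap, h, neg_zero]))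
  have hhit : ∀ c', RayNull u P c' v → c' ∈ insert b (insert a P) →
      0 ≤ (cross v c' - cross v y) / cross v x * cross x (rot v) → False := by
    intro c' hc' hmem hpos
    refine false_of_hits_ray hP hu hv hc' (fun p hp => hG' p (by simp [hp])) (hG' _ hmem) hyG hl hx
      hpos ?_ hvx
    rw [cross_add_right, cross_smul_right, div_mul_cancel₀ _ hvx]; ring
  have hya : cross v a - cross v y ≤ 0 := by linarith [hyI.1]
  have hyb : 0 ≤ cross v b - cross v y := by linarith [hyI.2]
  rcases le_total 0 (cross x (rot v) / cross v x) with h | h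
  · refine hhit b hb (by simp) ?_
    have : (cross v b - cross v y) / cross v x * cross x (rot v) =
      (cross v b - cross v y) * (cross x (rot v) / cross v x) := by ring
    rw [this]; exact mul_nonneg hyb h
  · refine hhit a ha (by simp) ?_
    have : (cross v a - cross v y) / cross v x * cross x (rot v) =
      (cross v a - cross v y) * (cross x (rot v) / cross v x) := by ring
    rw [this]; exact mul_nonneg_of_nonpos_of_nonpos hya h

/-- Between two parallel null lines the solution is a cylinder, so that it has no singularity
there. -/
theorem false_of_between_nullLines (hP : P.Finite) (hu : IsSolutionOff u P) {v : Plane}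
    (hv : v ≠ 0) {l₁ l₂ : ℝ} (h1 : NullLine u P v l₁) (h2 : NullLine u P v l₂) {p : Plane}
    (hp : p ∈ P) (hp1 : l₁ < cross v p) (hp2 : cross v p < l₂) : False := by
  have hcv : Continuous fun z : Plane => cross v z := by unfold cross; fun_prop
  have hnull : ∀ y, y ∉ P → l₁ < cross v y → cross v y < l₂ → hess u y v = 0 := by
    intro y₀ hy₀ hy1 hy2
    by_contra hne
    set O : Set Plane := {y | y ∉ P ∧ l₁ < cross v y ∧ cross v y < l₂ ∧ hess u y v ≠ 0} with hO
    have hOo : IsOpen O := by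
      rw [isOpen_iff_mem_nhds]
      rintro y ⟨b1, b2, b3, b4⟩
      have c4 : ContinuousAt (fun z => hess u z v) y :=
        (continuousAt_hess hP hu b1).clm_apply continuousAt_const
      filter_upwards [hP.isClosed.isOpen_compl.mem_nhds b1,
        hcv.continuousAt.eventually (lt_mem_nhds b2), hcv.continuousAt.eventually (gt_mem_nhds b3),
        c4.eventually_ne b4] with z z1 z2 z3 z4
      exact ⟨z1, z2, z3, z4⟩
    obtain ⟨y, ⟨b1, b2, b3, b4⟩, hgen⟩ :=
      exists_forall_cross_secant_ne_zero hP hOo ⟨y₀, hy₀, hy1, hy2, hne⟩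
    have hl : lap u y ≠ 0 := fun h => b4 (by rw [(lap_eq_zero_iff hP hu b1).1 h]; rfl)
    obtain ⟨x, hxn, hx⟩ := exists_null hP hu b1
    have hx0 : x ≠ 0 := by rw [← norm_ne_zero_iff, hxn]; exact one_ne_zero
    have hvx : cross v x ≠ 0 := fun h =>
      b4 (hess_eq_zero_of_cross_eq_zero hx hx0 (by rw [cross_swap, h, neg_zero]))
    -- the leaf through `y` ends at points of `P` in both directions
    have hend : ∀ l, NullLine u P v l → l ≠ cross v y →
        ∃ s : ℝ, 0 < s ∧ y + (s * ((l - cross v y) / cross v x)) • x ∈ P := by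
      intro l hnl hne'
      by_contra! hno
      obtain ⟨k1, k2⟩ := lap_ne_zero_of_segment hP hu hl hx
        (t := (l - cross v y) / cross v x) (fun s hs => by
          rcases eq_or_lt_of_le hs.1 with h | h
          · rw [← h]; simpa using b1
          · exact hno s h)
      obtain ⟨-, -, k3⟩ := hnl _ (show cross v (y + ((l - cross v y) / cross v x) • x) = l by
        rw [cross_add_right, cross_smul_right, div_mul_cancel₀ _ hvx]; ring)
      exact false_of_two_null k1 k3 k2 hvx
    obtain ⟨s, hs, hsP⟩ := hend l₁ h1 (by linarith)
    obtain ⟨s', hs', hsP'⟩ := hend l₂ h2 (by linarith)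
    refine hgen _ hsP _ hsP' ?_ ?_
    · intro heq
      have h3 := smul_left_injective ℝ hx0 (add_left_cancel heq)
      have h4 : s * (l₁ - cross v y) = s' * (l₂ - cross v y) := by field_simp at h3; linarith
      nlinarith
    · set α := s * ((l₁ - cross v y) / cross v x)
      set β := s' * ((l₂ - cross v y) / cross v x)
      have e1 : y + β • x - (y + α • x) = (β - α) • x := by module
      have e2 : y - (y + α • x) = (-α) • x := by module
      rw [e1, e2, cross_smul_left, cross_smul_right, cross_self_eq_zero, mul_zero, mul_zero]
  refine not_kernelTendsTo hP hu hp hv ?_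
  intro y x x₀ hy hyP hl hx hxn hxlim
  have hlim : Tendsto (fun k => cross v (x k)) atTop (𝓝 (cross v x₀)) :=
    tendsto_const_nhds.cross hxlim
  refine tendsto_nhds_unique (hlim.congr' ?_) tendsto_const_nhds
  have hyl : Tendsto (fun k => cross v (y k)) atTop (𝓝 (cross v p)) := tendsto_const_nhds.cross hy
  filter_upwards [hyl.eventually (lt_mem_nhds hp1), hyl.eventually (gt_mem_nhds hp2)] with k k1 k2
  by_contra hne
  exact false_of_two_null (hl k) (hnull _ (hyP k) k1 k2) (hx k) hne

/-- If both rays of a supporting line consist of null vectors, then null lines parallel to it are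
dense in the strip spanned by `P`. -/
lemma exists_nullLine_of_mem_both (hP : P.Finite) (hne : P.Nonempty) (hu : IsSolutionOff u P)
    (hadm : IsAdmissible u P) {v : Plane} (hv : v ≠ 0) (h1 : v ∈ tangentRays u P 1)
    (h2 : v ∈ tangentRays u P (-1)) {p p' : Plane} (hp : p ∈ P) (hp' : p' ∈ P) {l₁ l₂ : ℝ}
    (hl₁ : cross v p ≤ l₁) (hl : l₁ < l₂) (hl₂ : l₂ ≤ cross v p') :
    ∃ l, l₁ < l ∧ l < l₂ ∧ NullLine u P v l := by
  obtain ⟨q, hq, hqm, hqr⟩ := h1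
  obtain ⟨q', hq', hqm', hqr'⟩ := h2
  rw [one_smul] at hqr
  rw [neg_one_smul] at hqr'
  have k1 := hqm p hp
  have k2 := hqm' p hp
  rw [cross_sub_right] at k1 k2
  have hun : -v ∈ tangentRays u P 1 ∪ tangentRays u P (-1) := by
    rw [tangentRays_union hP hne hu hadm]; exact mem_univ _
  rcases hun with ⟨r, hr, hrm, hrr⟩ | ⟨r, hr, hrm, hrr⟩
  · rw [one_smul] at hrr
    have k3 := hrm p' hp'
    rw [cross_neg_left, cross_sub_right] at k3
    obtain ⟨l, h3, h4, h5⟩ := exists_nullLine hP hu hadm (neg_ne_zero.2 hv) hrr hqr'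
      (l₁ := -l₂) (l₂ := -l₁) (by rw [cross_neg_left]; linarith) (by linarith)
      (by rw [cross_neg_left]; linarith)
    exact ⟨-l, by linarith, by linarith, h5.neg⟩
  · rw [neg_one_smul, neg_neg] at hrr
    have k3 := hrm p' hp'
    rw [cross_neg_left, cross_sub_right] at k3
    exact exists_nullLine hP hu hadm hv hqr hrr (by linarith) hl (by linarith)

lemma zero_mem_tangentRays (hne : P.Nonempty) (σ : ℝ) : (0 : Plane) ∈ tangentRays u P σ := by
  obtain ⟨q, hq⟩ := hne
  exact ⟨q, hq, fun p _ => by rw [cross_zero_left], fun t _ _ => by simp⟩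

/-- If `P` is not collinear, no supporting line has both of its rays null: a null line separating
`P` would yield, by turning the supporting line through half a turn, a second supporting line of this
kind, and hence a null line crossing the first one. -/
lemma eq_zero_of_mem_both (hP : P.Finite) (hne : P.Nonempty) (hu : IsSolutionOff u P)
    (hadm : IsAdmissible u P)
    (hcol : ∀ v : Plane, v ≠ 0 → ∃ p ∈ P, ∃ p' ∈ P, cross v p < cross v p') {v : Plane}
    (h1 : v ∈ tangentRays u P 1) (h2 : v ∈ tangentRays u P (-1)) : v = 0 := by
  by_contra hv
  obtain ⟨p, hp, p', hp', hpp⟩ := hcol v hv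
  obtain ⟨l, hl1, hl2, hl⟩ := exists_nullLine_of_mem_both hP hne hu hadm hv h1 h2 hp hp' le_rfl hpp
    le_rfl
  have hn : 0 < ‖v‖ ^ 2 := pow_pos (norm_pos_iff.2 hv) 2
  set w : ℝ → Plane := fun τ => Real.cos τ • v + Real.sin τ • rot v with hw
  have hwc : Continuous w := by fun_prop
  have hvw : ∀ τ, cross v (w τ) = Real.sin τ * ‖v‖ ^ 2 := fun τ => by
    simp only [hw, cross_add_right, cross_smul_right, cross_self_eq_zero, cross_rot_self]; ring
  have hw0 : w 0 = v := by simp [hw]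
  have hwπ : w Real.pi = -v := by simp [hw]
  have hlev : ∀ q ∈ P, cross v q ≠ l := fun q hq h => (hl q h).1 hq
  have hsin : ∀ τ ∈ Ioo 0 Real.pi, 0 < cross v (w τ) := fun τ hτ => by
    rw [hvw]; exact mul_pos (Real.sin_pos_of_pos_of_lt_pi hτ.1 hτ.2) hn
  have hcov : Ioo 0 Real.pi ⊆ w ⁻¹' tangentRays u P 1 ∪ w ⁻¹' tangentRays u P (-1) := by
    rw [← preimage_union, tangentRays_union hP hne hu hadm]; simp
  -- near `0` the forward ray, and near `π` the backward ray, would run into the null line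
  have hfw : (Ioo 0 Real.pi ∩ w ⁻¹' tangentRays u P (-1)).Nonempty := by
    have hev : ∀ᶠ τ in 𝓝 (0 : ℝ), ∀ q ∈ P, l < cross v q → cross (w τ) (p - q) < 0 := by
      refine (hP.eventually_all).2 fun q _ => ?_
      by_cases hq : l < cross v q
      · have hc : ContinuousAt (fun τ => cross (w τ) (p - q)) 0 :=
          (hwc.cross continuous_const).continuousAt
        have h0 : cross (w 0) (p - q) < 0 := by rw [hw0, cross_sub_right]; linarith
        exact (hc.eventually (gt_mem_nhds h0)).mono fun τ h _ => h
      · exact Eventually.of_forall fun τ h => absurd h hq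
    have hIoo : ∀ᶠ τ in 𝓝[>] (0 : ℝ), τ ∈ Ioo 0 Real.pi := Ioo_mem_nhdsGT Real.pi_pos
    obtain ⟨τ, hτ, hτI⟩ := ((hev.filter_mono nhdsWithin_le_nhds).and hIoo).exists
    refine ⟨τ, hτI, (hcov hτI).resolve_left ?_⟩
    rintro ⟨q, hq, hqm, hqr⟩
    rw [one_smul] at hqr
    have hql : cross v q < l := lt_of_le_of_ne (not_lt.1 fun h =>
      absurd (hτ q hq h) (not_lt.2 (hqm p hp))) (hlev q hq)
    exact hl.false_of_rayNull hqr (hsin τ hτI).ne' (div_pos (by linarith) (hsin τ hτI))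
  have hbw : (Ioo 0 Real.pi ∩ w ⁻¹' tangentRays u P 1).Nonempty := by
    have hev : ∀ᶠ τ in 𝓝 Real.pi, ∀ q ∈ P, cross v q < l → cross (w τ) (p' - q) < 0 := by
      refine (hP.eventually_all).2 fun q _ => ?_
      by_cases hq : cross v q < l
      · have hc : ContinuousAt (fun τ => cross (w τ) (p' - q)) Real.pi :=
          (hwc.cross continuous_const).continuousAt
        have h0 : cross (w Real.pi) (p' - q) < 0 := by
          rw [hwπ, cross_neg_left, cross_sub_right]; linarith
        exact (hc.eventually (gt_mem_nhds h0)).mono fun τ h _ => h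
      · exact Eventually.of_forall fun τ h => absurd h hq
    have hIoo : ∀ᶠ τ in 𝓝[<] Real.pi, τ ∈ Ioo 0 Real.pi := Ioo_mem_nhdsLT Real.pi_pos
    obtain ⟨τ, hτ, hτI⟩ := ((hev.filter_mono nhdsWithin_le_nhds).and hIoo).exists
    refine ⟨τ, hτI, (hcov hτI).resolve_right ?_⟩
    rintro ⟨q, hq, hqm, hqr⟩
    rw [neg_one_smul] at hqr
    have hql : l < cross v q := lt_of_le_of_ne (not_lt.1 fun h =>
      absurd (hτ q hq h) (not_lt.2 (hqm p' hp'))) (hlev q hq).symm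
    have hs := hsin τ hτI
    refine hl.false_of_rayNull hqr (by rw [cross_neg_right]; linarith) ?_
    rw [cross_neg_right]
    exact div_pos_of_neg_of_neg (by linarith) (by linarith)
  obtain ⟨τ, hτI, hτ1, hτ2⟩ := isPreconnected_closed_iff.1 isPreconnected_Ioo _ _
    ((isClosed_tangentRays hP hu 1).preimage hwc) ((isClosed_tangentRays hP hu (-1)).preimage hwc)
    hcov hbw hfw
  have hτ0 : w τ ≠ 0 := fun h => by
    have := hsin τ hτI
    rw [h, cross_zero_right] at this
    exact lt_irrefl 0 this
  obtain ⟨r, hr, r', hr', hrr⟩ := hcol (w τ) hτ0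
  obtain ⟨l', -, -, hl'⟩ := exists_nullLine_of_mem_both hP hne hu hadm hτ0 hτ1 hτ2 hr hr' le_rfl hrr
    le_rfl
  exact hl.false_of_cross_ne_zero hl' (hsin τ hτI).ne'

lemma one_lt_rank_plane : 1 < Module.rank ℝ Plane := by
  apply Module.lt_rank_of_lt_finrank
  simp

/-- If `P` is not collinear, the null rays of the supporting lines all have the same
orientation. -/
theorem tangentRays_eq_univ (hP : P.Finite) (hne : P.Nonempty) (hu : IsSolutionOff u P)
    (hadm : IsAdmissible u P)
    (hcol : ∀ v : Plane, v ≠ 0 → ∃ p ∈ P, ∃ p' ∈ P, cross v p < cross v p') :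
    ∃ σ : ℝ, (σ = 1 ∨ σ = -1) ∧ tangentRays u P σ = univ := by
  have hun := tangentRays_union hP hne hu hadm
  by_contra hno
  push Not at hno
  obtain ⟨v, hv⟩ := (ne_univ_iff_exists_notMem _).1 (hno 1 (Or.inl rfl))
  obtain ⟨v', hv'⟩ := (ne_univ_iff_exists_notMem _).1 (hno (-1) (Or.inr rfl))
  have hv0 : v ≠ 0 := fun h => hv (h ▸ zero_mem_tangentRays hne 1)
  have hv'0 : v' ≠ 0 := fun h => hv' (h ▸ zero_mem_tangentRays hne (-1))
  have hm : v ∈ tangentRays u P (-1) := ((hun ▸ mem_univ v :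
    v ∈ tangentRays u P 1 ∪ tangentRays u P (-1))).resolve_left hv
  have hm' : v' ∈ tangentRays u P 1 := ((hun ▸ mem_univ v' :
    v' ∈ tangentRays u P 1 ∪ tangentRays u P (-1))).resolve_right hv'
  obtain ⟨w, hw0, hw1, hw2⟩ := isPreconnected_closed_iff.1
    (isConnected_compl_singleton_of_one_lt_rank one_lt_rank_plane (0 : Plane)).isPreconnected _ _
    (isClosed_tangentRays hP hu 1) (isClosed_tangentRays hP hu (-1)) (by rw [hun]; simp)
    ⟨v', hv'0, hm'⟩ ⟨v, hv0, hm⟩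
  exact hw0 (eq_zero_of_mem_both hP hne hu hadm hcol hw1 hw2)

/-! ### Collinear singular sets -/

/-- Suppose that both rays of the supporting line of direction `v` are null. Then `v` is not
transversal to a segment whose end points belong to `P`, together with a point in between: null lines
on both sides of the point in between would make the singularity there removable. -/
lemma cross_nonpos_of_mem_both (hP : P.Finite) (hu : IsSolutionOff u P) (hadm : IsAdmissible u P)
    {a e : Plane} (ha : a ∈ P) (hb : a + e ∈ P) {γ : ℝ} (hγ : γ ∈ Ioo (0 : ℝ) 1)
    (hc : a + γ • e ∈ P) {v : Plane} (h1 : v ∈ tangentRays u P 1)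
    (h2 : v ∈ tangentRays u P (-1)) : cross v e ≤ 0 := by
  by_contra hpos
  rw [not_le] at hpos
  have hv : v ≠ 0 := by rintro rfl; rw [cross_zero_left] at hpos; exact lt_irrefl _ hpos
  have eb : cross v (a + e) = cross v a + cross v e := cross_add_right _ _ _
  have ec : cross v (a + γ • e) = cross v a + γ * cross v e := by
    rw [cross_add_right, cross_smul_right]
  have m1 := mul_pos hγ.1 hpos
  have m2 := mul_pos (sub_pos.2 hγ.2) hpos
  obtain ⟨l₁, -, k2, k3⟩ := exists_nullLine_of_mem_both hP ⟨a, ha⟩ hu hadm hv h1 h2 ha hb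
    (l₁ := cross v a) (l₂ := cross v (a + γ • e)) le_rfl (by linarith) (by linarith)
  obtain ⟨l₂, j1, -, j3⟩ := exists_nullLine_of_mem_both hP ⟨a, ha⟩ hu hadm hv h1 h2 ha hb
    (l₁ := cross v (a + γ • e)) (l₂ := cross v (a + e)) (by linarith) (by linarith) le_rfl
  exact false_of_between_nullLines hP hu hv k3 j3 hc k2 j1

/-- If `P` lies on a segment and contains a point in its interior, then all rays on one side of the
segment issuing from an end point of it are null. -/
lemma exists_sign_of_collinear (hP : P.Finite) (hu : IsSolutionOff u P) (hadm : IsAdmissible u P)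
    {a e : Plane} (ha : a ∈ P) (hb : a + e ∈ P) {γ : ℝ} (hγ : γ ∈ Ioo (0 : ℝ) 1)
    (hc : a + γ • e ∈ P) (hPe : ∀ p ∈ P, ∃ τ ∈ Icc (0 : ℝ) 1, p = a + τ • e) :
    ∃ σ : ℝ, (σ = 1 ∨ σ = -1) ∧ ∀ z ∉ P, 0 < σ * cross (z - a) e → hess u z (z - a) = 0 := by
  have hray : ∀ σ v, 0 < cross v e → v ∈ tangentRays u P σ → RayNull u P a (σ • v) := by
    rintro σ v hv ⟨q, hq, hqm, hqr⟩
    obtain ⟨τ, hτ, rfl⟩ := hPe q hq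
    have h := hqm a ha
    have e1 : a - (a + τ • e) = (-τ) • e := by module
    rw [e1, cross_smul_right] at h
    have : τ = 0 := le_antisymm (not_lt.1 fun h0 => by nlinarith) hτ.1
    subst this
    simpa using hqr
  have hconv : IsPreconnected {v : Plane | 0 < cross v e} := by
    refine Convex.isPreconnected fun x hx y hy s t hs ht hst => ?_
    simp only [mem_ofPred_eq, cross_add_left, cross_smul_left] at hx hy ⊢
    rcases hs.eq_or_lt with rfl | hs
    · have : t = 1 := by linarith
      subst this; simpa using hy
    · have := mul_pos hs hx
      have := mul_nonneg ht hy.le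
      linarith
  have hcov := tangentRays_union hP ⟨a, ha⟩ hu hadm
  have key : (∀ v, 0 < cross v e → v ∈ tangentRays u P 1) ∨
      ∀ v, 0 < cross v e → v ∈ tangentRays u P (-1) := by
    by_contra! hno
    obtain ⟨⟨v, hv, hv1⟩, ⟨w, hw, hw1⟩⟩ := hno
    have hv2 : v ∈ tangentRays u P (-1) :=
      ((hcov ▸ mem_univ v : v ∈ tangentRays u P 1 ∪ tangentRays u P (-1))).resolve_left hv1
    have hw2 : w ∈ tangentRays u P 1 :=
      ((hcov ▸ mem_univ w : w ∈ tangentRays u P 1 ∪ tangentRays u P (-1))).resolve_right hw1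
    obtain ⟨x, hx, hx1, hx2⟩ := isPreconnected_closed_iff.1 hconv _ _
      (isClosed_tangentRays hP hu 1) (isClosed_tangentRays hP hu (-1))
      (by rw [hcov]; exact subset_univ _) ⟨w, hw, hw2⟩ ⟨v, hv, hv2⟩
    exact absurd (cross_nonpos_of_mem_both hP hu hadm ha hb hγ hc hx1 hx2) (not_le.2 hx)
  have fin : ∀ σ : ℝ, σ * σ = 1 → (∀ v, 0 < cross v e → v ∈ tangentRays u P σ) →
      ∀ z ∉ P, 0 < σ * cross (z - a) e → hess u z (z - a) = 0 := by
    intro σ hσ h z hz hpos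
    rw [← cross_smul_left] at hpos
    have h1 := hray σ _ hpos (h _ hpos) 1 one_pos
    rw [one_smul, smul_smul, hσ, one_smul, add_sub_cancel] at h1
    exact h1 hz
  rcases key with h | h
  · exact ⟨1, Or.inl rfl, fin 1 (by norm_num) h⟩
  · exact ⟨-1, Or.inr rfl, fin (-1) (by norm_num) h⟩

/-- The singular set is not contained in a segment with a singular point in its interior. -/
lemma false_of_collinear (hP : P.Finite) (hu : IsSolutionOff u P) (hadm : IsAdmissible u P)
    {a e : Plane} (he : e ≠ 0) (ha : a ∈ P) (hb : a + e ∈ P) {γ : ℝ} (hγ : γ ∈ Ioo (0 : ℝ) 1)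
    (hc : a + γ • e ∈ P) (hPe : ∀ p ∈ P, ∃ τ ∈ Icc (0 : ℝ) 1, p = a + τ • e) : False := by
  obtain ⟨σ, hσ, hA⟩ := exists_sign_of_collinear hP hu hadm ha hb hγ hc hPe
  obtain ⟨σ', hσ', hB⟩ := exists_sign_of_collinear hP hu hadm (a := a + e) (e := -e) hb
    (by simpa using ha) (γ := 1 - γ) ⟨by linarith [hγ.2], by linarith [hγ.1]⟩
    (by convert hc using 1; module) (fun p hp => by
      obtain ⟨τ, hτ, rfl⟩ := hPe p hp
      exact ⟨1 - τ, ⟨by linarith [hτ.2], by linarith [hτ.1]⟩, by module⟩)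
  have eB : ∀ z, cross (z - (a + e)) (-e) = -cross (z - a) e := fun z => by
    rw [cross_neg_right, ← sub_sub, cross_sub_left, cross_self_eq_zero, sub_zero]
  have hne : 0 < ‖e‖ ^ 2 := pow_pos (norm_pos_iff.2 he) 2
  have hline : ∀ p ∈ P, cross (p - a) e = 0 := fun p hp => by
    obtain ⟨τ, -, rfl⟩ := hPe p hp
    rw [add_sub_cancel_left, cross_smul_left, cross_self_eq_zero, mul_zero]
  have hσ2 : σ * σ = 1 := by rcases hσ with rfl | rfl <;> norm_num
  by_cases hss : σ' = -σ
  · -- both pencils cover the same half-plane, on which `u` is therefore linear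
    have hst : ∀ z ∈ halfStrip a e ((-σ) • rot e), 0 < σ * cross (z - a) e := by
      rintro z ⟨s, -, t, ht, rfl⟩
      have e1 : a + s • e + t • (-σ) • rot e - a = s • e + (t * -σ) • rot e := by module
      rw [e1, cross_add_left, cross_smul_left, cross_smul_left, cross_self_eq_zero,
        cross_swap e (rot e), cross_rot_self]
      have : σ * (s * 0 + t * -σ * -‖e‖ ^ 2) = (σ * σ) * (t * ‖e‖ ^ 2) := by ring
      rw [this, hσ2, one_mul]
      exact mul_pos ht hne
    have hsub : halfStrip a e ((-σ) • rot e) ⊆ Pᶜ := fun z hz hzP => by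
      have := hst z hz
      rw [hline z hzP, mul_zero] at this
      exact lt_irrefl _ this
    obtain ⟨z, hz, hl⟩ := exists_lap_ne_zero_of_halfStrip hP hu hadm
      (by
        rw [cross_smul_right, cross_rot_self]
        exact mul_ne_zero (neg_ne_zero.2 fun h => by rw [h] at hσ2; norm_num at hσ2) hne.ne') hsub
    have h1 := hA z (hsub hz) (hst z hz)
    have h2 := hB z (hsub hz) (by rw [eB, hss, neg_mul_neg]; exact hst z hz)
    refine false_of_two_null hl h1 h2 ?_
    rw [← sub_sub, cross_sub_right, cross_self_eq_zero, zero_sub, neg_ne_zero]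
    intro h0
    have := hst z hz
    rw [h0, mul_zero] at this
    exact lt_irrefl _ this
  · -- opposite pencils: the null directions at the middle point become parallel to the line
    have hss' : σ' = σ := by
      rcases hσ with rfl | rfl <;> rcases hσ' with rfl | rfl <;>
        first | (norm_num; done) | exact absurd (by norm_num) hss
    subst hss'
    have hoff : ∀ z ∉ P, cross e (z - a) ≠ 0 → hess u z (z - a) = 0 ∨ hess u z (z - (a + e)) = 0 := by
      intro z hz h0
      have h0' : σ' * cross (z - a) e ≠ 0 := by
        rw [cross_swap]
        exact mul_ne_zero (fun h => by rw [h] at hσ2; norm_num at hσ2) (neg_ne_zero.2 h0)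
      rcases lt_or_gt_of_ne h0' with h | h
      · exact Or.inr (hB z hz (by rw [eB]; linarith))
      · exact Or.inl (hA z hz h)
    have hall : ∀ z ∉ P, hess u z (z - a) = 0 ∨ hess u z (z - (a + e)) = 0 := by
      intro z hz
      have hS : IsClosed {x : (Plane →L[ℝ] ℝ) × (Plane →L[ℝ] ℝ) | x.1 = 0 ∨ x.2 = 0} :=
        (isClosed_eq continuous_fst continuous_const).union
          (isClosed_eq continuous_snd continuous_const)
      have hcont := continuousAt_hess hP hu hz
      refine mem_of_eventually_off_line (f := fun z => (hess u z (z - a), hess u z (z - (a + e))))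
        hS he (q := a) ?_ ?_
      · exact (hcont.clm_apply (by fun_prop)).prodMk (hcont.clm_apply (by fun_prop))
      · filter_upwards [hP.isClosed.isOpen_compl.mem_nhds hz] with y hy h0 using hoff y hy h0
    refine not_kernelTendsTo hP hu hc he ?_
    intro y x x₀ hy hyP hl hx hxn hxlim
    have hprod : ∀ k, cross (y k - a) (x k) * cross (y k - (a + e)) (x k) = 0 := by
      intro k
      by_contra hne
      obtain ⟨n1, n2⟩ := mul_ne_zero_iff.1 hne
      rcases hall _ (hyP k) with h | h
      · exact false_of_two_null (hl k) h (hx k) n1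
      · exact false_of_two_null (hl k) h (hx k) n2
    have hlim := ((hy.sub_const a).cross hxlim).mul ((hy.sub_const (a + e)).cross hxlim)
    have h0 := tendsto_nhds_unique (hlim.congr hprod) tendsto_const_nhds
    have e1 : a + γ • e - a = γ • e := by module
    have e2 : a + γ • e - (a + e) = (γ - 1) • e := by module
    rw [e1, e2, cross_smul_left, cross_smul_left] at h0
    rcases mul_eq_zero.1 h0 with h | h
    · exact (mul_eq_zero.1 h).resolve_left hγ.1.ne'
    · exact (mul_eq_zero.1 h).resolve_left (by linarith [hγ.2])

/-- A singular set with at least three points is not collinear. -/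
theorem exists_cross_lt (hP : P.Finite) (hu : IsSolutionOff u P) (hadm : IsAdmissible u P)
    (hcard : 3 ≤ P.ncard) {v : Plane} (hv : v ≠ 0) : ∃ p ∈ P, ∃ p' ∈ P, cross v p < cross v p' := by
  by_contra! hno
  have hlev : ∀ p ∈ P, ∀ q ∈ P, cross v (p - q) = 0 := fun p hp q hq => by
    rw [cross_sub_right]; linarith [hno p hp q hq, hno q hq p hp]
  have hne : P.Nonempty := by
    rw [← Set.ncard_pos hP]; omega
  set f : Plane → ℝ := fun z => cross (rot v) z with hf
  have hvr := cross_rot_self_ne hv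
  have hrep : ∀ p ∈ P, ∀ q ∈ P, p - q = ((f p - f q) / cross (rot v) v) • v := by
    intro p hp q hq
    obtain ⟨t, ht⟩ := exists_eq_smul_of_cross_eq_zero hv (hlev p hp q hq)
    have : f p - f q = t * cross (rot v) v := by
      rw [hf]; simp only; rw [← cross_sub_right, ht, cross_smul_right]
    rw [this, mul_div_assoc, div_self (by rw [cross_swap]; exact neg_ne_zero.2 hvr), mul_one, ht]
  obtain ⟨a, ha, hamin⟩ := hP.exists_minimalFor f P hne
  obtain ⟨b, hb, hbmax⟩ := hP.exists_maximalFor f P hne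
  have hmin : ∀ p ∈ P, f a ≤ f p := fun p hp => (le_total (f a) (f p)).elim id fun h => hamin hp h
  have hmax : ∀ p ∈ P, f p ≤ f b := fun p hp => (le_total (f p) (f b)).elim id fun h => hbmax hp h
  have hinj : ∀ p ∈ P, ∀ q ∈ P, f p = f q → p = q := fun p hp q hq h => by
    have := hrep p hp q hq
    rwa [h, sub_self, zero_div, zero_smul, sub_eq_zero] at this
  obtain ⟨c, hc, hcab⟩ : ∃ c ∈ P, c ∉ ({a, b} : Set Plane) := by
    by_contra! hsub
    have := Set.ncard_le_ncard (show P ⊆ {a, b} from hsub) (by simp)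
    have := Set.ncard_insert_le a ({b} : Set Plane)
    rw [Set.ncard_singleton] at this
    omega
  simp only [mem_insert_iff, mem_singleton_iff, not_or] at hcab
  have hac : f a < f c := lt_of_le_of_ne (hmin c hc) fun h => hcab.1 (hinj _ hc _ ha h.symm)
  have hcb : f c < f b := lt_of_le_of_ne (hmax c hc) fun h => hcab.2 (hinj _ hc _ hb h)
  have hrep' : ∀ p ∈ P, p = a + ((f p - f a) / (f b - f a)) • (b - a) := fun p hp => by
    have h1 : (f b - f a) ≠ 0 := by linarith
    rw [hrep b hb a ha, smul_smul, div_mul_div_comm, mul_comm (f b - f a), mul_div_mul_right _ _ h1,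
      ← hrep p hp a ha]
    abel
  refine false_of_collinear hP hu hadm (a := a) (e := b - a) (γ := (f c - f a) / (f b - f a))
    (sub_ne_zero.2 ?_) ha (by simpa using hb) ⟨div_pos (by linarith) (by linarith), ?_⟩
    (by rw [← hrep' c hc]; exact hc) (fun p hp => ⟨_, ⟨?_, ?_⟩, hrep' p hp⟩)
  · rintro rfl; linarith
  · rw [div_lt_one (by linarith)]; linarith
  · exact div_nonneg (by linarith [hmin p hp]) (by linarith)
  · rw [div_le_one (by linarith)]; linarith [hmax p hp]

/-! ### The convex hull of the singular set -/

lemma RayNull.smul {q v : Plane} (h : RayNull u P q v) {c : ℝ} (hc : 0 < c) :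
    RayNull u P q (c • v) := by
  intro t ht hz
  rw [smul_smul] at hz ⊢
  rw [map_smul, h _ (mul_pos ht hc) hz, smul_zero]

/-- Every direction is the direction of a ray of null vectors issuing from a point of `P` in a line
that supports `P`, with `P` always on the same side. -/
def HasTangentRays (u : Plane → ℝ) (P : Set Plane) (σ : ℝ) : Prop :=
  ∀ v, ∃ q ∈ P, (∀ p ∈ P, 0 ≤ σ * cross v (p - q)) ∧ RayNull u P q v

theorem exists_hasTangentRays (hP : P.Finite) (hne : P.Nonempty) (hu : IsSolutionOff u P)
    (hadm : IsAdmissible u P)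
    (hcol : ∀ v : Plane, v ≠ 0 → ∃ p ∈ P, ∃ p' ∈ P, cross v p < cross v p') :
    ∃ σ : ℝ, (σ = 1 ∨ σ = -1) ∧ HasTangentRays u P σ := by
  obtain ⟨σ, hσ, h⟩ := tangentRays_eq_univ hP hne hu hadm hcol
  refine ⟨σ, hσ, fun v => ?_⟩
  obtain ⟨q, hq, h1, h2⟩ : σ • v ∈ tangentRays u P σ := h ▸ mem_univ _
  refine ⟨q, hq, fun p hp => by simpa [cross_smul_left] using h1 p hp, ?_⟩
  rw [smul_smul] at h2
  rcases hσ with rfl | rfl <;> simpa using h2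

lemma exists_cross_pos_of_notMem_convexHull (hP : P.Finite) {z : Plane}
    (hz : z ∉ convexHull ℝ P) : ∃ m : Plane, ∀ p ∈ P, 0 < cross m (p - z) := by
  obtain ⟨f, s, h1, h2⟩ := geometric_hahn_banach_point_closed (convex_convexHull ℝ P)
    (hP.isCompact_convexHull ℝ).isClosed hz
  refine ⟨f e₁ • e₀ - f e₀ • e₁, fun p hp => ?_⟩
  have h3 : f (p - z) = cross (f e₁ • e₀ - f e₀ • e₁) (p - z) := by
    conv_lhs => rw [plane_eq (p - z)]
    simp [cross, e₀, e₁]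
    ring
  rw [← h3, map_sub]
  linarith [h2 p (subset_convexHull ℝ P hp)]

/-- Through every point outside the convex hull of `P` passes one of the tangent rays. -/
lemma HasTangentRays.exists_of_notMem_convexHull {σ : ℝ} (hH : HasTangentRays u P σ)
    (hσ : σ ≠ 0) (hP : P.Finite) (hne : P.Nonempty) {z : Plane} (hz : z ∉ convexHull ℝ P) :
    ∃ q ∈ P, (∀ p ∈ P, 0 ≤ σ * cross (z - q) (p - q)) ∧ RayNull u P q (z - q) := by
  obtain ⟨m, hm⟩ := exists_cross_pos_of_notMem_convexHull hP hz
  have hm0 : m ≠ 0 := by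
    rintro rfl
    obtain ⟨p, hp⟩ := hne
    have := hm p hp
    rw [cross_zero_left] at this
    exact lt_irrefl _ this
  have hn : 0 < ‖m‖ ^ 2 := pow_pos (norm_pos_iff.2 hm0) 2
  -- `q` is the contact point of one of the two lines through `z` that support `P`
  obtain ⟨q, hq, hqmax⟩ := hP.exists_maximalFor
    (fun p => σ * (cross (rot m) (p - z) / cross m (p - z))) P hne
  have hmax : ∀ p ∈ P, σ * (cross (rot m) (p - z) / cross m (p - z)) ≤
      σ * (cross (rot m) (q - z) / cross m (q - z)) := fun p hp =>
    (le_total _ _).elim id fun h => hqmax hp h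
  have hsup : ∀ p ∈ P, 0 ≤ σ * cross (z - q) (p - q) := by
    intro p hp
    have e : ‖m‖ ^ 2 * cross (z - q) (p - q) = cross m (p - z) * cross (rot m) (q - z) -
        cross m (q - z) * cross (rot m) (p - z) := by
      rw [← cross_rot_self]
      simp only [cross, rot_zero', rot_one', PiLp.sub_apply]
      ring
    have h1 := hm p hp
    have h2 := hm q hq
    have h3 : ‖m‖ ^ 2 * (σ * cross (z - q) (p - q)) = cross m (p - z) * cross m (q - z) *
        (σ * (cross (rot m) (q - z) / cross m (q - z)) -
          σ * (cross (rot m) (p - z) / cross m (p - z))) := by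
      rw [mul_left_comm, e]
      field_simp
    refine nonneg_of_mul_nonneg_right ?_ hn
    rw [h3]
    exact mul_nonneg (mul_pos h1 h2).le (sub_nonneg.2 (hmax p hp))
  -- the tangent ray of this direction may issue from another point of the same line, but one
  -- before `z`, since `z` lies outside the convex hull
  obtain ⟨q', hq', h1, h2⟩ := hH (z - q)
  have hzq : z - q ≠ 0 := by
    intro h
    have := hm q hq
    rw [← neg_sub, h, neg_zero, cross_zero_right] at this
    exact lt_irrefl _ this
  have h3 := h1 q hq
  have h4 := hsup q' hq'
  rw [← neg_sub q' q, cross_neg_right] at h3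
  have h5 : cross (z - q) (q' - q) = 0 :=
    (mul_eq_zero.1 (by linarith : σ * cross (z - q) (q' - q) = 0)).resolve_left hσ
  obtain ⟨τ, hτ⟩ := exists_eq_smul_of_cross_eq_zero hzq h5
  have e1 : q' - z = (1 - τ) • (q - z) := by
    have : q' - z = (q' - q) - (z - q) := by abel
    rw [this, hτ]; module
  have hτ1 : 0 < 1 - τ := by
    have := hm q' hq'
    rw [e1, cross_smul_right] at this
    exact pos_of_mul_pos_left this (hm q hq).le
  have e2 : z - q' = (1 - τ) • (z - q) := by
    rw [← neg_sub q' z, e1]; module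
  refine ⟨q', hq', fun p hp => ?_, ?_⟩
  · rw [e2, cross_smul_left, mul_left_comm]
    exact mul_nonneg hτ1.le (h1 p hp)
  · rw [e2]
    exact h2.smul hτ1

lemma cross_nonneg_of_mem_convexHull {d q : Plane} (h : ∀ p ∈ P, 0 ≤ cross d (p - q)) :
    ∀ p ∈ convexHull ℝ P, 0 ≤ cross d (p - q) := by
  refine convexHull_min (t := {p | 0 ≤ cross d (p - q)}) h ?_
  intro a ha b hb s t hs ht hst
  simp only [mem_ofPred_eq, cross_sub_right, cross_add_right, cross_smul_right] at ha hb ⊢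
  have h4 : s * cross d a + t * cross d b - cross d q =
      s * (cross d a - cross d q) + t * (cross d b - cross d q) := by
    have : s = 1 - t := by linarith
    subst this; ring
  rw [h4]
  exact add_nonneg (mul_nonneg hs ha) (mul_nonneg ht hb)

/-- A leaf through a point outside the convex hull of `P` lies on a supporting line of `P`. -/
lemma HasTangentRays.exists_supporting {σ : ℝ} (hH : HasTangentRays u P σ) (hσ : σ ≠ 0)
    (hP : P.Finite) (hne : P.Nonempty) {z x : Plane} (hz : z ∉ convexHull ℝ P) (hl : lap u z ≠ 0)
    (hx : hess u z x = 0) : ∃ q ∈ P, cross x (z - q) = 0 ∧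
      ((∀ p ∈ convexHull ℝ P, 0 ≤ cross x (p - q)) ∨
        ∀ p ∈ convexHull ℝ P, cross x (p - q) ≤ 0) := by
  obtain ⟨q, hq, hqs, hqr⟩ := hH.exists_of_notMem_convexHull hσ hP hne hz
  have hzq : z - q ≠ 0 := by
    intro h
    rw [sub_eq_zero.1 h] at hz
    exact hz (subset_convexHull ℝ P hq)
  have h1 := hqr 1 one_pos
  rw [one_smul, add_sub_cancel] at h1
  have h2 := h1 fun h => hz (subset_convexHull ℝ P h)
  have h3 : cross x (z - q) = 0 := by
    by_contra hne'
    exact false_of_two_null hl hx h2 hne'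
  obtain ⟨c, rfl⟩ := exists_eq_smul_of_cross_eq_zero hzq (by rw [cross_swap, h3, neg_zero])
  refine ⟨q, hq, h3, ?_⟩
  have hscale : ∀ p, σ ^ 2 * cross (c • (z - q)) (p - q) =
      (c * σ) * (σ * cross (z - q) (p - q)) := fun p => by rw [cross_smul_left]; ring
  rcases le_total 0 (c * σ) with h | h
  · left
    refine cross_nonneg_of_mem_convexHull fun p hp => ?_
    refine nonneg_of_mul_nonneg_right (a := σ ^ 2) ?_ (by positivity)
    rw [hscale]
    exact mul_nonneg h (hqs p hp)
  · right
    intro p hp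
    rw [← neg_nonneg, ← cross_neg_left]
    refine cross_nonneg_of_mem_convexHull (fun p hp => ?_) p hp
    refine nonneg_of_mul_nonneg_right (a := σ ^ 2) ?_ (by positivity)
    rw [cross_neg_left, mul_neg, hscale, neg_nonneg]
    exact mul_nonpos_of_nonpos_of_nonneg h (hqs p hp)

lemma cross_ne_zero_of_mem_interior {K : Set Plane} {d q y : Plane} (hd : d ≠ 0)
    (hy : y ∈ interior K) (h : (∀ p ∈ K, 0 ≤ cross d (p - q)) ∨ ∀ p ∈ K, cross d (p - q) ≤ 0) :
    cross d (y - q) ≠ 0 := by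
  have hn : 0 < ‖d‖ ^ 2 := pow_pos (norm_pos_iff.2 hd) 2
  have hev : ∀ᶠ t : ℝ in 𝓝 0, y + t • rot d ∈ K := by
    have hc : ContinuousAt (fun t : ℝ => y + t • rot d) 0 := by fun_prop
    exact hc.eventually (by simpa using mem_interior_iff_mem_nhds.1 hy)
  obtain ⟨ε, hε, hball⟩ := Metric.eventually_nhds_iff.1 hev
  have h1 := hball (y := ε / 2) (by rw [dist_zero_right, Real.norm_eq_abs, abs_of_pos] <;> linarith)
  have h2 := hball (y := -(ε / 2))
    (by rw [dist_zero_right, norm_neg, Real.norm_eq_abs, abs_of_pos] <;> linarith)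
  have hv : ∀ t : ℝ, cross d (y + t • rot d - q) = cross d (y - q) + t * ‖d‖ ^ 2 := fun t => by
    rw [cross_sub_right, cross_add_right, cross_smul_right, cross_rot_self, cross_sub_right]; ring
  intro h0
  have := mul_pos hε hn
  rcases h with h | h
  · have := h _ h2
    rw [hv, h0] at this
    linarith
  · have := h _ h1
    rw [hv, h0] at this
    linarith

/-- The Hessian vanishes inside the convex hull of `P`: a leaf through an interior point can be
chosen to meet `P` at most on one side; on the other side it leaves the convex hull, but there leaves
lie on supporting lines. -/
lemma HasTangentRays.lap_eq_zero_of_mem_interior {σ : ℝ} (hH : HasTangentRays u P σ) (hσ : σ ≠ 0)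
    (hP : P.Finite) (hne : P.Nonempty) (hu : IsSolutionOff u P) {z : Plane}
    (hz : z ∈ interior (convexHull ℝ P)) (hzP : z ∉ P) : lap u z = 0 := by
  by_contra hl
  have hev : ∀ᶠ y in 𝓝 z, lap u y ≠ 0 ∧ y ∉ P ∧ y ∈ interior (convexHull ℝ P) :=
    ((continuousAt_lap hP hu hzP).eventually_ne hl).and
      ((hP.isClosed.isOpen_compl.eventually_mem hzP).and (isOpen_interior.eventually_mem hz))
  obtain ⟨O, hO, hOo, hzO⟩ := mem_nhds_iff.1 hev
  obtain ⟨y, hy, hgen⟩ := exists_forall_cross_secant_ne_zero hP hOo ⟨z, hzO⟩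
  obtain ⟨hyl, hyP, hyi⟩ := hO hy
  obtain ⟨x, hxn, hx⟩ := exists_null hP hu hyP
  have hx0 : x ≠ 0 := fun h => by rw [h, norm_zero] at hxn; exact zero_ne_one hxn
  have key : ∀ x : Plane, ‖x‖ = 1 → hess u y x = 0 → ∃ t : ℝ, 0 < t ∧ y + t • x ∈ P := by
    intro x hxn hx
    by_contra! hno
    obtain ⟨R, hR⟩ := (hP.isCompact_convexHull ℝ).isBounded.subset_closedBall y
    set t := |R| + 1
    have ht : 0 < t := by positivity
    have hout : y + t • x ∉ convexHull ℝ P := by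
      intro h
      have := hR h
      rw [Metric.mem_closedBall, dist_eq_norm, add_sub_cancel_left, norm_smul, hxn, mul_one,
        Real.norm_eq_abs, abs_of_pos ht] at this
      linarith [le_abs_self R]
    obtain ⟨h1, h2⟩ := lap_ne_zero_of_segment hP hu hyl hx (t := t) (fun s hs => by
      rcases eq_or_lt_of_le hs.1 with h | h
      · rw [← h]; simpa using hyP
      · exact hno _ (mul_pos h ht))
    obtain ⟨q, hq, h3, h4⟩ := hH.exists_supporting hσ hP hne hout h1 h2
    refine cross_ne_zero_of_mem_interior (fun h => ?_) hyi h4 ?_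
    · rw [h, norm_zero] at hxn; exact zero_ne_one hxn
    · rwa [add_sub_right_comm, cross_add_right, cross_smul_right, cross_self_eq_zero, mul_zero,
        add_zero] at h3
  obtain ⟨t, ht, htP⟩ := key x hxn hx
  obtain ⟨s, hs, hsP⟩ := key (-x) (by rwa [norm_neg]) (by rw [map_neg, hx, neg_zero])
  refine hgen _ htP _ hsP ?_ ?_
  · intro h
    have h1 : (t + s) • x = 0 := by
      have := add_left_cancel h
      rw [smul_neg] at this
      rw [add_smul, this, neg_add_cancel]
    rcases smul_eq_zero.1 h1 with h2 | h2
    · linarith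
    · exact hx0 h2
  · have e1 : y + s • -x - (y + t • x) = (-s - t) • x := by module
    have e2 : y - (y + t • x) = (-t) • x := by module
    rw [e1, e2, cross_smul_left, cross_smul_right, cross_self_eq_zero, mul_zero, mul_zero]

lemma interior_convexHull_nonempty (hne : P.Nonempty)
    (hcol : ∀ v : Plane, v ≠ 0 → ∃ p ∈ P, ∃ p' ∈ P, cross v p < cross v p') :
    (interior (convexHull ℝ P)).Nonempty := by
  rw [interior_convexHull_nonempty_iff_affineSpan_eq_top,
    AffineSubspace.affineSpan_eq_top_iff_vectorSpan_eq_top_of_nonempty ℝ Plane Plane hne]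
  have he : e₀ ≠ 0 := fun h => by simpa [e₀] using congrArg (fun z : Plane => z 0) h
  obtain ⟨p, hp, p', hp', h⟩ := hcol e₀ he
  obtain ⟨r, hr, r', hr', h'⟩ := hcol (p' - p) fun h0 => by rw [sub_eq_zero.1 h0] at h; exact h.false
  have hc : cross (p' - p) (r' - r) ≠ 0 := by rw [cross_sub_right]; linarith
  refine eq_top_iff.2 fun z _ => ?_
  rw [eq_smul_add_smul hc z]
  exact add_mem (Submodule.smul_mem _ _ (vsub_mem_vectorSpan ℝ hp' hp))
    (Submodule.smul_mem _ _ (vsub_mem_vectorSpan ℝ hr' hr))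

lemma HasTangentRays.lap_eq_zero_of_mem_convexHull {σ : ℝ} (hH : HasTangentRays u P σ) (hσ : σ ≠ 0)
    (hP : P.Finite) (hne : P.Nonempty) (hu : IsSolutionOff u P)
    (hint : (interior (convexHull ℝ P)).Nonempty) {z : Plane}
    (hz : z ∈ convexHull ℝ P) (hzP : z ∉ P) : lap u z = 0 := by
  by_contra hl
  have hev : ∀ᶠ y in 𝓝 z, lap u y ≠ 0 ∧ y ∉ P :=
    ((continuousAt_lap hP hu hzP).eventually_ne hl).and (hP.isClosed.isOpen_compl.mem_nhds hzP)
  have hz' : z ∈ closure (interior (convexHull ℝ P)) := by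
    rw [(convex_convexHull ℝ P).closure_interior_eq_closure_of_nonempty_interior hint]
    exact subset_closure hz
  obtain ⟨y, ⟨hy1, hy2⟩, hy3⟩ := (mem_closure_iff_nhds.1 hz') _ hev
  exact hy1 (hH.lap_eq_zero_of_mem_interior hσ hP hne hu hy3 hy2)

/-- The points of `P` are in convex position: at a point of `P` in an open segment contained in the
convex hull, the leaves, being contained in supporting lines, would become parallel to this
segment. -/
theorem HasTangentRays.extremePoints_convexHull {σ : ℝ} (hH : HasTangentRays u P σ) (hσ : σ ≠ 0)
    (hP : P.Finite) (hne : P.Nonempty) (hu : IsSolutionOff u P)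
    (hint : (interior (convexHull ℝ P)).Nonempty) : (convexHull ℝ P).extremePoints ℝ = P := by
  refine extremePoints_convexHull_subset.antisymm fun q hq => ?_
  refine ⟨subset_convexHull ℝ P hq, fun a ha b hb hqab => ?_⟩
  by_contra hab
  have hd : b - a ≠ 0 := by
    intro h
    rw [sub_eq_zero.1 h, openSegment_same, mem_singleton_iff] at hqab
    exact hab hqab.symm
  refine not_kernelTendsTo hP hu hq hd ?_
  intro y x x₀ hy hyP hl hx hxn hxlim
  -- lying on a supporting line is a closed condition on a point and a direction
  set S : Set (Plane × Plane) := ⋃ q' ∈ P, {w | cross w.1 (w.2 - q') = 0} ∩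
      ({w | ∀ p ∈ convexHull ℝ P, 0 ≤ cross w.1 (p - q')} ∪
        {w | ∀ p ∈ convexHull ℝ P, cross w.1 (p - q') ≤ 0}) with hS
  have hSc : IsClosed S := by
    refine hP.isClosed_biUnion fun q' _ => ?_
    refine (isClosed_eq (by fun_prop) (by fun_prop)).inter (IsClosed.union ?_ ?_)
    · have : {w : Plane × Plane | ∀ p ∈ convexHull ℝ P, 0 ≤ cross w.1 (p - q')} =
          ⋂ p ∈ convexHull ℝ P, {w | 0 ≤ cross w.1 (p - q')} := by ext; simp
      rw [this]
      exact isClosed_biInter fun p _ => isClosed_le (by fun_prop) (by fun_prop)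
    · have : {w : Plane × Plane | ∀ p ∈ convexHull ℝ P, cross w.1 (p - q') ≤ 0} =
          ⋂ p ∈ convexHull ℝ P, {w | cross w.1 (p - q') ≤ 0} := by ext; simp
      rw [this]
      exact isClosed_biInter fun p _ => isClosed_le (by fun_prop) (by fun_prop)
  have hmem : ((x₀, q) : Plane × Plane) ∈ S := by
    refine hSc.mem_of_tendsto (hxlim.prodMk_nhds hy) (Eventually.of_forall fun k => ?_)
    have hout : y k ∉ convexHull ℝ P := fun h =>
      hl k (hH.lap_eq_zero_of_mem_convexHull hσ hP hne hu hint h (hyP k))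
    obtain ⟨q', hq', h1, h2⟩ := hH.exists_supporting hσ hP hne hout (hl k) (hx k)
    exact mem_biUnion hq' ⟨h1, h2⟩
  rw [hS, mem_iUnion₂] at hmem
  obtain ⟨q', hq', h1, h2⟩ := hmem
  simp only [mem_ofPred_eq, mem_union] at h1 h2
  obtain ⟨s, t, hs, ht, hst, rfl⟩ := hqab
  simp only [cross_sub_right, cross_add_right, cross_smul_right] at h1 h2
  rw [cross_swap, cross_sub_right, neg_eq_zero]
  have hs' : s = 1 - t := by linarith
  subst hs'
  rcases h2 with h2 | h2
  · have ha' := h2 a ha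
    have hb' := h2 b hb
    have := mul_nonneg hs.le ha'
    have := mul_nonneg ht.le hb'
    have := (mul_eq_zero.1 (show t * (cross x₀ b - cross x₀ q') = 0 by linarith)).resolve_left ht.ne'
    have := (mul_eq_zero.1 (show (1 - t) * (cross x₀ a - cross x₀ q') = 0 by
      linarith)).resolve_left hs.ne'
    linarith
  · have ha' := h2 a ha
    have hb' := h2 b hb
    have := mul_nonpos_of_nonneg_of_nonpos hs.le ha'
    have := mul_nonpos_of_nonneg_of_nonpos ht.le hb'
    have := (mul_eq_zero.1 (show t * (cross x₀ b - cross x₀ q') = 0 by linarith)).resolve_left ht.ne'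
    have := (mul_eq_zero.1 (show (1 - t) * (cross x₀ a - cross x₀ q') = 0 by
      linarith)).resolve_left hs.ne'
    linarith

/-! ### The cyclic order of points in convex position -/

lemma exists_cross_pos_of_extreme (hP : P.Finite) (hext : (convexHull ℝ P).extremePoints ℝ = P)
    {q : Plane} (hq : q ∈ P) : ∃ m : Plane, ∀ p ∈ P, p ≠ q → 0 < cross m (p - q) := by
  have h1 : q ∈ (convexHull ℝ P).extremePoints ℝ := by rwa [hext]
  have h2 := ((convex_convexHull ℝ P).mem_extremePoints_iff_mem_sdiff_convexHull_sdiff.1 h1).2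
  have h3 : q ∉ convexHull ℝ (P \ {q}) := fun h =>
    h2 (convexHull_mono (sdiff_subset_sdiff_left (subset_convexHull ℝ P)) h)
  obtain ⟨m, hm⟩ := exists_cross_pos_of_notMem_convexHull hP.sdiff h3
  exact ⟨m, fun p hp hpq => hm p ⟨hp, hpq⟩⟩

/-- The relation between three vectors of the plane, paired with a fourth one. -/
lemma cross_mul_cross_cyclic (m x y z : Plane) :
    cross m x * cross y z + cross m y * cross z x + cross m z * cross x y = 0 := by
  simp only [cross]; ring

/-- The points of a finite set in convex position, numbered so that `s` times the oriented area of
every triangle with increasing indices is positive: the first point is arbitrary, the other ones are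
ordered by the angle under which they are seen from it. -/
lemma exists_perm_cross_pos {n : ℕ} [NeZero n] {p : Fin n → Plane} (hp : Function.Injective p)
    (hsep : ∀ i, ∃ m : Plane, ∀ j, j ≠ i → 0 < cross m (p j - p i)) {s : ℝ} (hs : s ≠ 0) :
    ∃ σ : Equiv.Perm (Fin n), ∀ i j k, i < j → j < k →
      0 < s * cross (p (σ j) - p (σ i)) (p (σ k) - p (σ i)) := by
  classical
  -- a point is never a convex combination of three other ones
  have htri : ∀ q a b c, a ≠ q → b ≠ q → c ≠ q → 0 < s * cross (p a - p q) (p b - p q) →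
      0 ≤ s * cross (p b - p q) (p c - p q) → 0 ≤ s * cross (p c - p q) (p a - p q) → False := by
    intro q a b c ha hb hc h1 h2 h3
    obtain ⟨m, hm⟩ := hsep q
    have := cross_mul_cross_cyclic m (p a - p q) (p b - p q) (p c - p q)
    have e1 := mul_nonneg (hm a ha).le h2
    have e2 := mul_nonneg (hm b hb).le h3
    have e3 := mul_pos (hm c hc) h1
    have e4 : s * (cross m (p a - p q) * cross (p b - p q) (p c - p q) +
        cross m (p b - p q) * cross (p c - p q) (p a - p q) +
        cross m (p c - p q) * cross (p a - p q) (p b - p q)) = 0 := by rw [this, mul_zero]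
    linarith
  obtain ⟨m, hm⟩ := hsep 0
  set x : Fin n → Plane := fun i => p i - p 0 with hx
  set r : Fin n → ℝ := fun i => s * (cross (rot m) (x i) / cross m (x i)) with hr
  -- `f` orders the points by their angle as seen from the first one
  set f : Fin n → WithBot ℝ := fun i => if i = 0 then ⊥ else (r i : WithBot ℝ) with hf
  have hcr : ∀ i j, i ≠ 0 → j ≠ 0 →
      ‖m‖ ^ 2 * (s * cross (x i) (x j)) = cross m (x i) * cross m (x j) * (r j - r i) := by
    intro i j hi hj
    have h1 := hm i hi
    have h2 := hm j hj
    have e : ‖m‖ ^ 2 * cross (x i) (x j) = cross m (x i) * cross (rot m) (x j) -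
        cross m (x j) * cross (rot m) (x i) := by
      rw [← cross_rot_self]
      simp only [cross, rot_zero', rot_one']
      ring
    rw [mul_left_comm, e]
    simp only [hr]
    simp only [hx]
    field_simp
  have hx0 : ∀ i, i ≠ 0 → x i ≠ 0 := fun i hi h => hi (hp (sub_eq_zero.1 h))
  have hcr0 : ∀ i j, i ≠ 0 → j ≠ 0 → i ≠ j → cross (x i) (x j) ≠ 0 := by
    intro i j hi hj hij h
    obtain ⟨t, ht⟩ := exists_eq_smul_of_cross_eq_zero (hx0 i hi) h
    have h1 : 0 < t := by
      have := hm j hj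
      change 0 < cross m (x j) at this
      rw [ht, cross_smul_right] at this
      exact pos_of_mul_pos_left this (hm i hi).le
    have e1 : p 0 - p i = (-1 : ℝ) • x i := by simp only [hx]; module
    have e2 : p j - p i = (t - 1) • x i := by
      have : p j - p i = x j - x i := by simp only [hx]; abel
      rw [this, ht]; module
    have e3 : p 0 - p j = (-t) • x i := by
      have : p 0 - p j = -x j := by simp only [hx]; abel
      rw [this, ht]; module
    have e4 : p i - p j = (1 - t) • x i := by
      rw [← neg_sub (p j), e2]; module
    rcases lt_trichotomy t 1 with h2 | rfl | h2
    · obtain ⟨m', hm'⟩ := hsep j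
      have k1 := hm' 0 hj.symm
      have k2 := hm' i hij
      rw [e3, cross_smul_right] at k1
      rw [e4, cross_smul_right] at k2
      nlinarith [pos_of_mul_pos_right k2 (by linarith)]
    · rw [one_smul] at ht
      exact hij (hp (sub_left_injective ht)).symm
    · obtain ⟨m', hm'⟩ := hsep i
      have k1 := hm' 0 hi.symm
      have k2 := hm' j hij.symm
      rw [e1, cross_smul_right] at k1
      rw [e2, cross_smul_right] at k2
      nlinarith [pos_of_mul_pos_right k2 (by linarith)]
  have hm0 : n = 1 ∨ m ≠ 0 := by
    by_contra! h
    obtain ⟨j, hj⟩ : ∃ j : Fin n, j ≠ 0 := by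
      have := NeZero.ne n
      exact ⟨⟨1, by omega⟩, fun h => by simpa using congrArg Fin.val h⟩
    have := hm j hj
    rw [h.2, cross_zero_left] at this
    exact this.false
  rcases hm0 with rfl | hm0
  · exact ⟨1, fun i j k hij => by omega⟩
  have hn : 0 < ‖m‖ ^ 2 := pow_pos (norm_pos_iff.2 hm0) 2
  have hfinj : Function.Injective f := by
    intro i j hij
    by_contra hne
    by_cases hi : i = 0
    · have hj : j ≠ 0 := fun h => hne (hi.trans h.symm)
      simp [hf, hi, hj] at hij
    · by_cases hj : j = 0
      · simp [hf, hi, hj] at hij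
      · simp only [hf, hi, hj, if_false, WithBot.coe_inj] at hij
        have := hcr i j hi hj
        rw [hij, sub_self, mul_zero] at this
        rcases mul_eq_zero.1 this with h | h
        · exact hn.ne' h
        · exact hcr0 i j hi hj hne ((mul_eq_zero.1 h).resolve_left hs)
  set σ := Tuple.sort f with hσ
  have hmono : StrictMono (f ∘ σ) :=
    (Tuple.monotone_sort f).strictMono_of_injective (hfinj.comp σ.injective)
  have hσ0 : σ 0 = 0 := by
    have h1 : f (σ 0) ≤ f (σ (σ.symm 0)) := hmono.monotone (Fin.zero_le _)
    rw [Equiv.apply_symm_apply] at h1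
    have h2 : f 0 = ⊥ := by simp [hf]
    rw [h2, le_bot_iff, ← h2] at h1
    exact hfinj h1
  have hσne : ∀ i, 0 < i → σ i ≠ 0 := fun i hi h => hi.ne' (σ.injective (h.trans hσ0.symm))
  have hpos : ∀ i j, 0 < i → i < j → 0 < s * cross (x (σ i)) (x (σ j)) := by
    intro i j hi hij
    have hi' := hσne i hi
    have hj' := hσne j (hi.trans hij)
    have h1 := hmono hij
    simp only [Function.comp_apply, hf, hi', hj', if_false, WithBot.coe_lt_coe] at h1
    have h2 := hcr _ _ hi' hj'
    refine pos_of_mul_pos_right (a := ‖m‖ ^ 2) ?_ hn.le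
    rw [h2]
    exact mul_pos (mul_pos (hm _ hi') (hm _ hj')) (sub_pos.2 h1)
  refine ⟨σ, fun i j k hij hjk => ?_⟩
  rcases (Fin.zero_le i).eq_or_lt with rfl | hi
  · rw [hσ0]; exact hpos j k hij hjk
  by_contra hneg
  have hne : ∀ a b, a < b → σ a ≠ σ b := fun a b hab h => hab.ne (σ.injective h)
  refine htri (σ j) (σ k) (σ 0) (σ i) (hne _ _ hjk).symm (hne _ _ (hi.trans hij)) (hne _ _ hij)
    ?_ ?_ ?_
  · refine (hpos j k (hi.trans hij) hjk).trans_eq ?_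
    rw [hσ0]; simp only [hx, cross, PiLp.sub_apply]; ring
  · refine (hpos i j hi hij).le.trans_eq ?_
    rw [hσ0]; simp only [hx, cross, PiLp.sub_apply]; ring
  · rw [not_lt, ← neg_nonneg] at hneg
    refine hneg.trans_eq ?_
    simp only [cross, PiLp.sub_apply]; ring

/-- The same numbering, described by the sides of the convex polygon: all other points lie strictly
on one side of the line through two consecutive points. -/
lemma exists_perm_side {n : ℕ} [NeZero n] {p : Fin n → Plane} (hp : Function.Injective p)
    (hsep : ∀ i, ∃ m : Plane, ∀ j, j ≠ i → 0 < cross m (p j - p i)) {s : ℝ} (hs : s ≠ 0) :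
    ∃ σ : Equiv.Perm (Fin n), ∀ i j, j ≠ i → j ≠ i + 1 →
      0 < s * cross (p (σ (i + 1)) - p (σ i)) (p (σ j) - p (σ i)) := by
  obtain ⟨σ, hσ⟩ := exists_perm_cross_pos hp hsep hs
  refine ⟨σ, fun i j hji hji' => ?_⟩
  have h1 : ((i + 1 : Fin n) : ℕ) = (i + 1) % n := by
    rw [Fin.val_add, Fin.val_one', Nat.add_mod_mod]
  have hin := i.isLt
  have hjn := j.isLt
  rcases Nat.lt_or_ge (i + 1) n with h | h
  · rw [Nat.mod_eq_of_lt h] at h1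
    have hii : i < i + 1 := by rw [Fin.lt_def]; omega
    rcases lt_or_gt_of_ne hji with h2 | h2
    · refine (hσ j i (i + 1) h2 hii).trans_eq ?_
      simp only [cross, PiLp.sub_apply]; ring
    · refine hσ i (i + 1) j hii ?_
      rw [Fin.lt_def] at h2 ⊢
      have : (j : ℕ) ≠ (i + 1 : Fin n) := fun h => hji' (Fin.ext h)
      omega
  · have h0 : i + 1 = 0 := by
      apply Fin.ext
      rw [h1, show (i : ℕ) + 1 = n by omega, Nat.mod_self]; simp
    rw [h0] at hji' ⊢
    have hj0 : 0 < j := lt_of_le_of_ne (Fin.zero_le _) (Ne.symm hji')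
    have hjl : j < i := by
      rw [Fin.lt_def]
      have : (j : ℕ) ≠ i := fun h => hji (Fin.ext h)
      omega
    refine (hσ 0 j i hj0 hjl).trans_eq ?_
    simp only [cross, PiLp.sub_apply]; ring

/-! ### Conical functions on sectors -/

lemma contDiff_unitVec {n : WithTop ℕ∞} : ContDiff ℝ n unitVec := by
  rw [contDiff_euclidean]
  intro i
  fin_cases i
  · simpa [unitVec_zero] using Real.contDiff_cos
  · simpa [unitVec_one] using Real.contDiff_sin

lemma cross_unitVec (θ φ : ℝ) : cross (unitVec θ) (unitVec φ) = Real.sin (φ - θ) := by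
  simp only [cross, unitVec_zero, unitVec_one, Real.sin_sub]; ring

/-- Polar coordinates relative to the direction of angle `θ`, for a vector to its left. -/
lemma exists_polar_of_cross_pos {θ : ℝ} {z : Plane} (h : 0 < cross (unitVec θ) z) :
    ∃ ρ : ℝ, 0 < ρ ∧ ∃ φ ∈ Ioo 0 Real.pi, z = ρ • unitVec (θ + φ) := by
  set w : ℂ := ⟨Real.cos θ * z 0 + Real.sin θ * z 1, cross (unitVec θ) z⟩ with hw
  have hw0 : w ≠ 0 := fun h0 => h.ne' (congrArg Complex.im h0)
  have h1 := Complex.norm_mul_cos_arg w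
  have h2 := Complex.norm_mul_sin_arg w
  have hn : 0 < ‖w‖ := norm_pos_iff.2 hw0
  have hre : w.re = Real.cos θ * z 0 + Real.sin θ * z 1 := rfl
  have him : w.im = Real.cos θ * z 1 - Real.sin θ * z 0 := by
    simp [hw, cross, unitVec_zero, unitVec_one]
  have harg : 0 < Complex.arg w := by
    refine lt_of_le_of_ne (Complex.arg_nonneg_iff.2 h.le) fun h0 => ?_
    rw [← h0, Real.sin_zero, mul_zero] at h2
    exact h.ne h2
  have harg' : Complex.arg w < Real.pi := by
    refine lt_of_le_of_ne (Complex.arg_le_pi w) fun h0 => ?_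
    rw [h0, Real.sin_pi, mul_zero] at h2
    exact h.ne h2
  have hcs := Real.sin_sq_add_cos_sq θ
  refine ⟨‖w‖, hn, Complex.arg w, ⟨harg, harg'⟩, plane_ext ?_ ?_⟩
  · rw [PiLp.smul_apply, smul_eq_mul, unitVec_zero, Real.cos_add]
    have : ‖w‖ * (Real.cos θ * Real.cos w.arg - Real.sin θ * Real.sin w.arg) =
        Real.cos θ * w.re - Real.sin θ * w.im := by rw [← h1, ← h2]; ring
    rw [this, hre, him]
    linear_combination (-z 0) * hcs
  · rw [PiLp.smul_apply, smul_eq_mul, unitVec_one, Real.sin_add]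
    have : ‖w‖ * (Real.sin θ * Real.cos w.arg + Real.cos θ * Real.sin w.arg) =
        Real.sin θ * w.re + Real.cos θ * w.im := by rw [← h1, ← h2]; ring
    rw [this, hre, him]
    linear_combination (-z 1) * hcs

lemma exists_polar {z : Plane} (h : z ≠ 0) : ∃ ρ : ℝ, 0 < ρ ∧ ∃ θ : ℝ, z = ρ • unitVec θ := by
  set w : ℂ := ⟨z 0, z 1⟩ with hw
  have hw0 : w ≠ 0 := fun h0 => h (plane_ext (congrArg Complex.re h0) (congrArg Complex.im h0))
  refine ⟨‖w‖, norm_pos_iff.2 hw0, Complex.arg w, plane_ext ?_ ?_⟩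
  · rw [PiLp.smul_apply, smul_eq_mul, unitVec_zero, Complex.norm_mul_cos_arg]
  · rw [PiLp.smul_apply, smul_eq_mul, unitVec_one, Complex.norm_mul_sin_arg]

lemma mem_sectorBetween_iff {a x y z : Plane} (h : 0 < cross x y) :
    z ∈ sectorBetween a x y ↔ 0 < cross x (z - a) ∧ 0 < cross (z - a) y := by
  constructor
  · rintro ⟨s, hs, t, ht, rfl⟩
    have e : a + s • x + t • y - a = s • x + t • y := by abel
    rw [e, cross_add_left, cross_add_right]
    simp only [cross_smul_left, cross_smul_right, cross_self_eq_zero, mul_zero, add_zero, zero_add]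
    exact ⟨mul_pos ht h, mul_pos hs h⟩
  · rintro ⟨h1, h2⟩
    refine ⟨_, div_pos h2 h, _, div_pos h1 h, ?_⟩
    rw [add_assoc, ← eq_smul_add_smul h.ne' (z - a)]
    abel

lemma sectorBetween_comm (a x y : Plane) : sectorBetween a x y = sectorBetween a y x := by
  ext z
  constructor <;> rintro ⟨s, hs, t, ht, rfl⟩ <;> exact ⟨t, ht, s, hs, by abel⟩

/-- A convex sector in polar coordinates. -/
lemma exists_sectorBetween_eq_openSector (a : Plane) {x y : Plane} (h : cross x y ≠ 0) :
    ∃ θ₁ θ₂ : ℝ, θ₁ < θ₂ ∧ θ₂ - θ₁ < Real.pi ∧ sectorBetween a x y = openSector a θ₁ θ₂ := by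
  wlog hpos : 0 < cross x y generalizing x y
  · rw [sectorBetween_comm]
    refine this (by rwa [cross_swap, neg_ne_zero]) ?_
    rw [cross_swap, neg_pos]
    exact lt_of_le_of_ne (not_lt.1 hpos) h
  have hx0 : x ≠ 0 := by rintro rfl; rw [cross_zero_left] at h; exact h rfl
  obtain ⟨r, hr, θ, rfl⟩ := exists_polar hx0
  rw [cross_smul_left] at hpos
  have hpos' := pos_of_mul_pos_right hpos hr.le
  obtain ⟨R, hR, δ, hδ, rfl⟩ := exists_polar_of_cross_pos hpos'
  refine ⟨θ, θ + δ, by linarith [hδ.1], by linarith [hδ.2], ?_⟩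
  ext z
  rw [mem_sectorBetween_iff (by rwa [cross_smul_left])]
  constructor
  · rintro ⟨h1, h2⟩
    rw [cross_smul_left] at h1
    obtain ⟨ρ, hρ, φ, hφ, e⟩ := exists_polar_of_cross_pos (pos_of_mul_pos_right h1 hr.le)
    refine ⟨ρ, hρ, θ + φ, ⟨by linarith [hφ.1], ?_⟩, by rw [← e]; abel⟩
    rw [e, cross_smul_left, cross_smul_right, cross_unitVec] at h2
    have h3 := pos_of_mul_pos_right (pos_of_mul_pos_right h2 hρ.le) hR.le
    rw [add_sub_add_left_eq_sub] at h3
    by_contra hle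
    have := Real.sin_nonpos_of_nonpos_of_neg_pi_le (x := δ - φ) (by linarith)
      (by linarith [hφ.2, hδ.1])
    linarith
  · rintro ⟨ρ, hρ, φ, hφ, rfl⟩
    rw [add_sub_cancel_left, cross_smul_left, cross_smul_right, cross_smul_left, cross_smul_right,
      cross_unitVec, cross_unitVec]
    exact ⟨mul_pos hr (mul_pos hρ (Real.sin_pos_of_pos_of_lt_pi (by linarith [hφ.1])
      (by linarith [hφ.2, hδ.2]))), mul_pos hρ (mul_pos hR (Real.sin_pos_of_pos_of_lt_pi
      (by linarith [hφ.2]) (by linarith [hφ.1, hδ.2])))⟩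

lemma isOpen_sectorBetween {a x y : Plane} (h : cross x y ≠ 0) : IsOpen (sectorBetween a x y) := by
  wlog hpos : 0 < cross x y generalizing x y
  · rw [sectorBetween_comm]
    refine this (by rwa [cross_swap, neg_ne_zero]) ?_
    rw [cross_swap, neg_pos]
    exact lt_of_le_of_ne (not_lt.1 hpos) h
  have : sectorBetween a x y = {z | 0 < cross x (z - a)} ∩ {z | 0 < cross (z - a) y} :=
    ext fun z => mem_sectorBetween_iff hpos
  rw [this]
  exact (isOpen_lt (by fun_prop) (by fun_prop)).inter (isOpen_lt (by fun_prop) (by fun_prop))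

lemma convex_sectorBetween (a x y : Plane) : Convex ℝ (sectorBetween a x y) := by
  rintro _ ⟨s, hs, t, ht, rfl⟩ _ ⟨s', hs', t', ht', rfl⟩ b c hb hc hbc
  have hpos : ∀ m n : ℝ, 0 < m → 0 < n → 0 < b * m + c * n := by
    intro m n hm hn
    rcases hb.eq_or_lt with rfl | hb
    · have : c = 1 := by linarith
      subst this; linarith
    · exact add_pos_of_pos_of_nonneg (mul_pos hb hm) (mul_nonneg hc hn.le)
  refine ⟨_, hpos s s' hs hs', _, hpos t t' ht ht', ?_⟩
  have : c = 1 - b := by linarith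
  subst this
  module

/-- If the Hessian annihilates the radial direction on a convex sector, then `u` is conical there:
Euler's expression `u z - Du z (z - a)` is constant. -/
theorem isConicalOn_sectorBetween (hP : P.Finite) (hu : IsSolutionOff u P) {a x y : Plane}
    (h : cross x y ≠ 0) (hS : ∀ z ∈ sectorBetween a x y, z ∉ P ∧ hess u z (z - a) = 0) :
    IsConicalOn u a (sectorBetween a x y) := by
  have hSo := isOpen_sectorBetween (a := a) h
  obtain ⟨u₀, hu₀⟩ : ∃ u₀, ∀ z ∈ sectorBetween a x y, u z - fderiv ℝ u z (z - a) = u₀ := by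
    have hd : ∀ z ∈ sectorBetween a x y,
        HasFDerivAt (fun z => u z - fderiv ℝ u z (z - a)) (0 : Plane →L[ℝ] ℝ) z := by
      intro z hz
      obtain ⟨hzP, hzn⟩ := hS z hz
      have h1 := (differentiableAt_of_notMem hP hu hzP).hasFDerivAt
      have h2 := (hasFDerivAt_fderiv hP hu hzP).clm_apply ((hasFDerivAt_id z).sub_const a)
      refine (h1.sub h2).congr_fderiv ?_
      ext w
      have h3 : hess u z w (z - a) = 0 := by rw [hess_symm hP hu hzP, hzn]; rfl
      rw [map_sub] at h3
      simp
      linarith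
    refine hSo.exists_is_const_of_fderiv_eq_zero (convex_sectorBetween a x y).isPreconnected
      (fun z hz => (hd z hz).differentiableAt.differentiableWithinAt) fun z hz => (hd z hz).fderiv
  obtain ⟨θ₁, θ₂, h1, h2, h3⟩ := exists_sectorBetween_eq_openSector a h
  have hmem : ∀ ρ : ℝ, 0 < ρ → ∀ θ ∈ Ioo θ₁ θ₂, a + ρ • unitVec θ ∈ sectorBetween a x y :=
    fun ρ hρ θ hθ => h3 ▸ ⟨ρ, hρ, θ, hθ, rfl⟩
  refine ⟨θ₁, θ₂, sub_pos.2 h1, by linarith [Real.pi_pos], h3, u₀,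
    fun θ => u (a + unitVec θ) - u₀, ?_, ?_⟩
  · intro θ hθ
    have hmem1 := (hS _ (hmem 1 one_pos θ hθ)).1
    rw [one_smul] at hmem1
    refine ContDiffAt.contDiffWithinAt (ContDiffAt.sub ?_ contDiffAt_const)
    exact (contDiffAt_of_notMem hP hu hmem1).comp (f := fun θ => a + unitVec θ) θ
      (contDiff_const.add contDiff_unitVec).contDiffAt
  · intro ρ hρ θ hθ
    set e := unitVec θ
    have hd : ∀ τ ∈ Ioi (0 : ℝ), HasDerivAt (fun τ : ℝ => (u (a + τ • e) - u₀) / τ) 0 τ := by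
      intro τ hτ
      have hz := hmem τ hτ θ hθ
      have k1 := (differentiableAt_of_notMem hP hu (hS _ hz).1).hasFDerivAt
      have k2 : HasDerivAt (fun τ : ℝ => a + τ • e) e τ := by
        simpa using ((hasDerivAt_id τ).smul_const e).const_add a
      have k3 := ((k1.comp_hasDerivAt τ k2).sub_const u₀).div (hasDerivAt_id τ) (ne_of_gt hτ)
      have k4 := hu₀ _ hz
      rw [add_sub_cancel_left, map_smul, smul_eq_mul] at k4
      refine k3.congr_deriv (div_eq_zero_iff.2 (Or.inl ?_))
      change fderiv ℝ u (a + τ • e) e * τ - (u (a + τ • e) - u₀) * 1 = 0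
      linarith
    have hc := isOpen_Ioi.is_const_of_deriv_eq_zero isPreconnected_Ioi
      (fun τ hτ => (hd τ hτ).differentiableAt.differentiableWithinAt) (fun τ hτ => (hd τ hτ).deriv)
      (show ρ ∈ Ioi (0 : ℝ) from hρ) (show (1 : ℝ) ∈ Ioi (0 : ℝ) from mem_Ioi.2 one_pos)
    simp only [one_smul, div_one] at hc
    rw [div_eq_iff hρ.ne'] at hc
    linarith

/-! ### Affine part and continuity at the singular points -/

lemma notMem_interior_of_extreme {K : Set Plane} {q : Plane} (hq : q ∈ K.extremePoints ℝ) :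
    q ∉ interior K := by
  intro hi
  have hev : ∀ᶠ t : ℝ in 𝓝 0, q + t • e₀ ∈ K := by
    have hc : ContinuousAt (fun t : ℝ => q + t • e₀) 0 := by fun_prop
    exact hc.eventually (by simpa using mem_interior_iff_mem_nhds.1 hi)
  obtain ⟨ε, hε, hball⟩ := Metric.eventually_nhds_iff.1 hev
  have h1 := hball (y := ε / 2) (by rw [dist_zero_right, Real.norm_eq_abs, abs_of_pos] <;> linarith)
  have h2 := hball (y := -(ε / 2))
    (by rw [dist_zero_right, norm_neg, Real.norm_eq_abs, abs_of_pos] <;> linarith)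
  have h3 := hq.2 h1 h2 ⟨1 / 2, 1 / 2, by norm_num, by norm_num, by norm_num, by module⟩
  have h4 : (ε / 2) • e₀ = 0 := by rwa [add_eq_left] at h3
  rcases smul_eq_zero.1 h4 with h5 | h5
  · linarith
  · simpa [e₀] using congrArg (fun z : Plane => z 0) h5

/-- The solution is affine on the convex hull of its singular set. -/
lemma HasTangentRays.exists_affine {σ : ℝ} (hH : HasTangentRays u P σ) (hσ : σ ≠ 0)
    (hP : P.Finite) (hne : P.Nonempty) (hu : IsSolutionOff u P)
    (hint : (interior (convexHull ℝ P)).Nonempty) :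
    ∃ g : Plane →ᵃ[ℝ] ℝ, EqOn u g (convexHull ℝ P \ P) := by
  have hext := hH.extremePoints_convexHull hσ hP hne hu hint
  have hiP : interior (convexHull ℝ P) ⊆ Pᶜ := fun z hz hzP =>
    notMem_interior_of_extreme (by rwa [hext]) hz
  obtain ⟨g, hg⟩ := exists_eqOn_affine hP hu isOpen_interior (convex_convexHull ℝ P).interior hiP
    fun z hz => hH.lap_eq_zero_of_mem_interior hσ hP hne hu hz (hiP hz)
  refine ⟨g, fun z hz => ?_⟩
  by_contra hne'
  have hgc : Continuous g := g.continuous_of_finiteDimensional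
  have hev : ∀ᶠ y in 𝓝 z, u y - g y ≠ 0 :=
    ((differentiableAt_of_notMem hP hu hz.2).continuousAt.sub hgc.continuousAt).eventually_ne
      (sub_ne_zero.2 hne')
  have hz' : z ∈ closure (interior (convexHull ℝ P)) := by
    rw [(convex_convexHull ℝ P).closure_interior_eq_closure_of_nonempty_interior hint]
    exact subset_closure hz.1
  obtain ⟨y, hy1, hy2⟩ := (mem_closure_iff_nhds.1 hz') _ hev
  exact hy1 (sub_eq_zero.2 (hg hy2))

/-- Along a segment in a null direction the gradient is constant. -/
lemma fderiv_eq_of_null_segment (hP : P.Finite) (hu : IsSolutionOff u P) {y x : Plane} {T : ℝ}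
    (hT : 0 ≤ T) (hseg : ∀ τ ∈ Icc 0 T, y + τ • x ∉ P ∧ hess u (y + τ • x) x = 0) :
    fderiv ℝ u (y + T • x) = fderiv ℝ u y := by
  have hd : ∀ τ ∈ Icc 0 T, HasDerivAt (fun τ : ℝ => fderiv ℝ u (y + τ • x)) 0 τ := by
    intro τ hτ
    obtain ⟨h1, h2⟩ := hseg τ hτ
    have k2 : HasDerivAt (fun τ : ℝ => y + τ • x) x τ := by
      simpa using ((hasDerivAt_id τ).smul_const x).const_add y
    have := (hasFDerivAt_fderiv hP hu h1).comp_hasDerivAt τ k2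
    rwa [h2] at this
  have h := constant_of_has_deriv_right_zero
    (fun τ hτ => (hd τ hτ).continuousAt.continuousWithinAt)
    (fun τ hτ => (hd τ (Ico_subset_Icc_self hτ)).hasDerivWithinAt) T ⟨hT, le_rfl⟩
  simpa using h

/-- Near a point `q ∈ P`, but outside the convex hull of `P`, a null segment leads away from `q`. -/
lemma HasTangentRays.exists_null_segment {σ : ℝ} (hH : HasTangentRays u P σ) (hσ : σ ≠ 0)
    (hP : P.Finite) (hne : P.Nonempty) {q : Plane} {r : ℝ}
    (hrP : ∀ z ∈ Metric.ball q r, z ≠ q → z ∉ P) {y : Plane} (hy : y ∈ Metric.ball q (r / 4))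
    (hyK : y ∉ convexHull ℝ P) : ∃ x : Plane, ‖x‖ = 1 ∧ 0 ≤ inner ℝ (y - q) x ∧
      ∀ τ ∈ Icc 0 (r / 2), y + τ • x ∉ P → hess u (y + τ • x) x = 0 := by
  obtain ⟨q', hq', -, hray⟩ := hH.exists_of_notMem_convexHull hσ hP hne hyK
  have hyq : y - q' ≠ 0 := by
    intro h
    rw [sub_eq_zero.1 h] at hyK
    exact hyK (subset_convexHull ℝ P hq')
  have hL : 0 < ‖y - q'‖ := norm_pos_iff.2 hyq
  have hnull : ∀ c : ℝ, 0 < 1 + c * ‖y - q'‖⁻¹ → y + c • ‖y - q'‖⁻¹ • (y - q') ∉ P →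
      hess u (y + c • ‖y - q'‖⁻¹ • (y - q')) (y - q') = 0 := by
    intro c hc hcP
    have e : y + c • ‖y - q'‖⁻¹ • (y - q') = q' + (1 + c * ‖y - q'‖⁻¹) • (y - q') := by module
    rw [e] at hcP ⊢
    exact hray _ hc hcP
  have hnorm : ‖‖y - q'‖⁻¹ • (y - q')‖ = 1 := by
    rw [norm_smul, norm_inv, norm_norm, inv_mul_cancel₀ hL.ne']
  by_cases hin : 0 ≤ inner ℝ (y - q) (y - q')
  · refine ⟨‖y - q'‖⁻¹ • (y - q'), hnorm, ?_, fun τ hτ hτP => ?_⟩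
    · rw [inner_smul_right]
      exact mul_nonneg (inv_nonneg.2 hL.le) hin
    · rw [map_smul, hnull τ (by have := mul_nonneg hτ.1 (inv_nonneg.2 hL.le); linarith) hτP,
        smul_zero]
  · refine ⟨-(‖y - q'‖⁻¹ • (y - q')), by rw [norm_neg, hnorm], ?_, fun τ hτ hτP => ?_⟩
    · rw [inner_neg_right, inner_smul_right, neg_nonneg]
      exact mul_nonpos_of_nonneg_of_nonpos (inv_nonneg.2 hL.le) (not_le.1 hin).le
    · have hqq : q' ≠ q := by
        rintro rfl
        exact hin real_inner_self_nonneg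
      have hfar : r ≤ ‖q' - q‖ := by
        by_contra hlt
        exact hrP q' (by rwa [Metric.mem_ball, dist_eq_norm, ← not_le]) hqq hq'
      rw [Metric.mem_ball, dist_eq_norm] at hy
      have hL2 : r / 2 < ‖y - q'‖ := by
        have := norm_sub_le_norm_sub_add_norm_sub q' y q
        rw [norm_sub_rev q' y] at this
        linarith
      rw [smul_neg, ← neg_smul] at hτP ⊢
      rw [map_neg, map_smul, hnull (-τ) ?_ hτP, smul_zero, neg_zero]
      rw [neg_mul, ← div_eq_mul_inv, ← sub_eq_add_neg, sub_pos, div_lt_one hL]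
      linarith [hτ.2]

/-- The gradient is bounded near the singular points. -/
lemma HasTangentRays.exists_bound_fderiv {σ : ℝ} (hH : HasTangentRays u P σ) (hσ : σ ≠ 0)
    (hP : P.Finite) (hne : P.Nonempty) (hu : IsSolutionOff u P)
    (hint : (interior (convexHull ℝ P)).Nonempty) (q : Plane) :
    ∃ r > 0, ∃ C, ∀ z ∈ Metric.ball q r, z ≠ q → z ∉ P ∧ ‖fderiv ℝ u z‖ ≤ C := by
  obtain ⟨r, hr, hrP⟩ := exists_ball_inter_subset hP q
  obtain ⟨g, hg⟩ := hH.exists_affine hσ hP hne hu hint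
  -- null segments carry the gradient from points close to `q` to this compact annulus
  set A : Set Plane := Metric.closedBall q (3 * r / 4) \ Metric.ball q (r / 2) with hA
  have hAc : IsCompact A := (isCompact_closedBall q _).diff Metric.isOpen_ball
  have hAP : ∀ z ∈ A, z ∉ P := by
    rintro z ⟨h1, h2⟩
    refine hrP z ?_ ?_
    · rw [Metric.mem_closedBall] at h1
      rw [Metric.mem_ball]
      linarith
    · rintro rfl
      exact h2 (Metric.mem_ball_self (by linarith))
  obtain ⟨C, hC⟩ := hAc.exists_bound_of_continuousOn (f := fderiv ℝ u) fun z hz =>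
    (hasFDerivAt_fderiv hP hu (hAP z hz)).continuousAt.continuousWithinAt
  set G : Plane →L[ℝ] ℝ := LinearMap.toContinuousLinearMap g.linear with hG
  have hgd : ∀ z, HasFDerivAt g G z := fun z => by
    rw [g.decomp]
    exact G.hasFDerivAt.add_const (g 0)
  have hzP : ∀ z ∈ Metric.ball q (r / 4), z ≠ q → z ∉ P := fun z hz =>
    hrP z (Metric.ball_subset_ball (by linarith) hz)
  have hext := hH.extremePoints_convexHull hσ hP hne hu hint
  have hin : ∀ z ∈ interior (convexHull ℝ P), fderiv ℝ u z = G := by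
    intro z hz
    refine ((hgd z).congr_of_eventuallyEq ?_).fderiv
    filter_upwards [isOpen_interior.mem_nhds hz] with y hy
    exact hg ⟨interior_subset hy, fun h => notMem_interior_of_extreme (by rwa [hext]) hy⟩
  refine ⟨r / 4, by linarith, max C ‖G‖, fun z hz hzq => ⟨hzP z hz hzq, ?_⟩⟩
  by_cases hzK : z ∈ convexHull ℝ P
  · refine le_trans ?_ (le_max_right _ _)
    by_contra! hlt
    have hev : ∀ᶠ y in 𝓝 z, ‖G‖ < ‖fderiv ℝ u y‖ :=
      (hasFDerivAt_fderiv hP hu (hzP z hz hzq)).continuousAt.norm.eventually (lt_mem_nhds hlt)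
    have hz' : z ∈ closure (interior (convexHull ℝ P)) := by
      rw [(convex_convexHull ℝ P).closure_interior_eq_closure_of_nonempty_interior hint]
      exact subset_closure hzK
    obtain ⟨y, hy1, hy2⟩ := (mem_closure_iff_nhds.1 hz') _ hev
    have : ‖G‖ < ‖fderiv ℝ u y‖ := hy1
    rw [hin y hy2] at this
    exact this.false
  · refine le_trans ?_ (le_max_left _ _)
    obtain ⟨x, hx1, hx2, hx3⟩ := hH.exists_null_segment hσ hP hne hrP hz hzK
    have hsq : ∀ τ : ℝ, 0 ≤ τ → τ ^ 2 + ‖z - q‖ ^ 2 ≤ ‖z + τ • x - q‖ ^ 2 := by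
      intro τ hτ
      rw [add_sub_right_comm, norm_add_sq_real, inner_smul_right, norm_smul, hx1, mul_one,
        Real.norm_eq_abs, sq_abs]
      nlinarith [mul_nonneg hτ hx2]
    have hz1 : ‖z - q‖ < r / 4 := by rwa [Metric.mem_ball, dist_eq_norm] at hz
    have hz0 : 0 < ‖z - q‖ := norm_pos_iff.2 (sub_ne_zero.2 hzq)
    have hle : ∀ τ : ℝ, 0 ≤ τ → ‖z + τ • x - q‖ ≤ ‖z - q‖ + τ := by
      intro τ hτ
      rw [add_sub_right_comm]
      refine (norm_add_le _ _).trans_eq ?_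
      rw [norm_smul, hx1, mul_one, Real.norm_eq_abs, abs_of_nonneg hτ]
    rw [← fderiv_eq_of_null_segment hP hu (y := z) (x := x) (T := r / 2) (by linarith) ?_]
    · refine hC _ ⟨?_, ?_⟩
      · rw [Metric.mem_closedBall, dist_eq_norm]
        linarith [hle (r / 2) (by linarith)]
      · rw [Metric.mem_ball, dist_eq_norm, not_lt]
        refine le_of_sq_le_sq ?_ (norm_nonneg _)
        nlinarith [hsq (r / 2) (by linarith)]
    · intro τ hτ
      have h1 : z + τ • x ∉ P := by
        refine hrP _ ?_ fun h => ?_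
        · rw [Metric.mem_ball, dist_eq_norm]
          linarith [hle τ hτ.1, hτ.2]
        · have := hsq τ hτ.1
          rw [h, sub_self, norm_zero] at this
          nlinarith
      exact ⟨h1, hx3 τ hτ h1⟩

lemma HasTangentRays.tendsto_affine {σ : ℝ} (hH : HasTangentRays u P σ) (hσ : σ ≠ 0)
    (hP : P.Finite) (hne : P.Nonempty) (hu : IsSolutionOff u P)
    (hint : (interior (convexHull ℝ P)).Nonempty) {g : Plane →ᵃ[ℝ] ℝ}
    (hg : EqOn u g (convexHull ℝ P \ P)) {q : Plane} (hq : q ∈ P) :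
    Tendsto u (𝓝[≠] q) (𝓝 (g q)) := by
  obtain ⟨r, hr, C, hC⟩ := hH.exists_bound_fderiv hσ hP hne hu hint q
  have hext := hH.extremePoints_convexHull hσ hP hne hu hint
  have hgc : Continuous g := g.continuous_of_finiteDimensional
  have hq' : q ∈ closure (interior (convexHull ℝ P)) := by
    rw [(convex_convexHull ℝ P).closure_interior_eq_closure_of_nonempty_interior hint]
    exact subset_closure (subset_convexHull ℝ P hq)
  have : (𝓝[interior (convexHull ℝ P)] q).NeBot := mem_closure_iff_nhdsWithin_neBot.1 hq'
  have hkey : ∀ z ∈ Metric.ball q r, z ≠ q → ‖u z - g q‖ ≤ C * ‖z - q‖ := by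
    intro z hz hzq
    have h1 : Tendsto (fun y => ‖u z - g y‖) (𝓝[interior (convexHull ℝ P)] q)
        (𝓝 ‖u z - g q‖) :=
      (continuous_const.sub hgc).norm.continuousAt.tendsto.mono_left nhdsWithin_le_nhds
    have h2 : Tendsto (fun y => C * ‖z - y‖) (𝓝[interior (convexHull ℝ P)] q)
        (𝓝 (C * ‖z - q‖)) :=
      (Continuous.tendsto (by fun_prop) q).mono_left nhdsWithin_le_nhds
    refine le_of_tendsto_of_tendsto h1 h2 ?_
    filter_upwards [self_mem_nhdsWithin, mem_nhdsWithin_of_mem_nhds (Metric.ball_mem_nhds q hr)]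
      with y hy hyr
    have hyP : y ∉ P := fun h => notMem_interior_of_extreme (by rwa [hext]) hy
    have hyq : y ≠ q := fun h => hyP (h ▸ hq)
    rw [← hg ⟨interior_subset hy, hyP⟩]
    exact norm_sub_le_of_punctured
      (fun w hw hwq => (differentiableAt_of_notMem hP hu (hC w hw hwq).1).hasFDerivAt)
      (fun w hw hwq => (hC w hw hwq).2) hyr hyq hz hzq
  rw [tendsto_iff_norm_sub_tendsto_zero]
  have hlim : Tendsto (fun z => C * ‖z - q‖) (𝓝[≠] q) (𝓝 0) :=
    (Continuous.tendsto' (by fun_prop) _ _ (by simp)).mono_left nhdsWithin_le_nhds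
  refine squeeze_zero' (Eventually.of_forall fun z => norm_nonneg _) ?_ hlim
  filter_upwards [self_mem_nhdsWithin, mem_nhdsWithin_of_mem_nhds (Metric.ball_mem_nhds q hr)]
    with z hz hzr using hkey z hzr hz

/-! ### Sides and sectors of the polygon -/

/-- A segment between two points of `P` on a supporting line lies in the boundary of the convex
hull. -/
lemma segment_subset_frontier {a b : Plane} (ha : a ∈ P) (hb : b ∈ P) (hab : a ≠ b) {s : ℝ}
    (hs : s ≠ 0) (h : ∀ p ∈ P, 0 ≤ s * cross (b - a) (p - a)) :
    segment ℝ a b ⊆ frontier (convexHull ℝ P) := by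
  intro z hz
  refine ⟨subset_closure ((convex_convexHull ℝ P).segment_subset (subset_convexHull ℝ P ha)
    (subset_convexHull ℝ P hb) hz), fun hi => ?_⟩
  have hd : s • (b - a) ≠ 0 := smul_ne_zero hs (sub_ne_zero.2 hab.symm)
  refine cross_ne_zero_of_mem_interior (q := a) hd hi (Or.inl ?_) ?_
  · exact cross_nonneg_of_mem_convexHull fun p hp => by rw [cross_smul_left]; exact h p hp
  · obtain ⟨θ, -, rfl⟩ := (segment_eq_image' ℝ a b ▸ hz :
      z ∈ (fun θ : ℝ => a + θ • (b - a)) '' Icc 0 1)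
    rw [add_sub_cancel_left, cross_smul_left, cross_smul_right, cross_self_eq_zero, mul_zero,
      mul_zero]

lemma add_one_ne_self_fin {n : ℕ} [NeZero n] (hn : 3 ≤ n) (i : Fin n) :
    i + 1 ≠ i ∧ i - 1 ≠ i ∧ i + 1 ≠ i - 1 := by
  obtain ⟨m, rfl⟩ : ∃ m, n = m + 3 := ⟨n - 3, by omega⟩
  have h1 : (1 : Fin (m + 3)) ≠ 0 := by simp
  have h2 : (1 : Fin (m + 3)) + 1 ≠ 0 := by
    intro h
    have := congrArg Fin.val h
    rw [Fin.val_add, Fin.val_one', Fin.val_zero, Nat.mod_eq_of_lt (by omega : 1 < m + 3),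
      Nat.mod_eq_of_lt (by omega)] at this
    omega
  refine ⟨?_, ?_, ?_⟩
  · simp
  · simp
  · intro h
    apply h2
    have : i + (1 + 1) = i := by rw [← add_assoc, h, sub_add_cancel]
    simpa using this

/-- The tangent rays that sweep the sector between two consecutive sides all issue from the common
end point of these sides. -/
lemma HasTangentRays.conical {σ : ℝ} (hH : HasTangentRays u P σ) (hP : P.Finite)
    (hu : IsSolutionOff u P) {a b c : Plane} (ha : a ∈ P) (hb : b ∈ P) (hab : b ≠ a)
    (hca : c ≠ a) (hbc : b ≠ c)
    (h1 : ∀ p ∈ P, p ≠ a → p ≠ b → 0 < σ * cross (b - a) (p - a))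
    (h2 : ∀ p ∈ P, p ≠ c → p ≠ a → 0 < σ * cross (a - c) (p - c)) :
    IsConicalOn u a (sectorBetween a (b - a) (a - c)) := by
  have h2' : ∀ p, cross (a - c) (p - c) = cross (a - c) (p - a) := fun p => by
    have : p - c = (p - a) + (a - c) := by abel
    rw [this, cross_add_right, cross_self_eq_zero, add_zero]
  have hcontact : ∀ s t : ℝ, 0 < s → 0 < t → ∀ p ∈ P, p ≠ a →
      0 < σ * cross (s • (b - a) + t • (a - c)) (p - a) := by
    intro s t hs ht p hp hpa
    have e : σ * cross (s • (b - a) + t • (a - c)) (p - a) =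
        s * (σ * cross (b - a) (p - a)) + t * (σ * cross (a - c) (p - c)) := by
      rw [h2', cross_add_left, cross_smul_left, cross_smul_left]; ring
    rw [e]
    by_cases hpb : p = b
    · subst hpb
      rw [cross_self_eq_zero, mul_zero, mul_zero, zero_add]
      exact mul_pos ht (h2 p hp hbc hpa)
    · by_cases hpc : p = c
      · subst hpc
        rw [sub_self, cross_zero_right, mul_zero, mul_zero, add_zero]
        exact mul_pos hs (h1 p hp hpa hpb)
      · exact add_pos (mul_pos hs (h1 p hp hpa hpb)) (mul_pos ht (h2 p hp hpc hpa))
  refine isConicalOn_sectorBetween hP hu ?_ ?_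
  · intro h0
    have := h2 b hb hbc hab
    rw [h2', cross_swap, h0, neg_zero, mul_zero] at this
    exact this.false
  · rintro z ⟨s, hs, t, ht, rfl⟩
    set v := s • (b - a) + t • (a - c) with hv
    have e : a + s • (b - a) + t • (a - c) = a + v := by rw [hv, add_assoc]
    rw [e, add_sub_cancel_left]
    have hvP : a + v ∉ P := by
      intro hvP
      by_cases h0 : v = 0
      · have := hcontact s t hs ht b hb hab
        rw [← hv, h0, cross_zero_left, mul_zero] at this
        exact this.false
      · have := hcontact s t hs ht _ hvP (by simpa using h0)
        rw [← hv, add_sub_cancel_left, cross_self_eq_zero, mul_zero] at this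
        exact this.false
    refine ⟨hvP, ?_⟩
    obtain ⟨q, hq, hqs, hqr⟩ := hH v
    have hqa : q = a := by
      by_contra hne
      have k1 := hcontact s t hs ht q hq hne
      have k2 := hqs a ha
      rw [← hv] at k1
      rw [← neg_sub q a, cross_neg_right] at k2
      linarith
    subst hqa
    have := hqr 1 one_pos
    rw [one_smul] at this
    exact this hvP

end

/-! ### Singular solutions with at least three singularities -/

theorem theorem4 (n : ℕ) [NeZero n] (hn : 3 ≤ n) (p : Fin n → Plane)
    (hp : Function.Injective p) (u : Plane → ℝ)
    (hu : IsSolutionOff u (Set.range p)) (hadm : IsAdmissible u (Set.range p)) :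
    ∃ C : Set Plane,
      IsConvexPolygon C ∧ (interior C).Nonempty ∧ C.extremePoints ℝ = Set.range p ∧
      (∃ g : Plane →ᵃ[ℝ] ℝ, Set.EqOn u g (C \ Set.range p) ∧
        ∀ i : Fin n, Tendsto u (𝓝[≠] (p i)) (𝓝 (g (p i)))) ∧
      ∃ σ : Equiv.Perm (Fin n),
        FollowsBoundary (fun i => p (σ i)) C ∧
        ∀ i : Fin n, IsConicalOn u (p (σ i))
          (sectorBetween (p (σ i)) (p (σ (i + 1)) - p (σ i)) (p (σ i) - p (σ (i - 1)))) := by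
  have hP : (range p).Finite := finite_range p
  have hne : (range p).Nonempty := ⟨p 0, mem_range_self 0⟩
  have hcard : 3 ≤ (range p).ncard := by
    rw [← Set.image_univ, Set.ncard_image_of_injective _ hp, Set.ncard_univ, Nat.card_eq_fintype_card,
      Fintype.card_fin]
    exact hn
  have hcol : ∀ v : Plane, v ≠ 0 → ∃ q ∈ range p, ∃ q' ∈ range p, cross v q < cross v q' :=
    fun v hv => exists_cross_lt hP hu hadm hcard hv
  obtain ⟨s, hs, hH⟩ := exists_hasTangentRays hP hne hu hadm hcol
  have hs0 : s ≠ 0 := by rcases hs with rfl | rfl <;> norm_num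
  have hint := interior_convexHull_nonempty hne hcol
  have hext := hH.extremePoints_convexHull hs0 hP hne hu hint
  obtain ⟨g, hg⟩ := hH.exists_affine hs0 hP hne hu hint
  have hsep : ∀ i, ∃ m : Plane, ∀ j, j ≠ i → 0 < cross m (p j - p i) := fun i => by
    obtain ⟨m, hm⟩ := exists_cross_pos_of_extreme hP hext (mem_range_self i)
    exact ⟨m, fun j hj => hm _ (mem_range_self j) (hp.ne hj)⟩
  obtain ⟨σ, hσ⟩ := exists_perm_side hp hsep hs0
  have hside : ∀ i, ∀ q ∈ range p, q ≠ p (σ i) → q ≠ p (σ (i + 1)) →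
      0 < s * cross (p (σ (i + 1)) - p (σ i)) (q - p (σ i)) := by
    rintro i _ ⟨k, rfl⟩ h1 h2
    obtain ⟨j, rfl⟩ := σ.surjective k
    exact hσ i j (fun h => h1 (by rw [h])) fun h => h2 (by rw [h])
  have hinj : Function.Injective fun i => p (σ i) := hp.comp σ.injective
  refine ⟨convexHull ℝ (range p), ⟨Finset.univ.image p, by simp⟩, hint, hext,
    ⟨g, hg, fun i => hH.tendsto_affine hs0 hP hne hu hint hg (mem_range_self i)⟩, σ, ?_, ?_⟩
  · intro i
    refine segment_subset_frontier (mem_range_self _) (mem_range_self _)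
      (hinj.ne (add_one_ne_self_fin hn i).1.symm) hs0 fun q hq => ?_
    by_cases h1 : q = p (σ i)
    · rw [h1, sub_self, cross_zero_right, mul_zero]
    · by_cases h2 : q = p (σ (i + 1))
      · rw [h2, cross_self_eq_zero, mul_zero]
      · exact (hside i q hq h1 h2).le
  · intro i
    obtain ⟨k1, k2, k3⟩ := add_one_ne_self_fin hn i
    have h2 := hside (i - 1)
    rw [sub_add_cancel] at h2
    exact hH.conical hP hu (mem_range_self _) (mem_range_self _) (hinj.ne k1) (hinj.ne k2)
      (hinj.ne k3) (hside i) h2
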